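/- **Theorem 4.1.** All closures of products of subsets below denote closed linear spans, ideals of C\*-algebras are closed and two-sided, and $M(B)$ is the multiplier algebra of a C\*-algebra $B$. *Exel systems.* An Exel system $(A,\alpha,L)$ consists of a C\*-algebra $A$; an endomorphism $\alpha$ of $A$ that is extendible, i.e. is the restriction to $A$ of a strictly continuous endomorphism $\overline\alpha$ of $M(A)$; and a transfer operator $L$, i.e. a bounded positive linear map $L:A\to A$ which extends to a bounded positive linear map $\overline L:M(A)\to M(A)$ such that $L(\alpha(a)m)=a\overline L(m)$ for $a\in A$, $m\in M(A)$. *Toeplitz representations.* Let $M$ be a right Hilbert $A$-module with a left action $a\cdot x=\phi(a)x$ given by a homomorphism $\phi$ of $A$ into the adjointable operators on $M$. Write $\Theta_{x,y}(z)=x\cdot\langle y,z\rangle$ and $\mathcal K(M)=\overline{\operatorname{span}}\{\Theta_{x,y}\}$. A Toeplitz representation $(\psi,\pi)$ of $M$ in a C\*-algebra $B$ consists of a linear map $\psi:M\to B$ and a homomorphism $\pi:A\to B$ with $\psi(x\cdot a)=\psi(x)\pi(a)$, $\psi(x)^*\psi(y)=\pi(\langle x,y\rangle)$ and $\psi(a\cdot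 x)=\pi(a)\psi(x)$. It induces a homomorphism $(\psi,\pi)^{(1)}:\mathcal K(M)\to B$ with $(\psi,\pi)^{(1)}(\Theta_{x,y})=\psi(x)\psi(y)^*$. If $K$ is an ideal of $A$ contained in $\phi^{-1}(\mathcal K(M))$, then $(\psi,\pi)$ is coisometric on $K$ if $(\psi,\pi)^{(1)}(\phi(a))=\pi(a)$ for all $a\in K$. The relative Cuntz–Pimsner algebra $\mathcal O(K,M)$ is the C\*-algebra generated by a universal Toeplitz representation $(k_M,k_A)$ of $M$ that is coisometric on $K$. *The bimodule $M_L$.* Let $M_L$ be the Hilbert $A$-bimodule obtained by (Hausdorff) completing $A$ with respect to $\langle m,n\rangle_L=L(m^*n)$, with right action $m\cdot a=m\alpha(a)$ and left action by left multiplication; let $q:A\to M_L$ be the canonical map. Put $K_\alpha=\overline{A\alpha(A)A}\cap\phi^{-1}(\mathcal K(M_L))$. *The crossed product.* A Toeplitz-covariant representation $(\pi,V)$ of $(A,\alpha,L)$ in a C\*-algebra $B$ consists of a nondegenerate homomorphism $\pi:A\to B$ and an element $V\in M(B)$ with $V\pi(a)=\pi(\alpha(a))V$ and $V^*\pi(a)V=\pi(L(a))$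 for $a\in A$; let $\psi_V:M_L\to B$ be the bounded linear map with $\psi_V(q(a))=\pi(a)V$. The Toeplitz crossed product $\mathcal T(A,\alpha,L)$ is the C\*-algebra generated (by $i(A)\cup i(A)S$) by a universal Toeplitz-covariant representation $(i,S)$. A pair $(i(a),k)$ with $a\in A$ and $k\in\mathcal T(A,\alpha,L)$ is a redundancy if $k\in\overline{i(A)SS^*i(A)}$ and $i(a)i(b)S=k\,i(b)S$ for all $b\in A$. Exel's crossed product $A\rtimes_{\alpha,L}\mathbb N$ is the quotient of $\mathcal T(A,\alpha,L)$ by the ideal generated by the elements $i(a)-k$ such that $(i(a),k)$ is a redundancy and $a\in\overline{A\alpha(A)A}$. Let $Q:\mathcal T(A,\alpha,L)\to A\rtimes_{\alpha,L}\mathbb N$ be the quotient map and $\overline Q$ its extension to multiplier algebras; $(Q\circ i,\overline Q(S))$ is a Toeplitz-covariant representation, with associated map $\psi_{\overline Q(S)}:M_L\to A\rtimes_{\alpha,L}\mathbb N$. *Conclusion.* For every Exel system $(A,\alpha,L)$ there is an isomorphism $\theta$ (of C\*-algebras) of $\mathcal O(K_\alpha,M_L)$ onto $A\rtimes_{\alpha,L}\mathbb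 N$ such that $$\theta\circ k_A=Q\circ i\qquad\text{and}\qquad \theta\circ k_{M_L}=Q\circ\psi_S=\psi_{\overline Q(S)}.$$ -/

import Mathlib

universe u v w

noncomputable section

open Filter Topology
open scoped MultiplierAlgebra

namespace ExelCP

/-! ### C⋆-algebraic preliminaries -/

section Preliminaries

variable {A : Type u} [NonUnitalCStarAlgebra A]

theorem norm_sub_mul_le_of_pos {e c : A} (he : e = star c * c) (he1 : ‖e‖ ≤ 1) (y : A) :
    ‖y - e * y‖ ≤ ‖y‖ ∧ ‖y - y * e‖ ≤ ‖y‖ := by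
  let _ := CStarAlgebra.spectralOrder A
  have := CStarAlgebra.spectralOrderedRing A
  let _ := CStarAlgebra.spectralOrder (Unitization ℂ A)
  have := CStarAlgebra.spectralOrderedRing (Unitization ℂ A)
  have he0 : 0 ≤ e := he ▸ star_mul_self_nonneg c
  have h1 : (e : Unitization ℂ A) ∈ Set.Icc (0 : Unitization ℂ A) 1 :=
    CStarAlgebra.inr_mem_Icc_iff_norm_le.2 ⟨he0, he1⟩
  have h2 : ‖(1 : Unitization ℂ A) - e‖ ≤ 1 :=
    (CStarAlgebra.norm_le_one_iff_of_nonneg _ (sub_nonneg.2 h1.2)).2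
      (sub_le_self _ h1.1)
  constructor
  · rw [← Unitization.norm_inr (𝕜 := ℂ), ← Unitization.norm_inr (𝕜 := ℂ) y]
    calc ‖((y - e * y : A) : Unitization ℂ A)‖ = ‖(1 - (e : Unitization ℂ A)) * y‖ := by
          simp [sub_mul]
      _ ≤ ‖(1 - (e : Unitization ℂ A))‖ * ‖(y : Unitization ℂ A)‖ := norm_mul_le _ _
      _ ≤ 1 * ‖(y : Unitization ℂ A)‖ := by gcongr
      _ = _ := one_mul _
  · rw [← Unitization.norm_inr (𝕜 := ℂ), ← Unitization.norm_inr (𝕜 := ℂ) y]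
    calc ‖((y - y * e : A) : Unitization ℂ A)‖ = ‖(y : Unitization ℂ A) * (1 - e)‖ := by
          simp [mul_sub]
      _ ≤ ‖(y : Unitization ℂ A)‖ * ‖(1 - (e : Unitization ℂ A))‖ := norm_mul_le _ _
      _ ≤ ‖(y : Unitization ℂ A)‖ * 1 := by gcongr
      _ = _ := mul_one _

theorem exists_approx_unit (A : Type u) [NonUnitalCStarAlgebra A] :
    ∃ l : Filter A, l.NeBot ∧ (∀ x : A, Tendsto (fun e => e * x) l (𝓝 x)) ∧
      (∀ x : A, Tendsto (fun e => x * e) l (𝓝 x)) ∧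
      ∀ᶠ e in l, ‖e‖ ≤ 1 ∧ ∃ c, e = star c * c := by
  let _ := CStarAlgebra.spectralOrder A
  have := CStarAlgebra.spectralOrderedRing A
  have H := CStarAlgebra.increasingApproximateUnit A
  refine ⟨CStarAlgebra.approximateUnit A, H.neBot, H.tendsto_mul_right, H.tendsto_mul_left, ?_⟩
  filter_upwards [H.eventually_nonneg, H.eventually_norm] with e he0 he1
  exact ⟨he1, CStarAlgebra.nonneg_iff_eq_star_mul_self.1 he0⟩

theorem eq_of_mul_left {x y : A} (h : ∀ z, z * x = z * y) : x = y := by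
  have h1 : star (x - y) * (x - y) = 0 := by rw [mul_sub, h, sub_self]
  exact sub_eq_zero.1 (CStarRing.star_mul_self_eq_zero_iff _ |>.1 h1)

theorem eq_of_mul_right {x y : A} (h : ∀ z, x * z = y * z) : x = y := by
  have h1 : (x - y) * star (x - y) = 0 := by rw [sub_mul, h, sub_self]
  exact sub_eq_zero.1 (CStarRing.mul_star_self_eq_zero_iff _ |>.1 h1)

theorem multiplier_fst_mul (m : 𝓜(ℂ, A)) (x y : A) : m.fst (x * y) = m.fst x * y :=
  eq_of_mul_left fun z => by
    rw [← m.central, ← mul_assoc, m.central, mul_assoc]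

theorem multiplier_snd_mul (m : 𝓜(ℂ, A)) (x y : A) : m.snd (x * y) = x * m.snd y :=
  eq_of_mul_right fun z => by
    rw [m.central, mul_assoc, ← m.central, mul_assoc]

/-- Equality of multipliers can be tested on left multiplication. -/
theorem multiplier_ext {m n : 𝓜(ℂ, A)} (h : ∀ x, m.fst x = n.fst x) : m = n := by
  refine DoubleCentralizer.ext _ _ _ _ (Prod.ext (ContinuousLinearMap.ext h)
    (ContinuousLinearMap.ext fun x => eq_of_mul_right fun z => ?_))
  rw [m.central, n.central, h]

end Preliminaries

/-! ### Closed ideals and quotient C⋆-algebras -/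

/-- A closed two-sided ideal of a C⋆-algebra. (Closed two-sided ideals of a C⋆-algebra are
automatically self-adjoint; we record this in `star_mem'`.) -/
structure ClosedIdeal (T : Type u) [NonUnitalCStarAlgebra T] extends Submodule ℂ T where
  isClosed' : IsClosed (carrier : Set T)
  mul_left' : ∀ (t : T) {x : T}, x ∈ carrier → t * x ∈ carrier
  mul_right' : ∀ (t : T) {x : T}, x ∈ carrier → x * t ∈ carrier
  star_mem' : ∀ {x : T}, x ∈ carrier → star x ∈ carrier

namespace ClosedIdeal

variable {T : Type u} [NonUnitalCStarAlgebra T]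

/-- The closed ideal generated by a set: the smallest closed ideal containing it. -/
def generatedBy (s : Set T) : ClosedIdeal T where
  toSubmodule := sInf {J : Submodule ℂ T | s ⊆ J ∧ ∃ I : ClosedIdeal T, I.toSubmodule = J}
  isClosed' := by
    change IsClosed ((sInf _ : Submodule ℂ T) : Set T)
    rw [Submodule.coe_sInf]
    refine isClosed_biInter ?_
    rintro J ⟨-, I, rfl⟩
    exact I.isClosed'
  mul_left' := by
    intro t x hx
    change t * x ∈ (sInf _ : Submodule ℂ T)
    change x ∈ (sInf _ : Submodule ℂ T) at hx
    rw [Submodule.mem_sInf] at hx ⊢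
    rintro J ⟨hs, I, rfl⟩
    exact I.mul_left' t (hx _ ⟨hs, I, rfl⟩)
  mul_right' := by
    intro t x hx
    change x * t ∈ (sInf _ : Submodule ℂ T)
    change x ∈ (sInf _ : Submodule ℂ T) at hx
    rw [Submodule.mem_sInf] at hx ⊢
    rintro J ⟨hs, I, rfl⟩
    exact I.mul_right' t (hx _ ⟨hs, I, rfl⟩)
  star_mem' := by
    intro x hx
    change star x ∈ (sInf _ : Submodule ℂ T)
    change x ∈ (sInf _ : Submodule ℂ T) at hx
    rw [Submodule.mem_sInf] at hx ⊢
    rintro J ⟨hs, I, rfl⟩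
    exact I.star_mem' (hx _ ⟨hs, I, rfl⟩)

variable (I : ClosedIdeal T)

/-- The quotient C⋆-algebra `T ⧸ I`, with the quotient norm. -/
def Quot : Type u := T ⧸ I.toSubmodule

instance : IsClosed (I.toSubmodule : Set T) := I.isClosed'

instance : NormedAddCommGroup I.Quot :=
  inferInstanceAs (NormedAddCommGroup (T ⧸ I.toSubmodule))

instance : NormedSpace ℂ I.Quot :=
  inferInstanceAs (NormedSpace ℂ (T ⧸ I.toSubmodule))

instance : CompleteSpace I.Quot :=
  inferInstanceAs (CompleteSpace (T ⧸ I.toSubmodule))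

/-- The class of an element in the quotient. -/
def mkL : T →ₗ[ℂ] I.Quot := I.toSubmodule.mkQ

theorem mkL_surjective : Function.Surjective I.mkL := I.toSubmodule.mkQ_surjective

theorem mkL_eq {x y : T} : I.mkL x = I.mkL y ↔ x - y ∈ I.toSubmodule :=
  Submodule.Quotient.eq _

theorem norm_mkL_le (x : T) : ‖I.mkL x‖ ≤ ‖x‖ := Submodule.Quotient.norm_mk_le _ x

theorem exists_norm_lt (x : I.Quot) {ε : ℝ} (hε : 0 < ε) :
    ∃ m : T, I.mkL m = x ∧ ‖m‖ < ‖x‖ + ε := Submodule.Quotient.norm_mk_lt x hε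

instance : Mul I.Quot where
  mul := Quotient.map₂ (· * ·) (by
    intro a b hab c d hcd
    have h1 : a - b ∈ I.toSubmodule := (Submodule.quotientRel_def _).1 hab
    have h2 : c - d ∈ I.toSubmodule := (Submodule.quotientRel_def _).1 hcd
    refine (Submodule.quotientRel_def _).2 ?_
    have : a * c - b * d = (a - b) * c + b * (c - d) := by noncomm_ring
    change a * c - b * d ∈ _
    rw [this]
    exact add_mem (I.mul_right' _ h1) (I.mul_left' _ h2))

theorem mkL_mul (x y : T) : I.mkL (x * y) = I.mkL x * I.mkL y := rfl

instance : Star I.Quot where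
  star := Quotient.map star (by
    intro a b hab
    have h1 : a - b ∈ I.toSubmodule := (Submodule.quotientRel_def _).1 hab
    refine (Submodule.quotientRel_def _).2 ?_
    rw [← star_sub]
    exact I.star_mem' h1)

theorem mkL_star (x : T) : I.mkL (star x) = star (I.mkL x) := rfl

instance : NonUnitalRing I.Quot where
  left_distrib := by
    intro a b c
    obtain ⟨a, rfl⟩ := I.mkL_surjective a
    obtain ⟨b, rfl⟩ := I.mkL_surjective b
    obtain ⟨c, rfl⟩ := I.mkL_surjective c
    simp only [← mkL_mul, ← map_add, mul_add]
  right_distrib := by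
    intro a b c
    obtain ⟨a, rfl⟩ := I.mkL_surjective a
    obtain ⟨b, rfl⟩ := I.mkL_surjective b
    obtain ⟨c, rfl⟩ := I.mkL_surjective c
    simp only [← mkL_mul, ← map_add, add_mul]
  zero_mul := by
    intro a
    obtain ⟨a, rfl⟩ := I.mkL_surjective a
    rw [← map_zero I.mkL, ← mkL_mul, zero_mul]
  mul_zero := by
    intro a
    obtain ⟨a, rfl⟩ := I.mkL_surjective a
    rw [← map_zero I.mkL, ← mkL_mul, mul_zero]
  mul_assoc := by
    intro a b c
    obtain ⟨a, rfl⟩ := I.mkL_surjective a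
    obtain ⟨b, rfl⟩ := I.mkL_surjective b
    obtain ⟨c, rfl⟩ := I.mkL_surjective c
    simp only [← mkL_mul, mul_assoc]

instance : StarRing I.Quot where
  star_involutive := by
    intro a
    obtain ⟨a, rfl⟩ := I.mkL_surjective a
    simp only [← mkL_star, star_star]
  star_mul := by
    intro a b
    obtain ⟨a, rfl⟩ := I.mkL_surjective a
    obtain ⟨b, rfl⟩ := I.mkL_surjective b
    simp only [← mkL_star, ← mkL_mul, star_mul]
  star_add := by
    intro a b
    obtain ⟨a, rfl⟩ := I.mkL_surjective a
    obtain ⟨b, rfl⟩ := I.mkL_surjective b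
    simp only [← mkL_star, ← map_add, star_add]

theorem norm_mkL_sq_le (x j : T) (hj : j ∈ I.toSubmodule) :
    ‖I.mkL x‖ * ‖I.mkL x‖ ≤ ‖star x * x + j‖ := by
  let S : NonUnitalStarSubalgebra ℂ T :=
    { I.toSubmodule with
      mul_mem' := fun {a b} _ hb => I.mul_left' a hb
      star_mem' := fun h => I.star_mem' h }
  have : IsClosed (S : Set T) := I.isClosed'
  obtain ⟨l, hl, -, hright, hev⟩ := exists_approx_unit S
  have key : ∀ᶠ e : S in l, ‖I.mkL x‖ * ‖I.mkL x‖ ≤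
      ‖star x * x + j‖ + ‖(⟨j, hj⟩ : S) - ⟨j, hj⟩ * e‖ := by
    filter_upwards [hev] with e he
    obtain ⟨he1, c, hec⟩ := he
    have hec' : (e : T) = star (c : T) * c := congrArg Subtype.val hec
    have hes : star (e : T) = e := by rw [hec', star_mul, star_star]
    have hcon := norm_sub_mul_le_of_pos hec' (he1 : ‖(e : T)‖ ≤ 1)
    have h1 : I.mkL (x - x * e) = I.mkL x := by
      rw [mkL_eq]
      have : x - x * e - x = -(x * e) := by abel
      rw [this]
      exact neg_mem (I.mul_left' _ e.2)
    have h2 : ‖I.mkL x‖ ≤ ‖x - x * e‖ := h1 ▸ I.norm_mkL_le _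
    have h3 : ∀ y : T, star (x - x * e) * (x - x * e) =
        ((star x * x + j) - (star x * x + j) * e) - e * ((star x * x + j) - (star x * x + j) * e)
          - ((j - j * e) - e * (j - j * e)) := by
      intro y
      rw [star_sub, star_mul, hes]
      noncomm_ring
    calc ‖I.mkL x‖ * ‖I.mkL x‖ ≤ ‖x - x * e‖ * ‖x - x * e‖ := by gcongr
      _ = ‖star (x - x * e) * (x - x * e)‖ := CStarRing.norm_star_mul_self.symm
      _ ≤ ‖((star x * x + j) - (star x * x + j) * e) -
            e * ((star x * x + j) - (star x * x + j) * e)‖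
          + ‖(j - j * e) - e * (j - j * e)‖ := by rw [h3 0]; exact norm_sub_le _ _
      _ ≤ ‖star x * x + j‖ + ‖j - j * e‖ :=
          add_le_add ((hcon _).1.trans (hcon _).2) (hcon _).1
  have hlim : Tendsto (fun e : S => ‖star x * x + j‖ + ‖(⟨j, hj⟩ : S) - ⟨j, hj⟩ * e‖) l
      (𝓝 (‖star x * x + j‖ + 0)) := by
    refine tendsto_const_nhds.add ?_
    have := (tendsto_const_nhds (x := (⟨j, hj⟩ : S))).sub (hright ⟨j, hj⟩)
    simpa using this.norm
  simpa using ge_of_tendsto hlim key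

/-- The quotient of a C⋆-algebra by a closed ideal is a C⋆-algebra for the quotient norm. -/
instance : NonUnitalCStarAlgebra I.Quot where
  __ := (inferInstance : NormedAddCommGroup I.Quot)
  __ := (inferInstance : NonUnitalRing I.Quot)
  __ := (inferInstance : StarRing I.Quot)
  __ := (inferInstance : NormedSpace ℂ I.Quot)
  dist_eq := fun x y => dist_eq_norm_neg_add x y
  complete := (inferInstance : CompleteSpace I.Quot).complete
  norm_mul_le := by
    intro a b
    refine le_of_forall_pos_le_add fun ε hε => ?_
    have hcont : Tendsto (fun δ : ℝ => (‖a‖ + δ) * (‖b‖ + δ)) (𝓝[>] 0) (𝓝 ((‖a‖ + 0) * (‖b‖ + 0))) := by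
      refine Tendsto.mono_left ?_ nhdsWithin_le_nhds
      exact (Continuous.tendsto (by fun_prop) 0)
    have hev := hcont.eventually (eventually_lt_nhds (b := ‖a‖ * ‖b‖ + ε) (by simpa using hε))
    obtain ⟨δ, hδ, hδ0⟩ := (hev.and self_mem_nhdsWithin).exists
    obtain ⟨x, rfl, hx⟩ := I.exists_norm_lt a hδ0
    obtain ⟨y, rfl, hy⟩ := I.exists_norm_lt b hδ0
    calc ‖I.mkL x * I.mkL y‖ = ‖I.mkL (x * y)‖ := rfl
      _ ≤ ‖x * y‖ := I.norm_mkL_le _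
      _ ≤ ‖x‖ * ‖y‖ := norm_mul_le _ _
      _ ≤ (‖I.mkL x‖ + δ) * (‖I.mkL y‖ + δ) := by gcongr
      _ ≤ _ := hδ.le
  norm_mul_self_le := by
    intro a
    obtain ⟨x, rfl⟩ := I.mkL_surjective a
    rw [← mkL_star, ← mkL_mul]
    refine le_of_forall_pos_le_add fun ε hε => ?_
    obtain ⟨y, hy, hy'⟩ := I.exists_norm_lt (I.mkL (star x * x)) hε
    have hj : y - star x * x ∈ I.toSubmodule := (I.mkL_eq).1 hy
    have := I.norm_mkL_sq_le x _ hj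
    rw [add_sub_cancel] at this
    exact this.trans hy'.le
  smul_assoc := by
    intro c a b
    obtain ⟨a, rfl⟩ := I.mkL_surjective a
    obtain ⟨b, rfl⟩ := I.mkL_surjective b
    change (c • I.mkL a) * I.mkL b = c • (I.mkL a * I.mkL b)
    rw [← map_smul, ← mkL_mul, ← mkL_mul, smul_mul_assoc, map_smul]
  smul_comm := by
    intro c a b
    obtain ⟨a, rfl⟩ := I.mkL_surjective a
    obtain ⟨b, rfl⟩ := I.mkL_surjective b
    change c • (I.mkL a * I.mkL b) = I.mkL a * (c • I.mkL b)
    rw [← map_smul, ← mkL_mul, ← mkL_mul, mul_smul_comm, map_smul]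
  star_smul := by
    intro c a
    obtain ⟨a, rfl⟩ := I.mkL_surjective a
    rw [← map_smul, ← mkL_star, ← mkL_star, star_smul, map_smul]

/-- The quotient map `T → T ⧸ I`. -/
def proj : T →⋆ₙₐ[ℂ] I.Quot where
  toFun := I.mkL
  map_smul' := fun c x => map_smul I.mkL c x
  map_zero' := map_zero I.mkL
  map_add' := map_add I.mkL
  map_mul' := I.mkL_mul
  map_star' := I.mkL_star

theorem proj_surjective : Function.Surjective I.proj := I.mkL_surjective

theorem proj_eq_zero {x : T} : I.proj x = 0 ↔ x ∈ I.toSubmodule :=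
  Submodule.Quotient.mk_eq_zero _

/-- A multiplier of `T` maps a closed ideal of `T` into itself. -/
theorem multiplier_mem (m : 𝓜(ℂ, T)) {x : T} (hx : x ∈ I.toSubmodule) :
    m.fst x ∈ I.toSubmodule ∧ m.snd x ∈ I.toSubmodule := by
  obtain ⟨l, hl, h1, h2, -⟩ := exists_approx_unit T
  constructor
  · refine I.isClosed'.mem_of_tendsto ((m.fst.continuous.tendsto x).comp (h1 x))
      (Eventually.of_forall fun e => ?_)
    change m.fst (e * x) ∈ I.toSubmodule
    rw [multiplier_fst_mul]
    exact I.mul_left' _ hx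
  · refine I.isClosed'.mem_of_tendsto ((m.snd.continuous.tendsto x).comp (h2 x))
      (Eventually.of_forall fun e => ?_)
    change m.snd (x * e) ∈ I.toSubmodule
    rw [multiplier_snd_mul]
    exact I.mul_right' _ hx

/-- A bounded linear map on `T` preserving `I` descends to `T ⧸ I`. -/
def descend (f : T →L[ℂ] T) (hf : ∀ x ∈ I.toSubmodule, f x ∈ I.toSubmodule) :
    I.Quot →L[ℂ] I.Quot :=
  LinearMap.mkContinuous
    (show (T ⧸ I.toSubmodule) →ₗ[ℂ] (T ⧸ I.toSubmodule) from
      I.toSubmodule.mapQ I.toSubmodule f.toLinearMap hf) ‖f‖ (by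
    intro (x : I.Quot)
    refine le_of_forall_pos_le_add fun ε hε => ?_
    have hpos : 0 < ‖f‖ + 1 := by positivity
    obtain ⟨y, rfl, hy⟩ := I.exists_norm_lt x (div_pos hε hpos)
    calc ‖I.mkL (f y)‖ ≤ ‖f y‖ := I.norm_mkL_le _
      _ ≤ ‖f‖ * ‖y‖ := f.le_opNorm y
      _ ≤ ‖f‖ * (‖I.mkL y‖ + ε / (‖f‖ + 1)) := by gcongr
      _ = ‖f‖ * ‖I.mkL y‖ + ‖f‖ / (‖f‖ + 1) * ε := by ring
      _ ≤ ‖f‖ * ‖I.mkL y‖ + 1 * ε := by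
          gcongr
          rw [div_le_one hpos]
          linarith
      _ = _ := by rw [one_mul])

theorem descend_proj (f : T →L[ℂ] T) (hf : ∀ x ∈ I.toSubmodule, f x ∈ I.toSubmodule) (x : T) :
    I.descend f hf (I.proj x) = I.proj (f x) := rfl

/-- The extension `M(T) → M(T ⧸ I)` of the quotient map to multiplier algebras: the image of the
multiplier `m` is determined by `projBar m * proj x = proj (m * x)` and
`proj x * projBar m = proj (x * m)`. -/
def projBar (m : 𝓜(ℂ, T)) : 𝓜(ℂ, I.Quot) where
  fst := I.descend m.fst fun _ hx => (I.multiplier_mem m hx).1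
  snd := I.descend m.snd fun _ hx => (I.multiplier_mem m hx).2
  central := by
    intro a b
    obtain ⟨a, rfl⟩ := I.proj_surjective a
    obtain ⟨b, rfl⟩ := I.proj_surjective b
    rw [descend_proj, descend_proj, ← map_mul, ← map_mul, m.central]

@[simp] theorem projBar_fst (m : 𝓜(ℂ, T)) (x : T) :
    (I.projBar m).fst (I.proj x) = I.proj (m.fst x) := rfl

@[simp] theorem projBar_snd (m : 𝓜(ℂ, T)) (x : T) :
    (I.projBar m).snd (I.proj x) = I.proj (m.snd x) := rfl

end ClosedIdeal

/-! ### C⋆-algebras generated by a universal family -/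

/-- A class of admissible `G`-indexed families in C⋆-algebras, with a uniform norm bound. -/
structure FamilyClass (G : Type u) where
  /-- `Adm B f` says that the family `f` of elements of `B` is admissible. -/
  Adm : ∀ (B : Type u) [NonUnitalCStarAlgebra B], (G → B) → Prop
  bound : G → ℝ
  norm_le : ∀ (B : Type u) [NonUnitalCStarAlgebra B] (f : G → B), Adm B f → ∀ g, ‖f g‖ ≤ bound g

namespace FamilyClass

variable {G : Type u} (R : FamilyClass G)

/-- An admissible family together with its C⋆-algebra. -/
structure Index where
  B : Type u
  inst : NonUnitalCStarAlgebra B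
  f : G → B
  adm : R.Adm B f

instance (i : R.Index) : NonUnitalCStarAlgebra i.B := i.inst

/-- The bounded product of the targets of all admissible families. -/
abbrev Big : Type (u + 1) := lp (fun i : R.Index => i.B) ⊤

/-- The product of all admissible families. -/
def bigGen (g : G) : R.Big :=
  ⟨fun i => i.f g, memℓp_infty ⟨R.bound g, by
    rintro _ ⟨i, rfl⟩
    exact R.norm_le i.B i.f i.adm g⟩⟩

/-- The C⋆-algebra generated by the product of all admissible families. -/
def bigSub : NonUnitalStarSubalgebra ℂ R.Big :=
  (NonUnitalStarAlgebra.adjoin ℂ (Set.range R.bigGen)).topologicalClosure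

instance : IsClosed (R.bigSub : Set R.Big) :=
  NonUnitalStarSubalgebra.isClosed_topologicalClosure _

/-- Formal ⋆-polynomials, used only to see that `bigSub` is `u`-small. -/
inductive Word (G : Type u) : Type u
  | of (g : G) : Word G
  | zero : Word G
  | add (x y : Word G) : Word G
  | mul (x y : Word G) : Word G
  | smul (c : ℂ) (x : Word G) : Word G
  | star (x : Word G) : Word G

/-- Evaluation of formal ⋆-polynomials. -/
def evalWord : Word G → R.Big
  | .of g => R.bigGen g
  | .zero => 0
  | .add x y => evalWord x + evalWord y
  | .mul x y => evalWord x * evalWord y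
  | .smul c x => c • evalWord x
  | .star x => Star.star (evalWord x)

theorem exists_evalWord {x : R.Big}
    (hx : x ∈ NonUnitalStarAlgebra.adjoin ℂ (Set.range R.bigGen)) :
    ∃ w, R.evalWord w = x := by
  induction hx using NonUnitalStarAlgebra.adjoin_induction with
  | mem x hx => obtain ⟨g, rfl⟩ := hx; exact ⟨.of g, rfl⟩
  | add x y _ _ hx hy =>
    obtain ⟨a, rfl⟩ := hx
    obtain ⟨b, rfl⟩ := hy
    exact ⟨.add a b, rfl⟩
  | zero => exact ⟨.zero, rfl⟩
  | mul x y _ _ hx hy =>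
    obtain ⟨a, rfl⟩ := hx
    obtain ⟨b, rfl⟩ := hy
    exact ⟨.mul a b, rfl⟩
  | smul c x _ hx => obtain ⟨a, rfl⟩ := hx; exact ⟨.smul c a, rfl⟩
  | star x _ hx => obtain ⟨a, rfl⟩ := hx; exact ⟨.star a, rfl⟩

open Classical in
instance : Small.{u} R.bigSub := by
  let F : (ℕ → Word G) → R.bigSub := fun s =>
    if h : ∃ x : R.bigSub, Tendsto (fun n => R.evalWord (s n)) atTop (𝓝 (x : R.Big)) then h.choose
    else 0
  refine small_of_surjective (f := F) fun x => ?_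
  obtain ⟨y, hy, hyx⟩ := mem_closure_iff_seq_limit.1 x.2
  choose s hs using fun n => R.exists_evalWord (hy n)
  have h : ∃ x : R.bigSub, Tendsto (fun n => R.evalWord (s n)) atTop (𝓝 (x : R.Big)) :=
    ⟨x, by simpa only [hs] using hyx⟩
  refine ⟨s, ?_⟩
  have hF : F s = h.choose := dif_pos h
  rw [hF]
  refine Subtype.ext (tendsto_nhds_unique h.choose_spec ?_)
  simpa only [hs] using hyx

/-- The C⋆-algebra generated by a universal admissible family: the closed ⋆-subalgebra of the
product of all admissible families generated by the diagonal family, moved to the universe `u`. -/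
def Univ : Type u := Shrink.{u} R.bigSub

/-- The identification of `Univ` with the concrete C⋆-algebra `bigSub`. -/
def univEquiv : R.Univ ≃ R.bigSub := (equivShrink R.bigSub).symm

instance : NonUnitalRing R.Univ := R.univEquiv.nonUnitalRing
instance : NormedAddCommGroup R.Univ := R.univEquiv.normedAddCommGroup
instance : NormedSpace ℂ R.Univ := R.univEquiv.normedSpace ℂ
instance : Star R.Univ := ⟨fun x => R.univEquiv.symm (star (R.univEquiv x))⟩

theorem univEquiv_add (x y : R.Univ) : R.univEquiv (x + y) = R.univEquiv x + R.univEquiv y :=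
  R.univEquiv.apply_symm_apply _
theorem univEquiv_mul (x y : R.Univ) : R.univEquiv (x * y) = R.univEquiv x * R.univEquiv y :=
  R.univEquiv.apply_symm_apply _
theorem univEquiv_smul (c : ℂ) (x : R.Univ) : R.univEquiv (c • x) = c • R.univEquiv x :=
  R.univEquiv.apply_symm_apply _
theorem univEquiv_star (x : R.Univ) : R.univEquiv (star x) = star (R.univEquiv x) :=
  R.univEquiv.apply_symm_apply _
theorem univEquiv_norm (x : R.Univ) : ‖x‖ = ‖R.univEquiv x‖ := rfl
theorem univEquiv_zero : R.univEquiv 0 = 0 := R.univEquiv.apply_symm_apply _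
theorem univEquiv_dist (x y : R.Univ) : dist x y = dist (R.univEquiv x) (R.univEquiv y) := rfl

instance : StarRing R.Univ where
  star_involutive x := R.univEquiv.injective (by simp only [univEquiv_star, star_star])
  star_mul x y := R.univEquiv.injective (by simp only [univEquiv_star, univEquiv_mul, star_mul])
  star_add x y := R.univEquiv.injective (by simp only [univEquiv_star, univEquiv_add, star_add])

instance : NonUnitalCStarAlgebra R.Univ where
  __ := (inferInstance : NormedAddCommGroup R.Univ)
  __ := (inferInstance : NonUnitalRing R.Univ)
  __ := (inferInstance : StarRing R.Univ)
  __ := (inferInstance : NormedSpace ℂ R.Univ)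
  dist_eq := fun x y => dist_eq_norm_neg_add x y
  norm_mul_le x y := by
    rw [univEquiv_norm, univEquiv_norm, univEquiv_norm, univEquiv_mul]
    exact norm_mul_le _ _
  norm_mul_self_le x := by
    rw [univEquiv_norm, univEquiv_norm, univEquiv_mul, univEquiv_star]
    exact CStarRing.norm_mul_self_le _
  complete := by
    have h : IsUniformInducing R.univEquiv :=
      (Isometry.of_dist_eq fun x y => (R.univEquiv_dist x y).symm).isUniformInducing
    have := (completeSpace_congr ⟨h, R.univEquiv.injective⟩ (e := R.univEquiv)).2 inferInstance
    exact fun {f} hf => this.complete hf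
  smul_assoc c a b := R.univEquiv.injective (by
    change R.univEquiv ((c • a) * b) = R.univEquiv (c • (a * b))
    simp only [univEquiv_mul, univEquiv_smul, smul_mul_assoc])
  smul_comm c a b := R.univEquiv.injective (by
    change R.univEquiv (c • (a * b)) = R.univEquiv (a * (c • b))
    simp only [univEquiv_mul, univEquiv_smul, mul_smul_comm])
  star_smul c a := R.univEquiv.injective (by
    simp only [univEquiv_star, univEquiv_smul, star_smul])

theorem bigGen_mem (g : G) : R.bigGen g ∈ R.bigSub :=
  NonUnitalStarSubalgebra.le_topologicalClosure _
    (NonUnitalStarAlgebra.subset_adjoin ℂ _ ⟨g, rfl⟩)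

/-- The universal admissible family. -/
def gen (g : G) : R.Univ := R.univEquiv.symm ⟨R.bigGen g, R.bigGen_mem g⟩

theorem univEquiv_gen (g : G) : R.univEquiv (R.gen g) = ⟨R.bigGen g, R.bigGen_mem g⟩ :=
  R.univEquiv.apply_symm_apply _

variable {R}

/-- The homomorphism from the universal C⋆-algebra determined by an admissible family. -/
def lift {B : Type u} [NonUnitalCStarAlgebra B] {f : G → B} (hf : R.Adm B f) :
    R.Univ →⋆ₙₐ[ℂ] B where
  toFun x := ((R.univEquiv x : R.Big) : ∀ i : R.Index, i.B) ⟨B, inferInstance, f, hf⟩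
  map_smul' c x := by rw [univEquiv_smul]; rfl
  map_zero' := by rw [univEquiv_zero]; rfl
  map_add' x y := by rw [univEquiv_add]; rfl
  map_mul' x y := by rw [univEquiv_mul]; rfl
  map_star' x := by rw [univEquiv_star]; rfl

@[simp] theorem lift_gen {B : Type u} [NonUnitalCStarAlgebra B] {f : G → B} (hf : R.Adm B f)
    (g : G) : lift hf (R.gen g) = f g := by
  change ((R.univEquiv (R.gen g) : R.Big) : ∀ i : R.Index, i.B) _ = _
  rw [univEquiv_gen]
  rfl

/-- The norm of the universal C⋆-algebra is the supremum over all admissible families. -/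
theorem norm_le_of_lift {x : R.Univ} {C : ℝ} (hC : 0 ≤ C)
    (h : ∀ (B : Type u) [NonUnitalCStarAlgebra B] (f : G → B) (hf : R.Adm B f),
      ‖lift hf x‖ ≤ C) : ‖x‖ ≤ C := by
  rw [univEquiv_norm]
  change ‖(R.univEquiv x : R.Big)‖ ≤ C
  exact lp.norm_le_of_forall_le hC fun i => h i.B i.f i.adm

theorem ext_of_lift {x y : R.Univ}
    (h : ∀ (B : Type u) [NonUnitalCStarAlgebra B] (f : G → B) (hf : R.Adm B f),
      lift hf x = lift hf y) : x = y := by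
  rw [← sub_eq_zero, ← norm_le_zero_iff]
  refine norm_le_of_lift le_rfl fun B _ f hf => ?_
  rw [map_sub, h B f hf, sub_self, norm_zero]

/-- The universal family generates the universal C⋆-algebra. -/
theorem induction {p : R.Univ → Prop} (hclosed : IsClosed {x | p x})
    (hgen : ∀ g, p (R.gen g)) (hstar_gen : ∀ g, p (star (R.gen g)))
    (hadd : ∀ x y, p x → p y → p (x + y)) (hzero : p 0)
    (hmul : ∀ x y, p x → p y → p (x * y))
    (hsmul : ∀ (c : ℂ) x, p x → p (c • x)) (x : R.Univ) : p x := by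
  have main : ∀ y ∈ NonUnitalStarAlgebra.adjoin ℂ (Set.range R.bigGen),
      ∃ x : R.Univ, (R.univEquiv x : R.Big) = y ∧ p x ∧ p (star x) := by
    intro y hy
    induction hy using NonUnitalStarAlgebra.adjoin_induction with
    | mem y hy =>
      obtain ⟨g, rfl⟩ := hy
      exact ⟨R.gen g, by rw [univEquiv_gen], hgen g, hstar_gen g⟩
    | add y z _ _ hy hz =>
      obtain ⟨a, rfl, ha, ha'⟩ := hy
      obtain ⟨b, rfl, hb, hb'⟩ := hz
      exact ⟨a + b, by rw [univEquiv_add]; rfl, hadd _ _ ha hb,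
        by rw [star_add]; exact hadd _ _ ha' hb'⟩
    | zero => exact ⟨0, by rw [univEquiv_zero]; rfl, hzero, by rwa [star_zero]⟩
    | mul y z _ _ hy hz =>
      obtain ⟨a, rfl, ha, ha'⟩ := hy
      obtain ⟨b, rfl, hb, hb'⟩ := hz
      exact ⟨a * b, by rw [univEquiv_mul]; rfl, hmul _ _ ha hb,
        by rw [star_mul]; exact hmul _ _ hb' ha'⟩
    | smul c y _ hy =>
      obtain ⟨a, rfl, ha, ha'⟩ := hy
      exact ⟨c • a, by rw [univEquiv_smul]; rfl, hsmul _ _ ha,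
        by rw [star_smul]; exact hsmul _ _ ha'⟩
    | star y _ hy =>
      obtain ⟨a, rfl, ha, ha'⟩ := hy
      exact ⟨star a, by rw [univEquiv_star]; rfl, ha', by rwa [star_star]⟩
  obtain ⟨y, hy, hyx⟩ := mem_closure_iff_seq_limit.1 (R.univEquiv x).2
  choose s hs hps _ using fun n => main (y n) (hy n)
  have hlim : Tendsto s atTop (𝓝 x) := by
    rw [tendsto_iff_dist_tendsto_zero] at hyx ⊢
    refine hyx.congr fun n => ?_
    rw [← hs n, univEquiv_dist]
    rfl
  exact hclosed.mem_of_tendsto hlim (Eventually.of_forall hps)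

end FamilyClass

/-! ### Hilbert bimodules, Toeplitz representations, relative Cuntz–Pimsner algebras -/

/-- The quadratic estimate behind the Cauchy–Schwarz inequality. -/
theorem norm_sq_le_of_quadratic {A : Type u} [NonUnitalCStarAlgebra A] {b p r : A}
    (h : ∀ t : ℝ, 0 < t → ∃ c : A, (t ^ 2 : ℝ) • r - (2 * t : ℝ) • (star b * b) + star b * p * b
      = star c * c) : ‖b‖ ^ 2 ≤ ‖p‖ * ‖r‖ := by
  let _ := CStarAlgebra.spectralOrder A
  have := CStarAlgebra.spectralOrderedRing A
  have key : ∀ t : ℝ, 0 < t → 2 * t * ‖b‖ ^ 2 ≤ t ^ 2 * ‖r‖ + ‖p‖ * ‖b‖ ^ 2 := by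
    intro t ht
    obtain ⟨c, hc⟩ := h t ht
    have h1 : (2 * t : ℝ) • (star b * b) ≤ (t ^ 2 : ℝ) • r + star b * p * b := by
      rw [← sub_nonneg]
      have : (t ^ 2 : ℝ) • r + star b * p * b - (2 * t : ℝ) • (star b * b) = star c * c := by
        rw [← hc]; abel
      rw [this]
      exact star_mul_self_nonneg c
    have h2 := CStarAlgebra.norm_le_norm_of_nonneg_of_le
      (smul_nonneg (by positivity) (star_mul_self_nonneg b)) h1
    rw [norm_smul, CStarRing.norm_star_mul_self, Real.norm_of_nonneg (by positivity)] at h2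
    calc 2 * t * ‖b‖ ^ 2 = 2 * t * (‖b‖ * ‖b‖) := by ring
      _ ≤ _ := h2
      _ ≤ ‖(t ^ 2 : ℝ) • r‖ + ‖star b * p * b‖ := norm_add_le _ _
      _ ≤ t ^ 2 * ‖r‖ + ‖star b‖ * ‖p‖ * ‖b‖ := by
          gcongr
          · rw [norm_smul, Real.norm_of_nonneg (by positivity)]
          · exact (norm_mul_le _ _).trans (by gcongr; exact norm_mul_le _ _)
      _ = _ := by rw [norm_star]; ring
  rcases (norm_nonneg p).eq_or_lt with hp | hp
  · rw [← hp] at key ⊢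
    rw [zero_mul]
    refine le_of_forall_pos_le_add fun ε hε => ?_
    have hpos : 0 < ‖r‖ + 1 := by positivity
    have h1 := key (ε / (‖r‖ + 1)) (by positivity)
    set t := ε / (‖r‖ + 1) with ht
    have ht0 : 0 < t := by positivity
    have h2 : t * (‖r‖ + 1) = ε := by rw [ht]; field_simp
    have h3 : t * (2 * ‖b‖ ^ 2) ≤ t * (t * ‖r‖) := by nlinarith
    have h4 := le_of_mul_le_mul_left h3 ht0
    nlinarith [sq_nonneg ‖b‖]
  · have h1 := key ‖p‖ hp
    have h3 : ‖p‖ * ‖b‖ ^ 2 ≤ ‖p‖ * (‖p‖ * ‖r‖) := by nlinarith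
    exact le_of_mul_le_mul_left h3 hp

/-- A *Hilbert `A`-bimodule* (correspondence over `A`): a right Hilbert `A`-module `M`, with
`A`-valued inner product `ip` (linear in the second variable), right action `rsmul`, and norm
`‖x‖ = ‖⟨x, x⟩‖ ^ (1 / 2)`, together with a left action `φ` of `A` by adjointable operators.
Completeness of `M` is assumed separately, and the remaining axioms of a right module follow from
these, see `rsmul_add`, `add_rsmul`, `smul_rsmul`, `rsmul_smul` and `rsmul_rsmul` below. -/
class HilbertBimodule (A : Type u) (M : Type v) [NonUnitalCStarAlgebra A] [NormedAddCommGroup M]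
    [NormedSpace ℂ M] where
  ip : M → M → A
  rsmul : M → A → M
  φ : A →ₙₐ[ℂ] (M →L[ℂ] M)
  ip_add_right : ∀ x y z, ip x (y + z) = ip x y + ip x z
  ip_smul_right : ∀ (c : ℂ) (x y), ip x (c • y) = c • ip x y
  star_ip : ∀ x y, star (ip x y) = ip y x
  ip_self_pos : ∀ x, ∃ b, ip x x = star b * b
  norm_sq : ∀ x, ‖x‖ ^ 2 = ‖ip x x‖
  ip_rsmul : ∀ x y a, ip x (rsmul y a) = ip x y * a
  ip_φ : ∀ a x y, ip (φ a x) y = ip x (φ (star a) y)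

namespace HilbertBimodule

variable {A : Type u} {M : Type v} [NonUnitalCStarAlgebra A] [NormedAddCommGroup M]
  [NormedSpace ℂ M] [HilbertBimodule A M]

theorem ip_add_left (x y z : M) : (ip (x + y) z : A) = ip x z + ip y z := by
  rw [← star_ip, ip_add_right, star_add, star_ip, star_ip]

theorem ip_smul_left (c : ℂ) (x y : M) : (ip (c • x) y : A) = star c • ip x y := by
  rw [← star_ip, ip_smul_right, star_smul, star_ip]

theorem ip_sub_right (x y z : M) : (ip x (y - z) : A) = ip x y - ip x z := by
  rw [eq_sub_iff_add_eq, ← ip_add_right, sub_add_cancel]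

theorem ip_sub_left (x y z : M) : (ip (x - y) z : A) = ip x z - ip y z := by
  rw [← star_ip, ip_sub_right, star_sub, star_ip, star_ip]

variable (A) in
theorem ext_ip {x y : M} (h : ∀ z, (ip z x : A) = ip z y) : x = y := by
  have h1 : ‖x - y‖ ^ 2 = 0 := by
    rw [norm_sq (A := A), ip_sub_right, h, sub_self, norm_zero]
  exact sub_eq_zero.1 (norm_eq_zero.1 (pow_eq_zero_iff two_ne_zero |>.1 h1))

theorem rsmul_add (x : M) (a b : A) : rsmul x (a + b) = rsmul x a + rsmul x b :=
  ext_ip A fun z => by simp only [ip_rsmul, ip_add_right, mul_add]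

theorem add_rsmul (x y : M) (a : A) : rsmul (x + y) a = rsmul x a + rsmul y a :=
  ext_ip A fun z => by simp only [ip_rsmul, ip_add_right, add_mul]

theorem smul_rsmul (c : ℂ) (x : M) (a : A) : rsmul (c • x) a = c • rsmul x a :=
  ext_ip A fun z => by simp only [ip_rsmul, ip_smul_right, smul_mul_assoc]

theorem rsmul_smul (c : ℂ) (x : M) (a : A) : rsmul x (c • a) = c • rsmul x a :=
  ext_ip A fun z => by simp only [ip_rsmul, ip_smul_right, mul_smul_comm]

theorem rsmul_rsmul (x : M) (a b : A) : rsmul (rsmul x a) b = rsmul x (a * b) :=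
  ext_ip A fun z => by simp only [ip_rsmul, mul_assoc]

theorem ip_rsmul_left (x y : M) (a : A) : ip (rsmul x a) y = star a * ip x y := by
  rw [← star_ip, ip_rsmul, star_mul, star_ip]

theorem norm_ip_le (x y : M) : ‖(ip x y : A)‖ ≤ ‖x‖ * ‖y‖ := by
  have h : ‖(ip x y : A)‖ ^ 2 ≤ ‖(ip x x : A)‖ * ‖(ip y y : A)‖ := by
    refine norm_sq_le_of_quadratic fun t _ => ?_
    obtain ⟨c, hc⟩ := ip_self_pos (A := A) ((t : ℂ) • y - rsmul x (ip x y : A))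
    refine ⟨c, hc ▸ ?_⟩
    have e1 : (ip ((t : ℂ) • y - rsmul x (ip x y : A)) ((t : ℂ) • y - rsmul x (ip x y : A)) : A) =
        (t : ℂ) • (t : ℂ) • ip y y - (t : ℂ) • (ip y x * ip x y) - ((t : ℂ) • (ip y x * ip x y)
          - ip y x * ip x x * ip x y) := by
      simp only [ip_sub_left, ip_sub_right, ip_smul_left, ip_smul_right, ip_rsmul, ip_rsmul_left,
        star_ip, Complex.star_def, Complex.conj_ofReal, sub_mul, smul_mul_assoc, smul_sub]
    rw [e1, star_ip]
    simp only [Complex.coe_smul, smul_smul, two_mul, add_smul, pow_two]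
    abel
  rw [← norm_sq, ← norm_sq, ← mul_pow] at h
  exact (pow_le_pow_iff_left₀ (norm_nonneg _) (by positivity) two_ne_zero).1 h

theorem norm_rsmul_le (x : M) (a : A) : ‖rsmul x a‖ ≤ ‖x‖ * ‖a‖ := by
  have h : ‖rsmul x a‖ ^ 2 ≤ (‖x‖ * ‖a‖) ^ 2 := by
    rw [norm_sq (A := A), ip_rsmul, ip_rsmul_left]
    calc ‖star a * ip x x * a‖ ≤ ‖star a‖ * ‖(ip x x : A)‖ * ‖a‖ :=
          (norm_mul_le _ _).trans (by gcongr; exact norm_mul_le _ _)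
      _ = _ := by rw [norm_star, ← norm_sq]; ring
  exact (pow_le_pow_iff_left₀ (norm_nonneg _) (by positivity) two_ne_zero).1 h

variable (A) in
/-- The rank-one operator `Θ_{x,y} : z ↦ x · ⟨y, z⟩`. -/
def Θ (x y : M) : M →L[ℂ] M :=
  LinearMap.mkContinuous
    { toFun := fun z => rsmul x (ip y z : A)
      map_add' := fun z w => by rw [ip_add_right, rsmul_add]
      map_smul' := fun c z => by rw [ip_smul_right, rsmul_smul]; rfl } (‖x‖ * ‖y‖) (by
    intro z
    change ‖rsmul x (ip y z : A)‖ ≤ _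
    calc _ ≤ ‖x‖ * ‖(ip y z : A)‖ := norm_rsmul_le _ _
      _ ≤ ‖x‖ * (‖y‖ * ‖z‖) := by gcongr; exact norm_ip_le _ _
      _ = _ := by ring)

theorem Θ_apply (x y z : M) : Θ A x y z = rsmul x (ip y z : A) := rfl

variable (A M) in
/-- The compact operators `𝒦(M)`: the closed linear span of the operators `Θ_{x,y}`. -/
def compacts : Submodule ℂ (M →L[ℂ] M) :=
  (Submodule.span ℂ (Set.range fun p : M × M => Θ A p.1 p.2)).topologicalClosure

theorem Θ_mem_compacts (x y : M) : Θ A x y ∈ compacts A M :=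
  Submodule.le_topologicalClosure _ (Submodule.subset_span ⟨(x, y), rfl⟩)

variable (A M) in
/-- The ideal `J(M) = φ⁻¹(𝒦(M))` of `A`. -/
def J : Submodule ℂ A := (compacts A M).comap ((φ : A →ₙₐ[ℂ] (M →L[ℂ] M)) : A →ₗ[ℂ] (M →L[ℂ] M))

theorem mem_J {a : A} : a ∈ J A M ↔ (φ a : M →L[ℂ] M) ∈ compacts A M := Iff.rfl

instance : NormedAddCommGroup (compacts A M) := Submodule.normedAddCommGroup _

instance : NormedSpace ℂ (compacts A M) := Submodule.normedSpace _

instance : IsBoundedSMul ℂ (compacts A M) := NormedSpace.toIsBoundedSMul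

end HilbertBimodule

open HilbertBimodule

/-- A *Toeplitz representation* `(ψ, π)` of a Hilbert `A`-bimodule `M` in a C⋆-algebra `B`. -/
structure ToeplitzRep (A : Type u) (M : Type v) [NonUnitalCStarAlgebra A] [NormedAddCommGroup M]
    [NormedSpace ℂ M] [HilbertBimodule A M] (B : Type w) [NonUnitalCStarAlgebra B] where
  ψ : M →ₗ[ℂ] B
  π : A →⋆ₙₐ[ℂ] B
  map_rsmul : ∀ x a, ψ (rsmul x a) = ψ x * π a
  star_mul_map : ∀ x y, star (ψ x) * ψ y = π (ip x y)
  map_lsmul : ∀ a x, ψ (φ a x) = π a * ψ x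

namespace ToeplitzRep

variable {A : Type u} {M : Type v} [NonUnitalCStarAlgebra A] [NormedAddCommGroup M]
  [NormedSpace ℂ M] [HilbertBimodule A M] {B : Type w} [NonUnitalCStarAlgebra B]

theorem norm_ψ_le (ρ : ToeplitzRep A M B) (x : M) : ‖ρ.ψ x‖ ≤ ‖x‖ := by
  have h : ‖ρ.ψ x‖ ^ 2 ≤ ‖x‖ ^ 2 := by
    rw [pow_two, ← CStarRing.norm_star_mul_self, ρ.star_mul_map, norm_sq (A := A)]
    exact NonUnitalStarAlgHom.norm_apply_le _ _
  exact (pow_le_pow_iff_left₀ (norm_nonneg _) (norm_nonneg _) two_ne_zero).1 h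

variable (A M) in
/-- Formal finite combinations `∑ c_{x,y} (x, y)` mapped to `∑ c_{x,y} Θ_{x,y}`. -/
def finiteRank : (M × M →₀ ℂ) →ₗ[ℂ] compacts A M :=
  Finsupp.linearCombination ℂ fun p : M × M => (⟨Θ A p.1 p.2, Θ_mem_compacts _ _⟩ : compacts A M)

/-- Formal finite combinations `∑ c_{x,y} (x, y)` mapped to `∑ c_{x,y} ψ(x) ψ(y)⋆`. -/
def onFiniteRank (ρ : ToeplitzRep A M B) : (M × M →₀ ℂ) →ₗ[ℂ] B :=
  Finsupp.linearCombination ℂ fun p : M × M => ρ.ψ p.1 * star (ρ.ψ p.2)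

theorem finiteRank_single (x y : M) :
    (finiteRank A M (Finsupp.single (x, y) 1) : M →L[ℂ] M) = Θ A x y := by
  simp [finiteRank]

theorem denseRange_finiteRank : DenseRange (finiteRank A M) := by
  intro T
  have hT : (T : M →L[ℂ] M) ∈ closure
      (Submodule.span ℂ (Set.range fun p : M × M => Θ A p.1 p.2) : Set (M →L[ℂ] M)) := T.2
  have himg : Subtype.val '' (Set.range (finiteRank A M)) =
      (Submodule.span ℂ (Set.range fun p : M × M => Θ A p.1 p.2) : Set (M →L[ℂ] M)) := by
    rw [← Set.range_comp, ← Finsupp.range_linearCombination, LinearMap.coe_range]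
    congr 1
    funext c
    have : (compacts A M).subtype ∘ₗ finiteRank A M =
        Finsupp.linearCombination ℂ fun p : M × M => Θ A p.1 p.2 := by
      ext p : 2
      simp [finiteRank]
    exact LinearMap.congr_fun this c
  rw [← himg] at hT
  exact closure_subtype.2 hT

theorem onFiniteRank_mul_ψ (ρ : ToeplitzRep A M B) (c : M × M →₀ ℂ) (z : M) :
    ρ.onFiniteRank c * ρ.ψ z = ρ.ψ ((finiteRank A M c : M →L[ℂ] M) z) := by
  induction c using Finsupp.induction_linear with
  | zero => simp
  | add f g hf hg => rw [map_add, add_mul, hf, hg, map_add, ← map_add]; rfl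
  | single p c =>
    simp only [onFiniteRank, finiteRank, Finsupp.linearCombination_single, smul_mul_assoc,
      mul_assoc, ρ.star_mul_map, ← ρ.map_rsmul, Submodule.coe_smul, smul_apply,
      map_smul, Θ_apply]

theorem exists_adjoint_finiteRank (ρ : ToeplitzRep A M B) (c : M × M →₀ ℂ) :
    ∃ c', ρ.onFiniteRank c' = star (ρ.onFiniteRank c) ∧
      ∀ x y, (ip ((finiteRank A M c : M →L[ℂ] M) x) y : A) =
        ip x ((finiteRank A M c' : M →L[ℂ] M) y) := by
  induction c using Finsupp.induction_linear with
  | zero =>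
    refine ⟨0, by simp, fun x y => ?_⟩
    have h := ip_sub_left (A := A) x x y
    have h' := ip_sub_right (A := A) x y y
    simp only [sub_self] at h h'
    simp [h, h']
  | add f g hf hg =>
    obtain ⟨f', hf1, hf2⟩ := hf
    obtain ⟨g', hg1, hg2⟩ := hg
    refine ⟨f' + g', by rw [map_add, hf1, hg1, map_add, star_add], fun x y => ?_⟩
    simp only [map_add, Submodule.coe_add, add_apply, ip_add_left,
      ip_add_right, hf2, hg2]
  | single p c =>
    refine ⟨Finsupp.single (p.2, p.1) (star c), ?_, fun x y => ?_⟩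
    · simp [onFiniteRank]
    · simp only [finiteRank, Finsupp.linearCombination_single, Submodule.coe_smul,
        smul_apply, Θ_apply, ip_smul_left, ip_smul_right, ip_rsmul,
        ip_rsmul_left, star_ip]

theorem exists_norm_mul_onFiniteRank_le (ρ : ToeplitzRep A M B) (c : M × M →₀ ℂ) :
    ∃ D : ℝ, ∀ (m : Unitization ℂ B) (R : M →L[ℂ] M),
      (∀ z, m * (ρ.ψ z : Unitization ℂ B) = (ρ.ψ (R z) : B)) →
      ‖m * (ρ.onFiniteRank c : Unitization ℂ B)‖ ≤ ‖R‖ * D := by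
  induction c using Finsupp.induction_linear with
  | zero => exact ⟨0, fun m R _ => by simp⟩
  | add f g hf hg =>
    obtain ⟨D, hD⟩ := hf
    obtain ⟨E, hE⟩ := hg
    refine ⟨D + E, fun m R h => ?_⟩
    rw [map_add, Unitization.inr_add, mul_add, mul_add]
    exact (norm_add_le _ _).trans (add_le_add (hD m R h) (hE m R h))
  | single p c =>
    refine ⟨‖c‖ * (‖p.1‖ * ‖p.2‖), fun m R h => ?_⟩
    have h1 : m * (ρ.onFiniteRank (Finsupp.single p c) : Unitization ℂ B) =
        ((c • (ρ.ψ (R p.1) * star (ρ.ψ p.2)) : B) : Unitization ℂ B) := by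
      simp only [onFiniteRank, Finsupp.linearCombination_single, Unitization.inr_smul,
        Unitization.inr_mul, mul_smul_comm, ← mul_assoc, h]
    rw [h1, Unitization.norm_inr, norm_smul]
    calc ‖c‖ * ‖ρ.ψ (R p.1) * star (ρ.ψ p.2)‖ ≤ ‖c‖ * (‖ρ.ψ (R p.1)‖ * ‖star (ρ.ψ p.2)‖) := by
          gcongr; exact norm_mul_le _ _
      _ ≤ ‖c‖ * (‖R‖ * ‖p.1‖ * ‖p.2‖) := by
          rw [norm_star]
          gcongr
          · exact (ρ.norm_ψ_le _).trans (R.le_opNorm _)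
          · exact ρ.norm_ψ_le _
      _ = _ := by ring

theorem le_of_pow_two_pow_le {a b D : ℝ} (hb : 0 ≤ b)
    (h : ∀ j : ℕ, a ^ 2 ^ j ≤ b ^ (2 ^ j - 1) * D) : a ≤ b := by
  by_contra! hlt
  have ha' : 0 < a := hb.trans_lt hlt
  have hlim : Tendsto (fun n : ℕ => (b / a) ^ n * D) atTop (𝓝 (0 * D)) :=
    (tendsto_pow_atTop_nhds_zero_of_lt_one (by positivity) ((div_lt_one ha').2 hlt)).mul_const D
  have htop : Tendsto (fun j : ℕ => 2 ^ j - 1) atTop atTop :=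
    (tendsto_sub_atTop_nat 1).comp (tendsto_pow_atTop_atTop_of_one_lt one_lt_two)
  have h0 : a ≤ 0 * D := by
    refine ge_of_tendsto' (hlim.comp htop) fun j => ?_
    have h1 := h j
    obtain ⟨n, hn⟩ : ∃ n, 2 ^ j = n + 1 := ⟨2 ^ j - 1, by have := Nat.one_le_two_pow (n := j); omega⟩
    simp only [Function.comp_apply, hn, Nat.add_sub_cancel] at h1 ⊢
    rw [div_pow, div_mul_eq_mul_div, le_div_iff₀ (by positivity)]
    calc a * a ^ n = a ^ (n + 1) := by ring
      _ ≤ _ := h1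
  linarith

theorem norm_onFiniteRank_le (ρ : ToeplitzRep A M B) (c : M × M →₀ ℂ) :
    ‖ρ.onFiniteRank c‖ ≤ ‖finiteRank A M c‖ := by
  obtain ⟨c', hc1, hc2⟩ := ρ.exists_adjoint_finiteRank c
  obtain ⟨D, hD⟩ := ρ.exists_norm_mul_onFiniteRank_le c
  set k := ρ.onFiniteRank c with hk
  set T : M →L[ℂ] M := (finiteRank A M c : M →L[ℂ] M) with hT
  set T' : M →L[ℂ] M := (finiteRank A M c' : M →L[ℂ] M) with hT'
  change ‖k‖ ≤ ‖T‖
  have hTT : ‖T'‖ ≤ ‖T‖ := by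
    refine T'.opNorm_le_bound (norm_nonneg _) fun x => ?_
    have h1 : ‖T' x‖ * ‖T' x‖ ≤ ‖T' x‖ * (‖T‖ * ‖x‖) := by
      rw [← pow_two, norm_sq (A := A), ← hc2]
      calc _ ≤ ‖T (T' x)‖ * ‖x‖ := norm_ip_le _ _
        _ ≤ ‖T‖ * ‖T' x‖ * ‖x‖ := by gcongr; exact T.le_opNorm _
        _ = _ := by ring
    rcases (norm_nonneg (T' x)).eq_or_lt with h0 | h0
    · rw [← h0]; positivity
    · exact le_of_mul_le_mul_left h1 h0
  set h : Unitization ℂ B := (k : Unitization ℂ B) * star (k : Unitization ℂ B) with hh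
  have hsa : IsSelfAdjoint h := IsSelfAdjoint.mul_star_self _
  have hpow : ∀ (n : ℕ) (z : M), h ^ n * (ρ.ψ z : Unitization ℂ B) =
      (ρ.ψ (((T * T') ^ n) z) : B) := by
    intro n
    induction n with
    | zero => intro z; simp
    | succ n ih =>
      intro z
      have h1 : h * (ρ.ψ z : Unitization ℂ B) = (ρ.ψ ((T * T') z) : B) := by
        rw [hh, ← Unitization.inr_star, ← hc1, ← Unitization.inr_mul, ← Unitization.inr_mul,
          mul_assoc, onFiniteRank_mul_ψ, hk, onFiniteRank_mul_ψ]
        rfl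
      rw [pow_succ, mul_assoc, h1, ih, pow_succ]
      rfl
  have hle : ‖h‖ ≤ ‖T * T'‖ := by
    refine le_of_pow_two_pow_le (D := |D| * ‖k‖) (norm_nonneg _) fun j => ?_
    obtain ⟨n, hn⟩ : ∃ n, 2 ^ j = n + 1 := ⟨2 ^ j - 1, by have := Nat.one_le_two_pow (n := j); omega⟩
    have hRn : ∀ n : ℕ, ‖(T * T') ^ n‖ ≤ ‖T * T'‖ ^ n := by
      intro n
      induction n with
      | zero =>
        rw [pow_zero, pow_zero]
        exact ContinuousLinearMap.norm_id_le (𝕜 := ℂ) (E := M)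
      | succ n ih =>
        rw [pow_succ, pow_succ]
        exact (norm_mul_le _ _).trans (by gcongr)
    rw [← hsa.norm_pow_two_pow, hn, Nat.add_sub_cancel, pow_succ]
    calc ‖h ^ n * h‖ = ‖h ^ n * (k : Unitization ℂ B) * star (k : Unitization ℂ B)‖ := by
          rw [mul_assoc]
      _ ≤ ‖h ^ n * (k : Unitization ℂ B)‖ * ‖k‖ := by
          refine (norm_mul_le _ _).trans (le_of_eq ?_)
          rw [norm_star, Unitization.norm_inr]
      _ ≤ ‖(T * T') ^ n‖ * D * ‖k‖ := by gcongr; exact hD _ _ (hpow n)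
      _ ≤ ‖(T * T') ^ n‖ * |D| * ‖k‖ := by gcongr; exact le_abs_self D
      _ ≤ ‖T * T'‖ ^ n * |D| * ‖k‖ := by gcongr; exact hRn n
      _ = _ := by ring
  have h2 : ‖k‖ ^ 2 = ‖h‖ := by
    rw [hh, CStarRing.norm_self_mul_star, Unitization.norm_inr, pow_two]
  have h3 : ‖k‖ ^ 2 ≤ ‖T‖ ^ 2 := by
    rw [h2]
    calc ‖h‖ ≤ ‖T * T'‖ := hle
      _ ≤ ‖T‖ * ‖T'‖ := norm_mul_le _ _
      _ ≤ ‖T‖ * ‖T‖ := by gcongr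
      _ = _ := (pow_two _).symm
  exact (pow_le_pow_iff_left₀ (norm_nonneg _) (norm_nonneg _) two_ne_zero).1 h3

/-- The homomorphism `(ψ, π)⁽¹⁾ : 𝒦(M) → B`, the unique bounded linear map satisfying
`(ψ, π)⁽¹⁾(Θ_{x,y}) = ψ(x) ψ(y)⋆`. -/
def onCompacts (ρ : ToeplitzRep A M B) : compacts A M →L[ℂ] B :=
  LinearMap.extendOfNorm (𝕜 := ℂ) (𝕜₂ := ℂ) (σ₁₂ := RingHom.id ℂ) (E := M × M →₀ ℂ) (F := B)
    (Eₗ := compacts A M) ρ.onFiniteRank (finiteRank A M)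

theorem onCompacts_finiteRank (ρ : ToeplitzRep A M B) (c : M × M →₀ ℂ) :
    ρ.onCompacts (finiteRank A M c) = ρ.onFiniteRank c := by
  have hb : ∃ C : ℝ, ∀ c, ‖ρ.onFiniteRank c‖ ≤ C * ‖finiteRank A M c‖ :=
    ⟨1, fun c => by rw [one_mul]; exact ρ.norm_onFiniteRank_le c⟩
  have hd : DenseRange (finiteRank A M) := denseRange_finiteRank
  have := LinearMap.extendOfNorm_eq (𝕜 := ℂ) (𝕜₂ := ℂ) (σ₁₂ := RingHom.id ℂ) (E := M × M →₀ ℂ) (F := B)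
    (Eₗ := compacts A M) (f := ρ.onFiniteRank) (e := finiteRank A M) hd hb c
  exact this

theorem onCompacts_Θ (ρ : ToeplitzRep A M B) (x y : M) :
    ρ.onCompacts ⟨Θ A x y, Θ_mem_compacts x y⟩ = ρ.ψ x * star (ρ.ψ y) := by
  have h : (⟨Θ A x y, Θ_mem_compacts x y⟩ : compacts A M)
      = finiteRank A M (Finsupp.single (x, y) 1) := by simp [finiteRank]
  rw [h, onCompacts_finiteRank]
  simp [onFiniteRank]

/-- `(ψ, π)` is *coisometric* on `K ⊆ J(M)` if `(ψ, π)⁽¹⁾(φ(a)) = π(a)` for all `a ∈ K`. -/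
def IsCoisometricOn (ρ : ToeplitzRep A M B) {K : Submodule ℂ A} (hK : K ≤ J A M) : Prop :=
  ∀ a (ha : a ∈ K), ρ.onCompacts ⟨φ a, hK ha⟩ = ρ.π a

end ToeplitzRep

namespace ToeplitzRep

variable {A : Type u} {M : Type v} [NonUnitalCStarAlgebra A] [NormedAddCommGroup M]
  [NormedSpace ℂ M] [HilbertBimodule A M] {B : Type w} [NonUnitalCStarAlgebra B]

/-- Composition of a Toeplitz representation with a homomorphism of C⋆-algebras. -/
def map {C : Type*} [NonUnitalCStarAlgebra C] (σ : B →⋆ₙₐ[ℂ] C) (ρ : ToeplitzRep A M B) :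
    ToeplitzRep A M C where
  ψ := (σ : B →ₗ[ℂ] C) ∘ₗ ρ.ψ
  π := σ.comp ρ.π
  map_rsmul x a := by
    change σ (ρ.ψ _) = σ (ρ.ψ x) * σ (ρ.π a)
    rw [ρ.map_rsmul, map_mul]
  star_mul_map x y := by
    change star (σ (ρ.ψ x)) * σ (ρ.ψ y) = σ (ρ.π _)
    rw [← ρ.star_mul_map, map_mul, map_star]
  map_lsmul a x := by
    change σ (ρ.ψ _) = σ (ρ.π a) * σ (ρ.ψ x)
    rw [ρ.map_lsmul, map_mul]

theorem map_onCompacts {C : Type*} [NonUnitalCStarAlgebra C] (σ : B →⋆ₙₐ[ℂ] C)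
    (ρ : ToeplitzRep A M B) (T : compacts A M) :
    (ρ.map σ).onCompacts T = σ (ρ.onCompacts T) := by
  have hσ : Continuous σ := AddMonoidHomClass.continuous_of_bound σ 1 fun x => by
    rw [one_mul]; exact NonUnitalStarAlgHom.norm_apply_le σ x
  have hd : DenseRange (finiteRank A M) := denseRange_finiteRank
  refine hd.induction_on (p := fun T => (ρ.map σ).onCompacts T = σ (ρ.onCompacts T)) T
    (isClosed_eq (ρ.map σ).onCompacts.continuous (hσ.comp ρ.onCompacts.continuous)) fun c => ?_
  rw [onCompacts_finiteRank, onCompacts_finiteRank]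
  induction c using Finsupp.induction_linear with
  | zero => simp
  | add f g hf hg => rw [map_add, hf, hg, map_add, map_add]
  | single p c =>
    simp only [onFiniteRank, Finsupp.linearCombination_single, map_smul, map_mul, map_star]
    rfl

end ToeplitzRep

section RelativeCuntzPimsner

variable {A M : Type u} [NonUnitalCStarAlgebra A] [NormedAddCommGroup M]
  [NormedSpace ℂ M] [HilbertBimodule A M] {K : Submodule ℂ A} (hK : K ≤ J A M)

/-- The families `(π(a))_{a ∈ A}, (ψ(x))_{x ∈ M}` given by the Toeplitz representations `(ψ, π)`
of `M` which are coisometric on `K`. -/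
def coisometricClass : FamilyClass (A ⊕ M) where
  Adm B _ f := ∃ ρ : ToeplitzRep A M B, ρ.IsCoisometricOn hK ∧ f = Sum.elim ρ.π ρ.ψ
  bound := Sum.elim norm norm
  norm_le B _ f h g := by
    obtain ⟨ρ, -, rfl⟩ := h
    cases g with
    | inl a => exact NonUnitalStarAlgHom.norm_apply_le ρ.π a
    | inr x => exact ρ.norm_ψ_le x

/-- The *relative Cuntz–Pimsner algebra* `𝒪(K, M)`: the C⋆-algebra generated by a universal
Toeplitz representation of `M` which is coisometric on `K`. -/
abbrev RelCP : Type u := (coisometricClass hK).Univ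

namespace RelCP

/-- The homomorphism `ψ × π : 𝒪(K, M) → B` given by a Toeplitz representation `(ψ, π)` which is
coisometric on `K`. -/
def lift {B : Type u} [NonUnitalCStarAlgebra B] (ρ : ToeplitzRep A M B)
    (hρ : ρ.IsCoisometricOn hK) : RelCP hK →⋆ₙₐ[ℂ] B :=
  FamilyClass.lift (R := coisometricClass hK) ⟨ρ, hρ, rfl⟩

variable {hK} in
theorem ext {x y : RelCP hK} (h : ∀ (B : Type u) [NonUnitalCStarAlgebra B]
    (ρ : ToeplitzRep A M B) (hρ : ρ.IsCoisometricOn hK), lift hK ρ hρ x = lift hK ρ hρ y) :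
    x = y := by
  refine FamilyClass.ext_of_lift fun B _ f hf => ?_
  obtain ⟨ρ, hρ, rfl⟩ := hf
  exact h B ρ hρ

/-- The canonical Toeplitz representation `(k_M, k_A)` of `M` in `𝒪(K, M)`. -/
def rep : ToeplitzRep A M (RelCP hK) :=
  have h1 : ∀ (B : Type u) [NonUnitalCStarAlgebra B] (ρ : ToeplitzRep A M B)
      (hρ : ρ.IsCoisometricOn hK) (a : A),
      lift hK ρ hρ ((coisometricClass hK).gen (Sum.inl a)) = ρ.π a :=
    fun B _ ρ hρ a => FamilyClass.lift_gen _ _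
  have h2 : ∀ (B : Type u) [NonUnitalCStarAlgebra B] (ρ : ToeplitzRep A M B)
      (hρ : ρ.IsCoisometricOn hK) (x : M),
      lift hK ρ hρ ((coisometricClass hK).gen (Sum.inr x)) = ρ.ψ x :=
    fun B _ ρ hρ x => FamilyClass.lift_gen _ _
  { ψ :=
      { toFun := fun x => (coisometricClass hK).gen (Sum.inr x)
        map_add' := fun x y => ext fun B _ ρ hρ => by
          rw [map_add, h2, h2, h2, map_add]
        map_smul' := fun c x => ext fun B _ ρ hρ => by
          rw [map_smul, h2, h2, map_smul]; rfl }
    π :=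
      { toFun := fun a => (coisometricClass hK).gen (Sum.inl a)
        map_smul' := fun c a => ext fun B _ ρ hρ => by
          rw [map_smul, h1, h1, map_smul]; rfl
        map_zero' := ext fun B _ ρ hρ => by rw [h1, map_zero, map_zero]
        map_add' := fun a b => ext fun B _ ρ hρ => by rw [map_add, h1, h1, h1, map_add]
        map_mul' := fun a b => ext fun B _ ρ hρ => by rw [map_mul, h1, h1, h1, map_mul]
        map_star' := fun a => ext fun B _ ρ hρ => by rw [map_star, h1, h1, map_star] }
    map_rsmul := fun x a => ext fun B _ ρ hρ => by
      rw [map_mul]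
      exact (h2 B ρ hρ _).trans ((ρ.map_rsmul x a).trans
        (congrArg₂ _ (h2 B ρ hρ x).symm (h1 B ρ hρ a).symm))
    star_mul_map := fun x y => ext fun B _ ρ hρ => by
      rw [map_mul, map_star]
      exact (congrArg₂ (fun s t => star s * t) (h2 B ρ hρ x) (h2 B ρ hρ y)).trans
        ((ρ.star_mul_map x y).trans (h1 B ρ hρ _).symm)
    map_lsmul := fun a x => ext fun B _ ρ hρ => by
      rw [map_mul]
      exact (h2 B ρ hρ _).trans ((ρ.map_lsmul a x).trans
        (congrArg₂ _ (h1 B ρ hρ a).symm (h2 B ρ hρ x).symm)) }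

/-- `k_A : A → 𝒪(K, M)`. -/
def kA : A →⋆ₙₐ[ℂ] RelCP hK := (rep hK).π

/-- `k_M : M → 𝒪(K, M)`. -/
def kM : M →ₗ[ℂ] RelCP hK := (rep hK).ψ

theorem lift_kA {B : Type u} [NonUnitalCStarAlgebra B] (ρ : ToeplitzRep A M B)
    (hρ : ρ.IsCoisometricOn hK) (a : A) : lift hK ρ hρ (kA hK a) = ρ.π a :=
  FamilyClass.lift_gen (R := coisometricClass hK) _ _

theorem lift_kM {B : Type u} [NonUnitalCStarAlgebra B] (ρ : ToeplitzRep A M B)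
    (hρ : ρ.IsCoisometricOn hK) (x : M) : lift hK ρ hρ (kM hK x) = ρ.ψ x :=
  FamilyClass.lift_gen (R := coisometricClass hK) _ _

/-- The canonical Toeplitz representation in `𝒪(K, M)` is coisometric on `K`. -/
theorem rep_isCoisometricOn : (rep hK).IsCoisometricOn hK := by
  intro a ha
  refine ext fun B _ ρ hρ => ?_
  have h : (rep hK).map (lift hK ρ hρ) = ρ := by
    have e1 : ((rep hK).map (lift hK ρ hρ)).ψ = ρ.ψ := LinearMap.ext fun x => lift_kM hK ρ hρ x
    have e2 : ((rep hK).map (lift hK ρ hρ)).π = ρ.π :=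
      NonUnitalStarAlgHom.ext fun x => lift_kA hK ρ hρ x
    cases h : (rep hK).map (lift hK ρ hρ)
    cases ρ
    simp only [h] at e1 e2
    subst e1 e2
    rfl
  rw [← ToeplitzRep.map_onCompacts, h, hρ a ha]
  exact (lift_kA hK ρ hρ a).symm

/-- Every property of `𝒪(K, M)` preserved by the C⋆-algebra operations and limits may be checked
on `k_A(A)` and `k_M(M)`: these generate `𝒪(K, M)`. -/
theorem induction {p : RelCP hK → Prop} (hclosed : IsClosed {x | p x})
    (hA : ∀ a, p (kA hK a)) (hM : ∀ x, p (kM hK x)) (hM' : ∀ x, p (star (kM hK x)))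
    (hadd : ∀ x y, p x → p y → p (x + y)) (hzero : p 0) (hmul : ∀ x y, p x → p y → p (x * y))
    (hsmul : ∀ (c : ℂ) x, p x → p (c • x)) (x : RelCP hK) : p x := by
  refine FamilyClass.induction (R := coisometricClass hK) hclosed ?_ ?_ hadd hzero hmul hsmul x
  · rintro (a | x)
    · exact hA a
    · exact hM x
  · rintro (a | x)
    · have := hA (star a)
      rwa [map_star] at this
    · exact hM' x

end RelCP

end RelativeCuntzPimsner

/-! ### Exel systems and the bimodule `M_L` -/

/-- The strict topology on the multiplier algebra `M(A)`: the topology of pointwise norm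
convergence of `a ↦ m a` and `a ↦ a m`. -/
abbrev strictTopology (A : Type u) [NonUnitalCStarAlgebra A] : TopologicalSpace 𝓜(ℂ, A) :=
  TopologicalSpace.induced (fun m (a : A) => (m.fst a, m.snd a)) inferInstance

/-- A linear map between ⋆-algebras is positive if it maps elements of the form `a⋆a` (the positive
elements, in the case of C⋆-algebras) to elements of this form. -/
def IsPositiveMap {A B : Type*} [Mul A] [Star A] [Mul B] [Star B] (f : A → B) : Prop :=
  ∀ a : A, ∃ b : B, f (star a * a) = star b * b

/-- An *Exel system* `(A, α, L)`: an extendible endomorphism `α` of a C⋆-algebra `A` and a transfer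
operator `L` for `(A, α)`. Here `m.snd x` is the product `x m ∈ A` of `x ∈ A` and `m ∈ M(A)`. -/
structure ExelSystem (A : Type u) [NonUnitalCStarAlgebra A] where
  /-- the endomorphism -/
  α : A →⋆ₙₐ[ℂ] A
  /-- the transfer operator -/
  L : A →L[ℂ] A
  /-- `α` extends to a strictly continuous endomorphism of `M(A)` -/
  extendible : ∃ αbar : 𝓜(ℂ, A) →⋆ₙₐ[ℂ] 𝓜(ℂ, A),
    Continuous[strictTopology A, strictTopology A] αbar ∧
      ∀ a : A, αbar (DoubleCentralizer.coeHom a) = DoubleCentralizer.coeHom (α a)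
  /-- `L` is positive -/
  positive : IsPositiveMap L
  /-- `L` extends to a bounded positive linear map `L̄` on `M(A)` with `L(α(a) m) = a L̄(m)` -/
  transfer : ∃ Lbar : 𝓜(ℂ, A) →L[ℂ] 𝓜(ℂ, A), IsPositiveMap Lbar ∧
    (∀ a : A, Lbar (DoubleCentralizer.coeHom a) = DoubleCentralizer.coeHom (L a)) ∧
    ∀ (a : A) (m : 𝓜(ℂ, A)), L (m.snd (α a)) = (Lbar m).snd a

namespace ExelSystem

variable {A : Type u} [NonUnitalCStarAlgebra A] (E : ExelSystem A)

theorem L_α_mul (a b : A) : E.L (E.α a * b) = a * E.L b := by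
  obtain ⟨Lbar, -, h1, h2⟩ := E.transfer
  have := h2 a (DoubleCentralizer.coeHom b)
  rw [h1] at this
  exact this

theorem L_star (a : A) : E.L (star a) = star (E.L a) := by
  let _ := CStarAlgebra.spectralOrder A
  have := CStarAlgebra.spectralOrderedRing A
  obtain ⟨y, hy, -, hsum⟩ := CStarAlgebra.exists_sum_four_nonneg a
  have hsa : ∀ i, star (E.L (y i)) = E.L (y i) := fun i => by
    obtain ⟨b, hb⟩ := CStarAlgebra.nonneg_iff_eq_star_mul_self.1 (hy i)
    obtain ⟨c, hc⟩ := E.positive b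
    rw [hb, hc, star_mul, star_star]
  have hsa' : ∀ i, star (y i) = y i := fun i => (IsSelfAdjoint.of_nonneg (hy i)).star_eq
  rw [hsum]
  simp only [star_sum, map_sum, star_smul, map_smul, hsa, hsa']

theorem L_mul_α (a b : A) : E.L (b * E.α a) = E.L b * a := by
  rw [← star_star (b * E.α a), L_star, star_mul, ← map_star E.α, L_α_mul, star_mul, star_star,
    L_star, star_star]

theorem norm_L_conj_le (a b : A) :
    ‖E.L (star (a * b) * (a * b))‖ ≤ ‖a‖ ^ 2 * ‖E.L (star b * b)‖ := by
  let _ := CStarAlgebra.spectralOrder A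
  have := CStarAlgebra.spectralOrderedRing A
  have hpos : ∀ x : A, 0 ≤ x → 0 ≤ E.L x := fun x hx => by
    obtain ⟨c, rfl⟩ := CStarAlgebra.nonneg_iff_eq_star_mul_self.1 hx
    obtain ⟨d, hd⟩ := E.positive c
    rw [hd]
    exact star_mul_self_nonneg d
  have h1 : star (a * b) * (a * b) ≤ ((‖a‖ ^ 2 : ℝ) : ℂ) • (star b * b) := by
    have h2 : star b * (star a * a) * b ≤ ‖star a * a‖ • (star b * b) :=
      CStarAlgebra.star_left_conjugate_le_norm_smul (IsSelfAdjoint.star_mul_self a)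
    rw [CStarRing.norm_star_mul_self, ← pow_two] at h2
    rw [Complex.coe_smul, star_mul]
    simpa only [mul_assoc] using h2
  have h2 : E.L (star (a * b) * (a * b)) ≤ ((‖a‖ ^ 2 : ℝ) : ℂ) • E.L (star b * b) := by
    have := hpos _ (sub_nonneg.2 h1)
    rwa [map_sub, map_smul, sub_nonneg] at this
  refine (CStarAlgebra.norm_le_norm_of_nonneg_of_le (hpos _ (star_mul_self_nonneg _)) h2).trans ?_
  rw [norm_smul, Complex.norm_real, Real.norm_of_nonneg (by positivity)]

/-- The Cauchy–Schwarz inequality for the pairing `⟨m, n⟩_L = L(m⋆ n)`. -/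
theorem norm_L_le (x y : A) :
    ‖E.L (star x * y)‖ ^ 2 ≤ ‖E.L (star x * x)‖ * ‖E.L (star y * y)‖ := by
  refine norm_sq_le_of_quadratic fun t _ => ?_
  obtain ⟨c, hc⟩ := E.positive ((t : ℂ) • y - x * E.α (E.L (star x * y)))
  refine ⟨c, hc ▸ ?_⟩
  have h : star (E.L (star x * y)) = E.L (star y * x) := by
    rw [← L_star, star_mul, star_star]
  have e1 : star ((t : ℂ) • y - x * E.α (E.L (star x * y))) *
      ((t : ℂ) • y - x * E.α (E.L (star x * y))) =
      (t : ℂ) • (t : ℂ) • (star y * y) - (t : ℂ) • ((star y * x) * E.α (E.L (star x * y)))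
      - ((t : ℂ) • (E.α (E.L (star y * x)) * (star x * y))
        - E.α (E.L (star y * x)) * ((star x * x) * E.α (E.L (star x * y)))) := by
    rw [star_sub, star_mul, ← map_star, h, star_smul, sub_mul, mul_sub, mul_sub]
    simp only [Complex.star_def, Complex.conj_ofReal, smul_mul_assoc, mul_smul_comm, mul_assoc]
  rw [e1, h]
  simp only [map_sub, map_smul, L_mul_α, L_α_mul]
  simp only [Complex.coe_smul, smul_smul, two_mul, add_smul, pow_two, mul_assoc]
  abel

/-- The pre-inner-product module `A_L`, which is `A` as a vector space. -/
def AL (_E : ExelSystem A) : Type u := A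

instance : AddCommGroup E.AL := inferInstanceAs (AddCommGroup A)
instance : Module ℂ E.AL := inferInstanceAs (Module ℂ A)

/-- The identity map `A → A_L`. -/
def toAL : A →ₗ[ℂ] E.AL := LinearMap.id

/-- The seminorm `‖m‖ = ‖L(m⋆ m)‖ ^ (1 / 2)` on `A_L`. -/
instance : Norm E.AL := ⟨fun m => √‖E.L (star (show A from m) * (show A from m))‖⟩

theorem norm_toAL (m : A) : ‖E.toAL m‖ = √‖E.L (star m * m)‖ := rfl

theorem norm_toAL_sq (m : A) : ‖E.toAL m‖ ^ 2 = ‖E.L (star m * m)‖ :=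
  Real.sq_sqrt (norm_nonneg _)

theorem norm_L_le_toAL (x y : A) : ‖E.L (star x * y)‖ ≤ ‖E.toAL x‖ * ‖E.toAL y‖ := by
  have h := E.norm_L_le x y
  rw [← norm_toAL_sq, ← norm_toAL_sq, ← mul_pow] at h
  exact (pow_le_pow_iff_left₀ (norm_nonneg _)
    (mul_nonneg (Real.sqrt_nonneg _) (Real.sqrt_nonneg _)) two_ne_zero).1 h

theorem AL_core : SeminormedSpace.Core ℂ E.AL where
  norm_nonneg m := Real.sqrt_nonneg _
  norm_smul c m := by
    change ‖E.toAL (c • (show A from m))‖ = ‖c‖ * ‖E.toAL (show A from m)‖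
    rw [norm_toAL, norm_toAL, star_smul, smul_mul_smul_comm, map_smul, norm_smul, norm_mul,
      norm_star, Real.sqrt_mul (by positivity), Real.sqrt_mul_self (norm_nonneg _)]
  norm_triangle m n := by
    change ‖E.toAL ((show A from m) + (show A from n))‖ ≤
      ‖E.toAL (show A from m)‖ + ‖E.toAL (show A from n)‖
    generalize (show A from m) = x
    generalize (show A from n) = y
    have h0 : ∀ z, 0 ≤ ‖E.toAL z‖ := fun z => Real.sqrt_nonneg _
    have h : ‖E.toAL (x + y)‖ ^ 2 ≤ (‖E.toAL x‖ + ‖E.toAL y‖) ^ 2 := by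
      rw [norm_toAL_sq]
      calc ‖E.L (star (x + y) * (x + y))‖ =
            ‖E.L (star x * x) + E.L (star x * y) + E.L (star y * x) + E.L (star y * y)‖ := by
            rw [star_add, add_mul, mul_add, mul_add, map_add, map_add, map_add]
            congr 1
            abel
        _ ≤ ‖E.L (star x * x)‖ + ‖E.L (star x * y)‖ + ‖E.L (star y * x)‖ + ‖E.L (star y * y)‖ :=
            norm_add₄_le
        _ ≤ ‖E.toAL x‖ ^ 2 + ‖E.toAL x‖ * ‖E.toAL y‖ + ‖E.toAL y‖ * ‖E.toAL x‖
              + ‖E.toAL y‖ ^ 2 := by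
            gcongr
            · exact (E.norm_toAL_sq x).ge
            · exact E.norm_L_le_toAL x y
            · exact E.norm_L_le_toAL y x
            · exact (E.norm_toAL_sq y).ge
        _ = _ := by ring
    exact (pow_le_pow_iff_left₀ (h0 _) (add_nonneg (h0 _) (h0 _)) two_ne_zero).1 h

instance : SeminormedAddCommGroup E.AL := SeminormedAddCommGroup.ofCore E.AL_core

instance : NormedSpace ℂ E.AL where
  norm_smul_le c x := (E.AL_core.norm_smul c x).le

/-- The Hilbert module `M_L`: the (Hausdorff) completion of `A_L`. -/
def ML : Type u := UniformSpace.Completion E.AL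

instance : NormedAddCommGroup E.ML :=
  inferInstanceAs (NormedAddCommGroup (UniformSpace.Completion E.AL))
instance : NormedSpace ℂ E.ML :=
  inferInstanceAs (NormedSpace ℂ (UniformSpace.Completion E.AL))
instance : CompleteSpace E.ML :=
  inferInstanceAs (CompleteSpace (UniformSpace.Completion E.AL))

/-- The quotient map `q : A_L → M_L`. -/
def q : A →ₗ[ℂ] E.ML :=
  (UniformSpace.Completion.toComplₗᵢ (𝕜 := ℂ) (E := E.AL)).toLinearMap ∘ₗ E.toAL

theorem norm_q (m : A) : ‖E.q m‖ = ‖E.toAL m‖ := UniformSpace.Completion.norm_coe _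

theorem norm_q_sq (m : A) : ‖E.q m‖ ^ 2 = ‖E.L (star m * m)‖ := by rw [norm_q, norm_toAL_sq]

theorem denseRange_q : DenseRange E.q := UniformSpace.Completion.denseRange_coe (α := E.AL)

variable {E} in
theorem ext_q {F : Type*} [TopologicalSpace F] [T2Space F] {f g : E.ML → F} (hf : Continuous f)
    (hg : Continuous g) (h : ∀ m, f (E.q m) = g (E.q m)) : f = g :=
  E.denseRange_q.equalizer hf hg (funext h)

/-- The map `⟨m, ·⟩_L : M_L → A` for `m ∈ A_L`. -/
def preip (m : A) : E.ML →L[ℂ] A :=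
  LinearMap.extendOfNorm ((E.L : A →ₗ[ℂ] A) ∘ₗ LinearMap.mulLeft ℂ (star m)) E.q

theorem preip_bound (m n : A) :
    ‖((E.L : A →ₗ[ℂ] A) ∘ₗ LinearMap.mulLeft ℂ (star m)) n‖ ≤ ‖E.q m‖ * ‖E.q n‖ := by
  rw [norm_q, norm_q]
  exact E.norm_L_le_toAL m n

theorem preip_q (m n : A) : E.preip m (E.q n) = E.L (star m * n) :=
  LinearMap.extendOfNorm_eq E.denseRange_q ⟨_, E.preip_bound m⟩ n

theorem norm_preip_le (m : A) : ‖E.preip m‖ ≤ ‖E.q m‖ :=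
  ContinuousLinearMap.opNorm_le_bound _ (norm_nonneg _) fun x =>
    LinearMap.norm_extendOfNorm_apply_le E.denseRange_q _ (E.preip_bound m) x

/-- `preip` as a conjugate-linear map. -/
def preipₗ : A →ₗ⋆[ℂ] (E.ML →L[ℂ] A) where
  toFun := E.preip
  map_add' m n := ContinuousLinearMap.coeFn_injective
    (ext_q (ContinuousLinearMap.continuous _) (ContinuousLinearMap.continuous _) fun x => by
      rw [add_apply, preip_q, preip_q, preip_q, star_add, add_mul, map_add])
  map_smul' c m := ContinuousLinearMap.coeFn_injective
    (ext_q (ContinuousLinearMap.continuous _) (ContinuousLinearMap.continuous _) fun x => by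
      rw [smul_apply, preip_q, preip_q, star_smul, smul_mul_assoc, map_smul]
      rfl)

/-- The `A`-valued inner product on `M_L`, the continuous extension of `⟨m, n⟩_L = L(m⋆ n)`. -/
def ipML : E.ML →L⋆[ℂ] (E.ML →L[ℂ] A) := LinearMap.extendOfNorm E.preipₗ E.q

theorem ipML_q (m n : A) : E.ipML (E.q m) (E.q n) = E.L (star m * n) := by
  have h : E.ipML (E.q m) = E.preipₗ m := LinearMap.extendOfNorm_eq E.denseRange_q
    ⟨1, fun x => by rw [one_mul]; exact E.norm_preip_le x⟩ m
  rw [h]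
  exact E.preip_q m n

theorem continuous_ipML {X : Type*} [TopologicalSpace X] {f g : X → E.ML} (hf : Continuous f)
    (hg : Continuous g) : Continuous fun x => E.ipML (f x) (g x) :=
  (E.ipML.continuous.comp hf).clm_apply hg

/-- The right action of `a ∈ A` on `M_L`, the continuous extension of `m · a = m α(a)`. -/
def rightML (a : A) : E.ML →L[ℂ] E.ML :=
  LinearMap.extendOfNorm (E.q ∘ₗ LinearMap.mulRight ℂ (E.α a)) E.q

theorem rightML_q (a m : A) : E.rightML a (E.q m) = E.q (m * E.α a) := by
  refine LinearMap.extendOfNorm_eq E.denseRange_q ⟨‖a‖, fun x => ?_⟩ m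
  change ‖E.q (x * E.α a)‖ ≤ ‖a‖ * ‖E.q x‖
  refine (pow_le_pow_iff_left₀ (norm_nonneg _) (by positivity) two_ne_zero).1 ?_
  rw [mul_pow, norm_q_sq, norm_q_sq, star_mul, ← map_star]
  have : E.α (star a) * star x * (x * E.α a) = E.α (star a) * ((star x * x) * E.α a) := by
    simp only [mul_assoc]
  rw [this, L_α_mul, L_mul_α]
  calc ‖star a * (E.L (star x * x) * a)‖ ≤ ‖star a‖ * (‖E.L (star x * x)‖ * ‖a‖) :=
        (norm_mul_le _ _).trans (by gcongr; exact norm_mul_le _ _)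
    _ = _ := by rw [norm_star]; ring

/-- The left action of `a ∈ A` on `M_L`, the continuous extension of left multiplication. -/
def leftML (a : A) : E.ML →L[ℂ] E.ML :=
  LinearMap.extendOfNorm (E.q ∘ₗ LinearMap.mulLeft ℂ a) E.q

theorem leftML_q (a m : A) : E.leftML a (E.q m) = E.q (a * m) := by
  refine LinearMap.extendOfNorm_eq E.denseRange_q ⟨‖a‖, fun x => ?_⟩ m
  change ‖E.q (a * x)‖ ≤ ‖a‖ * ‖E.q x‖
  refine (pow_le_pow_iff_left₀ (norm_nonneg _) (by positivity) two_ne_zero).1 ?_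
  rw [mul_pow, norm_q_sq, norm_q_sq]
  exact E.norm_L_conj_le a x

/-- The Hilbert `A`-bimodule `M_L`: the completion of `A_L`, with
`⟨q(m), q(n)⟩ = L(m⋆ n)`, `q(m) · a = q(m α(a))` and `a · q(m) = q(a m)`. -/
instance : HilbertBimodule A E.ML where
  ip x y := E.ipML x y
  rsmul x a := E.rightML a x
  φ :=
    { toFun := E.leftML
      map_smul' := fun c a => ContinuousLinearMap.coeFn_injective
        (ext_q (ContinuousLinearMap.continuous _) (ContinuousLinearMap.continuous _) fun m => by
          rw [smul_apply, leftML_q, leftML_q, smul_mul_assoc, map_smul]; rfl)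
      map_zero' := ContinuousLinearMap.coeFn_injective
        (ext_q (ContinuousLinearMap.continuous _) (ContinuousLinearMap.continuous _) fun m => by
          rw [leftML_q, zero_mul, map_zero]; rfl)
      map_add' := fun a b => ContinuousLinearMap.coeFn_injective
        (ext_q (ContinuousLinearMap.continuous _) (ContinuousLinearMap.continuous _) fun m => by
          rw [add_apply, leftML_q, leftML_q, leftML_q, add_mul, map_add])
      map_mul' := fun a b => ContinuousLinearMap.coeFn_injective
        (ext_q (ContinuousLinearMap.continuous _) (ContinuousLinearMap.continuous _) fun m => by
          change _ = E.leftML a (E.leftML b (E.q m))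
          rw [leftML_q, leftML_q, leftML_q, mul_assoc]) }
  ip_add_right x y z := map_add (E.ipML x) y z
  ip_smul_right c x y := map_smul (E.ipML x) c y
  star_ip x y := by
    refine E.denseRange_q.induction_on₂ (p := fun x y => star (E.ipML x y) = E.ipML y x)
      (isClosed_eq (E.continuous_ipML continuous_fst continuous_snd).star
        (E.continuous_ipML continuous_snd continuous_fst)) (fun m n => ?_) x y
    rw [ipML_q, ipML_q, ← L_star, star_mul, star_star]
  ip_self_pos x := by
    let _ := CStarAlgebra.spectralOrder A
    have := CStarAlgebra.spectralOrderedRing A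
    have h : 0 ≤ E.ipML x x := by
      refine E.denseRange_q.induction_on (p := fun x => 0 ≤ E.ipML x x) x
        (isClosed_le continuous_const (E.continuous_ipML continuous_id continuous_id)) fun m => ?_
      obtain ⟨c, hc⟩ := E.positive m
      rw [ipML_q, hc]
      exact star_mul_self_nonneg c
    exact CStarAlgebra.nonneg_iff_eq_star_mul_self.1 h
  norm_sq x := by
    refine E.denseRange_q.induction_on (p := fun x => ‖x‖ ^ 2 = ‖E.ipML x x‖) x
      (isClosed_eq (continuous_norm.pow 2) (E.continuous_ipML continuous_id continuous_id).norm)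
      fun m => ?_
    rw [ipML_q, norm_q_sq]
  ip_rsmul x y a := by
    refine E.denseRange_q.induction_on₂
      (p := fun x y => E.ipML x (E.rightML a y) = E.ipML x y * a)
      (isClosed_eq
        (E.continuous_ipML continuous_fst ((E.rightML a).continuous.comp continuous_snd))
        ((E.continuous_ipML continuous_fst continuous_snd).mul continuous_const))
      (fun m n => ?_) x y
    rw [rightML_q, ipML_q, ipML_q, ← mul_assoc, L_mul_α]
  ip_φ a x y := by
    refine E.denseRange_q.induction_on₂
      (p := fun x y => E.ipML (E.leftML a x) y = E.ipML x (E.leftML (star a) y))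
      (isClosed_eq
        (E.continuous_ipML ((E.leftML a).continuous.comp continuous_fst) continuous_snd)
        (E.continuous_ipML continuous_fst ((E.leftML (star a)).continuous.comp continuous_snd)))
      (fun m n => ?_) x y
    rw [leftML_q, leftML_q, ipML_q, ipML_q, star_mul, mul_assoc]

theorem ip_q (m n : A) : (ip (E.q m) (E.q n) : A) = E.L (star m * n) := E.ipML_q m n

theorem rsmul_q (m a : A) : rsmul (E.q m) a = E.q (m * E.α a) := E.rightML_q a m

theorem φ_q (a m : A) : (φ a : E.ML →L[ℂ] E.ML) (E.q m) = E.q (a * m) := E.leftML_q a m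

/-- The closed ideal `closure (A α(A) A)` of `A`: the closed linear span of the products
`a α(b) c`. -/
def AαA : Submodule ℂ A :=
  (Submodule.span ℂ {x | ∃ a b c : A, x = a * E.α b * c}).topologicalClosure

/-- The ideal `K_α = closure (A α(A) A) ∩ φ⁻¹(𝒦(M_L))` of `A`. -/
def Kα : Submodule ℂ A := E.AαA ⊓ J A E.ML

theorem Kα_le : E.Kα ≤ J A E.ML := inf_le_right

end ExelSystem

theorem continuous_hom {A : Type u} {B : Type v} [NonUnitalCStarAlgebra A]
    [NonUnitalCStarAlgebra B] (f : A →⋆ₙₐ[ℂ] B) : Continuous f :=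
  AddMonoidHomClass.continuous_of_bound f 1 fun x => by
    rw [one_mul]
    exact NonUnitalStarAlgHom.norm_apply_le f x

/-! ### Toeplitz-covariant representations -/

/-- A *Toeplitz-covariant representation* `(π, V)` of `(A, α, L)` in a C⋆-algebra `B`: a
nondegenerate homomorphism `π : A → B` and an element `V ∈ M(B)` such that, in `M(B)`,
`V π(a) = π(α(a)) V` and `V⋆ π(a) V = π(L(a))`. -/
structure ToeplitzCovRep {A : Type u} [NonUnitalCStarAlgebra A] (E : ExelSystem A) (B : Type v)
    [NonUnitalCStarAlgebra B] where
  π : A →⋆ₙₐ[ℂ] B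
  nondegenerate : (Submodule.span ℂ {x : B | ∃ a b, x = π a * b}).topologicalClosure = ⊤
  V : 𝓜(ℂ, B)
  tc1 : ∀ a, V * DoubleCentralizer.coeHom (π a) = DoubleCentralizer.coeHom (π (E.α a)) * V
  tc2 : ∀ a, star V * DoubleCentralizer.coeHom (π a) * V = DoubleCentralizer.coeHom (π (E.L a))

namespace ToeplitzCovRep

variable {A : Type u} [NonUnitalCStarAlgebra A] {E : ExelSystem A} {B : Type v}
  [NonUnitalCStarAlgebra B]

/-- The element `π(a) V` of `B`. -/
def πV (ρ : ToeplitzCovRep E B) : A →ₗ[ℂ] B where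
  toFun a := ρ.V.snd (ρ.π a)
  map_add' a b := by rw [map_add, map_add]
  map_smul' c a := by rw [map_smul, map_smul]; rfl

variable (ρ : ToeplitzCovRep E B)

theorem πV_apply (a : A) : ρ.πV a = ρ.V.snd (ρ.π a) := rfl

/-- As a multiplier, `πV a` is the product of `π(a)` and `V`. -/
theorem coeHom_πV (a : A) : (DoubleCentralizer.coeHom (ρ.πV a) : 𝓜(ℂ, B)) =
    DoubleCentralizer.coeHom (ρ.π a) * ρ.V :=
  multiplier_ext fun _ => ρ.V.central _ _

theorem fst_π (a : A) : ρ.V.fst (ρ.π a) = ρ.πV (E.α a) := by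
  refine eq_of_mul_right fun z => ?_
  have h := congrArg (fun m : 𝓜(ℂ, B) => m.fst z) (ρ.tc1 a)
  rw [← coeHom_πV] at h
  rw [← multiplier_fst_mul]
  exact h

theorem fst_π_mul (a : A) (b : B) : ρ.V.fst (ρ.π a * b) = ρ.πV (E.α a) * b := by
  rw [multiplier_fst_mul, fst_π]

theorem π_mul_fst (a : A) (b : B) : ρ.π a * ρ.V.fst b = ρ.πV a * b := (ρ.V.central _ _).symm

theorem star_fst_π_mul (a : A) (b : B) :
    (star ρ.V).fst (ρ.π a * b) = star (ρ.πV (star a)) * b := by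
  rw [multiplier_fst_mul, DoubleCentralizer.star_fst, ← map_star ρ.π, πV_apply]

theorem π_mul_πV (a b : A) : ρ.π a * ρ.πV b = ρ.πV (a * b) := by
  rw [πV_apply, πV_apply, map_mul, multiplier_snd_mul]

theorem πV_mul_π (a b : A) : ρ.πV a * ρ.π b = ρ.πV (a * E.α b) := by
  rw [← π_mul_fst, fst_π, π_mul_πV]

theorem star_πV_mul_πV (a b : A) : star (ρ.πV a) * ρ.πV b = ρ.π (E.L (star a * b)) := by
  refine eq_of_mul_right fun z => ?_
  have h := congrArg (fun m : 𝓜(ℂ, B) => m.fst z) (ρ.tc2 (star a * b))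
  change (star ρ.V).fst (ρ.π (star a * b) * ρ.V.fst z) = ρ.π (E.L (star a * b)) * z at h
  rw [mul_assoc, ← h, map_mul ρ.π, mul_assoc (ρ.π (star a)), π_mul_fst, star_fst_π_mul, star_star]

theorem norm_πV_le (a : A) : ‖ρ.πV a‖ ≤ √‖E.L (star a * a)‖ := by
  refine Real.le_sqrt_of_sq_le ?_
  rw [pow_two, ← CStarRing.norm_star_mul_self, star_πV_mul_πV]
  exact NonUnitalStarAlgHom.norm_apply_le ρ.π _

theorem norm_πV_le' (a : A) : ‖ρ.πV a‖ ≤ √‖E.L‖ * ‖a‖ := by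
  refine (ρ.norm_πV_le a).trans ?_
  rw [← Real.sqrt_sq (norm_nonneg a), ← Real.sqrt_mul (norm_nonneg _)]
  refine Real.sqrt_le_sqrt ((E.L.le_opNorm _).trans (le_of_eq ?_))
  rw [CStarRing.norm_star_mul_self, pow_two]

theorem norm_V_le : ‖ρ.V‖ ≤ √‖E.L‖ := by
  rw [← DoubleCentralizer.norm_fst]
  refine ContinuousLinearMap.opNorm_le_bound _ (Real.sqrt_nonneg _) fun b => ?_
  obtain ⟨l, hl, h1, -, h3⟩ := exists_approx_unit A
  have hcl : IsClosed {b : B | ‖ρ.V.fst b‖ ≤ √‖E.L‖ * ‖b‖} :=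
    isClosed_le ρ.V.fst.continuous.norm (continuous_const.mul continuous_norm)
  have hdense : b ∈ (Submodule.span ℂ {x : B | ∃ a b, x = ρ.π a * b}).topologicalClosure := by
    rw [ρ.nondegenerate]; trivial
  refine closure_minimal (fun b hb => ?_) hcl hdense
  have hlim : Tendsto (fun e => ρ.π e * b) l (𝓝 b) := by
    induction hb using Submodule.span_induction with
    | mem x hx =>
      obtain ⟨a, c, rfl⟩ := hx
      have hc : Continuous ρ.π := continuous_hom ρ.π
      have := ((hc.tendsto a).comp (h1 a)).mul_const c
      refine this.congr fun e => ?_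
      rw [Function.comp_apply, map_mul, mul_assoc]
    | zero => simp
    | add x y _ _ hx hy => simpa only [mul_add] using hx.add hy
    | smul c x _ hx => simpa only [mul_smul_comm] using hx.const_smul c
  refine le_of_tendsto ((ρ.V.fst.continuous.tendsto b).comp hlim).norm ?_
  filter_upwards [h3] with e he
  rw [Function.comp_apply, fst_π_mul]
  refine (norm_mul_le _ _).trans ?_
  gcongr
  refine (ρ.norm_πV_le' _).trans (mul_le_of_le_one_right (Real.sqrt_nonneg _) ?_)
  exact (NonUnitalStarAlgHom.norm_apply_le E.α e).trans he.1

theorem πV_bound (a : A) : ‖ρ.πV a‖ ≤ 1 * ‖E.q a‖ := by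
  rw [one_mul, ExelSystem.norm_q, ExelSystem.norm_toAL]
  exact ρ.norm_πV_le a

/-- The map `ψ_V : M_L → B`, the unique bounded linear map with `ψ_V(q(a)) = π(a) V`. -/
def psi : E.ML →L[ℂ] B := LinearMap.extendOfNorm ρ.πV E.q

theorem psi_q (a : A) : ρ.psi (E.q a) = ρ.πV a :=
  LinearMap.extendOfNorm_eq E.denseRange_q ⟨1, ρ.πV_bound⟩ a

/-- `(ψ_V, π)` is a Toeplitz representation of `M_L`. -/
def toToeplitzRep : ToeplitzRep A E.ML B where
  ψ := ρ.psi
  π := ρ.π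
  map_rsmul x a := by
    refine congrFun (ExelSystem.ext_q (f := fun x => ρ.psi (E.rightML a x))
      (g := fun x => ρ.psi x * ρ.π a) (by fun_prop) (by fun_prop) fun m => ?_) x
    rw [E.rightML_q, psi_q, psi_q, πV_mul_π]
  star_mul_map x y := by
    refine E.denseRange_q.induction_on₂
      (p := fun x y => star (ρ.psi x) * ρ.psi y = ρ.π (E.ipML x y))
      (isClosed_eq (by fun_prop)
        ((continuous_hom ρ.π).comp (E.continuous_ipML continuous_fst continuous_snd)))
      (fun m n => ?_) x y
    rw [psi_q, psi_q, E.ipML_q, star_πV_mul_πV]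
  map_lsmul a x := by
    refine congrFun (ExelSystem.ext_q (f := fun x => ρ.psi (E.leftML a x))
      (g := fun x => ρ.π a * ρ.psi x) (by fun_prop) (by fun_prop) fun m => ?_) x
    rw [E.leftML_q, psi_q, psi_q, π_mul_πV]

end ToeplitzCovRep

/-- The image `(Q ∘ π, Q̄(V))` of a Toeplitz-covariant representation `(π, V)` in `B` under the
quotient map `Q : B → B ⧸ I`. -/
def ToeplitzCovRep.quot {A : Type u} [NonUnitalCStarAlgebra A] {E : ExelSystem A} {B : Type v}
    [NonUnitalCStarAlgebra B] (ρ : ToeplitzCovRep E B) (I : ClosedIdeal B) :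
    ToeplitzCovRep E I.Quot where
  π := I.proj.comp ρ.π
  nondegenerate := by
    rw [eq_top_iff]
    rintro x -
    obtain ⟨x, rfl⟩ := I.proj_surjective x
    have hx : x ∈ (Submodule.span ℂ {x : B | ∃ a b, x = ρ.π a * b}).topologicalClosure := by
      rw [ρ.nondegenerate]; trivial
    have hc : Continuous I.proj := continuous_hom I.proj
    refine map_mem_closure hc hx fun y hy => ?_
    induction hy using Submodule.span_induction with
    | mem y hy =>
      obtain ⟨a, b, rfl⟩ := hy
      exact Submodule.subset_span ⟨a, I.proj b, map_mul _ _ _⟩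
    | zero => rw [map_zero]; exact zero_mem (Submodule.span ℂ _)
    | add y z _ _ hy hz => rw [map_add]; exact add_mem (S := Submodule ℂ I.Quot) hy hz
    | smul c y _ hy => rw [map_smul]; exact Submodule.smul_mem _ c hy
  V := I.projBar ρ.V
  tc1 a := multiplier_ext fun x => by
    obtain ⟨x, rfl⟩ := I.proj_surjective x
    have h := congrArg (fun m : 𝓜(ℂ, B) => I.proj (m.fst x)) (ρ.tc1 a)
    change I.proj (ρ.V.fst (ρ.π a * x)) = I.proj (ρ.π (E.α a) * ρ.V.fst x) at h
    rw [map_mul I.proj] at h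
    exact h
  tc2 a := multiplier_ext fun x => by
    obtain ⟨x, rfl⟩ := I.proj_surjective x
    have h := congrArg (fun m : 𝓜(ℂ, B) => I.proj (m.fst x)) (ρ.tc2 a)
    change I.proj (star (ρ.V.snd (star (ρ.π a * ρ.V.fst x)))) = I.proj (ρ.π (E.L a) * x) at h
    rw [map_star, map_mul] at h
    exact h

namespace ExelSystem

variable {A : Type u} [NonUnitalCStarAlgebra A] (E : ExelSystem A)

/-! ### The Toeplitz crossed product -/

/-- The families `(π(a))_{a ∈ A}`, `(π(a) V)_{a ∈ A}`, where `(π, V)` is a Toeplitz-covariant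
representation. -/
def toeplitzClass : FamilyClass (A ⊕ A) where
  Adm B _ f := ∃ ρ : ToeplitzCovRep E B, f = Sum.elim ρ.π ρ.πV
  bound := Sum.elim norm fun a => √‖E.L (star a * a)‖
  norm_le B _ f h g := by
    obtain ⟨ρ, rfl⟩ := h
    cases g with
    | inl a => exact NonUnitalStarAlgHom.norm_apply_le ρ.π a
    | inr a => exact ρ.norm_πV_le a

/-- The *Toeplitz crossed product* `𝒯(A, α, L)`: the C⋆-algebra generated by a universal
Toeplitz-covariant representation `(i, S)` of `(A, α, L)`, that is, by `i(A) ∪ i(A) S`. -/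
abbrev Toeplitz : Type u := E.toeplitzClass.Univ

namespace Toeplitz

variable {E} in
/-- The homomorphism `π × V : 𝒯(A, α, L) → B` given by a Toeplitz-covariant representation. -/
def lift {B : Type u} [NonUnitalCStarAlgebra B] (ρ : ToeplitzCovRep E B) :
    E.Toeplitz →⋆ₙₐ[ℂ] B :=
  FamilyClass.lift (R := E.toeplitzClass) ⟨ρ, rfl⟩

variable {E} in
theorem ext {x y : E.Toeplitz} (h : ∀ (B : Type u) [NonUnitalCStarAlgebra B]
    (ρ : ToeplitzCovRep E B), lift ρ x = lift ρ y) : x = y := by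
  refine FamilyClass.ext_of_lift fun B _ f hf => ?_
  obtain ⟨ρ, rfl⟩ := hf
  exact h B ρ

variable {E} in
theorem norm_le {x : E.Toeplitz} {C : ℝ} (hC : 0 ≤ C) (h : ∀ (B : Type u)
    [NonUnitalCStarAlgebra B] (ρ : ToeplitzCovRep E B), ‖lift ρ x‖ ≤ C) : ‖x‖ ≤ C := by
  refine FamilyClass.norm_le_of_lift hC fun B _ f hf => ?_
  obtain ⟨ρ, rfl⟩ := hf
  exact h B ρ

theorem lift_gen_inl {B : Type u} [NonUnitalCStarAlgebra B] (ρ : ToeplitzCovRep E B) (a : A) :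
    lift ρ (E.toeplitzClass.gen (Sum.inl a)) = ρ.π a := FamilyClass.lift_gen _ _

/-- The canonical homomorphism `i : A → 𝒯(A, α, L)`. -/
def i : A →⋆ₙₐ[ℂ] E.Toeplitz where
  toFun a := E.toeplitzClass.gen (Sum.inl a)
  map_smul' c a := ext fun B _ ρ => by
    rw [map_smul, lift_gen_inl, lift_gen_inl, map_smul]; rfl
  map_zero' := ext fun B _ ρ => by rw [lift_gen_inl, map_zero, map_zero]
  map_add' a b := ext fun B _ ρ => by rw [map_add]; simp only [lift_gen_inl, map_add]
  map_mul' a b := ext fun B _ ρ => by rw [map_mul]; simp only [lift_gen_inl, map_mul]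
  map_star' a := ext fun B _ ρ => by rw [map_star]; simp only [lift_gen_inl, map_star]

/-- The canonical map `a ↦ i(a) S`; see `canonical_πV`. -/
def iS (a : A) : E.Toeplitz := E.toeplitzClass.gen (Sum.inr a)

@[simp] theorem lift_i {B : Type u} [NonUnitalCStarAlgebra B] (ρ : ToeplitzCovRep E B) (a : A) :
    lift ρ (i E a) = ρ.π a := FamilyClass.lift_gen _ _

@[simp] theorem lift_iS {B : Type u} [NonUnitalCStarAlgebra B] (ρ : ToeplitzCovRep E B) (a : A) :
    lift ρ (iS E a) = ρ.πV a := FamilyClass.lift_gen _ _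

theorem i_mul_iS (a b : A) : i E a * iS E b = iS E (a * b) := ext fun B _ ρ => by
  rw [map_mul, lift_i, lift_iS, lift_iS, ρ.π_mul_πV]

theorem star_iS_mul_iS (a b : A) : star (iS E a) * iS E b = i E (E.L (star a * b)) :=
  ext fun B _ ρ => by rw [map_mul, map_star, lift_i, lift_iS, lift_iS, ρ.star_πV_mul_πV]

theorem norm_iS_sub_le (a b : A) : ‖iS E a - iS E b‖ ≤ √‖E.L‖ * ‖a - b‖ :=
  norm_le (by positivity) fun B _ ρ => by
    rw [map_sub, lift_iS, lift_iS, ← map_sub]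
    exact ρ.norm_πV_le' _

/-- Every property of `𝒯(A, α, L)` preserved by the C⋆-algebra operations and limits may be checked
on `i(A)`, `i(A) S` and `S⋆ i(A)`: these generate `𝒯(A, α, L)`. -/
theorem induction {p : E.Toeplitz → Prop} (hclosed : IsClosed {x | p x})
    (hi : ∀ a, p (i E a)) (hS : ∀ a, p (iS E a)) (hS' : ∀ a, p (star (iS E a)))
    (hadd : ∀ x y, p x → p y → p (x + y)) (hzero : p 0) (hmul : ∀ x y, p x → p y → p (x * y))
    (hsmul : ∀ (c : ℂ) x, p x → p (c • x)) (x : E.Toeplitz) : p x := by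
  refine FamilyClass.induction (R := E.toeplitzClass) hclosed ?_ ?_ hadd hzero hmul hsmul x
  · rintro (a | a)
    · exact hi a
    · exact hS a
  · rintro (a | a)
    · have := hi (star a)
      rwa [map_star] at this
    · exact hS' a

theorem i_nondegenerate :
    (Submodule.span ℂ {x : E.Toeplitz | ∃ a b, x = i E a * b}).topologicalClosure = ⊤ := by
  set N := (Submodule.span ℂ {x : E.Toeplitz | ∃ a b, x = i E a * b}).topologicalClosure with hN
  have hNcl : IsClosed (N : Set E.Toeplitz) := Submodule.isClosed_topologicalClosure _
  have hmem : ∀ a b, i E a * b ∈ N := fun a b =>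
    Submodule.le_topologicalClosure _ (Submodule.subset_span ⟨a, b, rfl⟩)
  obtain ⟨l, hl, h1, -, h3⟩ := exists_approx_unit A
  have hc : Continuous (i E) := continuous_hom (i E)
  have hlim : ∀ x : E.Toeplitz, Tendsto (fun e => i E e * x) l (𝓝 x) → x ∈ N := fun x hx =>
    hNcl.mem_of_tendsto hx (Eventually.of_forall fun e => hmem e x)
  have hia : ∀ a, Tendsto (fun e => i E e * i E a) l (𝓝 (i E a)) := fun a => by
    have := (hc.tendsto a).comp (h1 a)
    simpa only [Function.comp_def, map_mul] using this
  rw [eq_top_iff]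
  rintro x -
  refine induction E (p := fun x => x ∈ N) hNcl ?_ ?_ ?_ (fun x y => N.add_mem) N.zero_mem ?_
    (fun c x => N.smul_mem c) x
  · exact fun a => hlim _ (hia a)
  · refine fun a => hlim _ ?_
    rw [tendsto_iff_norm_sub_tendsto_zero]
    have h4 := ((tendsto_iff_norm_sub_tendsto_zero.1 (h1 a)).const_mul √‖E.L‖)
    rw [mul_zero] at h4
    refine squeeze_zero (fun _ => norm_nonneg _) (fun e => ?_) h4
    rw [i_mul_iS]
    exact norm_iS_sub_le E _ _
  · refine fun a => hlim _ ?_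
    rw [tendsto_iff_norm_sub_tendsto_zero]
    set c := i E (E.L (star a * a)) with hcdef
    have h4 : Tendsto (fun e => √(2 * ‖i E e * c - c‖)) l (𝓝 0) := by
      have h5 := ((tendsto_iff_norm_sub_tendsto_zero.1 (hia (E.L (star a * a)))).const_mul 2).sqrt
      simpa only [mul_zero, Real.sqrt_zero] using h5
    refine squeeze_zero' (Eventually.of_forall fun _ => norm_nonneg _) ?_ h4
    filter_upwards [h3] with e he
    refine Real.le_sqrt_of_sq_le ?_
    rw [pow_two, ← CStarRing.norm_self_mul_star]
    have h6 : (i E e * star (iS E a) - star (iS E a)) *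
        star (i E e * star (iS E a) - star (iS E a)) =
        (i E e * c - c) * star (i E e) - (i E e * c - c) := by
      rw [hcdef, ← star_iS_mul_iS, star_sub, star_mul, star_star]
      noncomm_ring
    rw [h6]
    have h7 : ‖star (i E e)‖ ≤ 1 := by
      rw [norm_star]
      exact (NonUnitalStarAlgHom.norm_apply_le (i E) e).trans he.1
    calc _ ≤ ‖(i E e * c - c) * star (i E e)‖ + ‖i E e * c - c‖ := norm_sub_le _ _
      _ ≤ ‖i E e * c - c‖ * 1 + ‖i E e * c - c‖ := by
          gcongr
          exact (norm_mul_le _ _).trans (by gcongr)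
      _ = _ := by ring
  · intro x y hx _
    have hcont : Continuous fun z : E.Toeplitz => z * y := by fun_prop
    refine closure_minimal (t := {z : E.Toeplitz | z * y ∈ N}) (fun z hz => ?_)
      (hNcl.preimage hcont) hx
    induction hz using Submodule.span_induction with
    | mem z hz =>
      obtain ⟨a, b, rfl⟩ := hz
      change i E a * b * y ∈ N
      rw [mul_assoc]
      exact hmem _ _
    | zero => change (0 : E.Toeplitz) * y ∈ N; rw [zero_mul]; exact N.zero_mem
    | add z w _ _ hz hw => change (z + w) * y ∈ N; rw [add_mul]; exact N.add_mem hz hw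
    | smul c z _ hz => change c • z * y ∈ N; rw [smul_mul_assoc]; exact N.smul_mem c hz

/-- A bounded family of multipliers, one for each Toeplitz-covariant representation, which maps
`i(A) 𝒯(A, α, L)` to `𝒯(A, α, L)`, maps `𝒯(A, α, L)` to itself. -/
theorem exists_fst
    (W : ∀ (B : Type u) [NonUnitalCStarAlgebra B], ToeplitzCovRep E B → (B →L[ℂ] B)) (C : ℝ)
    (hC : 0 ≤ C)
    (hW : ∀ (B : Type u) [NonUnitalCStarAlgebra B] (ρ : ToeplitzCovRep E B) (b : B),
      ‖W B ρ b‖ ≤ C * ‖b‖)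
    (h : ∀ (a : A) (z : E.Toeplitz), ∃ y : E.Toeplitz, ∀ (B : Type u) [NonUnitalCStarAlgebra B]
      (ρ : ToeplitzCovRep E B), lift ρ y = W B ρ (lift ρ (i E a * z)))
    (x : E.Toeplitz) : ∃ y : E.Toeplitz, ∀ (B : Type u) [NonUnitalCStarAlgebra B]
      (ρ : ToeplitzCovRep E B), lift ρ y = W B ρ (lift ρ x) := by
  have hspan : ∀ x ∈ Submodule.span ℂ {x : E.Toeplitz | ∃ a b, x = i E a * b},
      ∃ y : E.Toeplitz, ∀ (B : Type u) [NonUnitalCStarAlgebra B]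
        (ρ : ToeplitzCovRep E B), lift ρ y = W B ρ (lift ρ x) := by
    intro x hx
    induction hx using Submodule.span_induction with
    | mem x hx => obtain ⟨a, b, rfl⟩ := hx; exact h a b
    | zero => exact ⟨0, fun B _ ρ => by rw [map_zero, map_zero]⟩
    | add x y _ _ hx hy =>
      obtain ⟨x', hx'⟩ := hx
      obtain ⟨y', hy'⟩ := hy
      exact ⟨x' + y', fun B _ ρ => by rw [map_add, hx', hy', ← map_add, ← map_add]⟩
    | smul c x _ hx =>
      obtain ⟨x', hx'⟩ := hx
      exact ⟨c • x', fun B _ ρ => by rw [map_smul, hx', ← map_smul, ← map_smul]⟩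
  have hx : x ∈ (Submodule.span ℂ {x : E.Toeplitz | ∃ a b, x = i E a * b}).topologicalClosure := by
    rw [i_nondegenerate]; trivial
  obtain ⟨s, hs, hsx⟩ := mem_closure_iff_seq_limit.1 hx
  choose y hy using fun n => hspan (s n) (hs n)
  have hle : ∀ m n, ‖y m - y n‖ ≤ C * ‖s m - s n‖ := fun m n =>
    norm_le (by positivity) fun B _ ρ => by
      rw [map_sub, hy, hy, ← map_sub, ← map_sub]
      refine (hW B ρ _).trans ?_
      gcongr
      exact NonUnitalStarAlgHom.norm_apply_le (lift ρ) _
  have hcauchy : CauchySeq y := by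
    have h0 := hsx.cauchySeq
    rw [Metric.cauchySeq_iff] at h0 ⊢
    intro ε hε
    obtain ⟨n, hn⟩ := h0 (ε / (C + 1)) (by positivity)
    refine ⟨n, fun k hk m hm => ?_⟩
    have h1 := hn k hk m hm
    rw [dist_eq_norm] at h1 ⊢
    rw [lt_div_iff₀ (by positivity)] at h1
    nlinarith [hle k m, norm_nonneg (s k - s m)]
  obtain ⟨z, hz⟩ := cauchySeq_tendsto_of_complete hcauchy
  refine ⟨z, fun B _ ρ => ?_⟩
  have hcl : Continuous (lift ρ) := continuous_hom (lift ρ)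
  refine tendsto_nhds_unique ((hcl.tendsto z).comp hz) ?_
  refine ((((W B ρ).continuous.comp hcl).tendsto x).comp hsx).congr fun n => ?_
  exact (hy n B ρ).symm

theorem exists_S (x : E.Toeplitz) : ∃ y : E.Toeplitz, ∀ (B : Type u) [NonUnitalCStarAlgebra B]
    (ρ : ToeplitzCovRep E B), lift ρ y = ρ.V.fst (lift ρ x) := by
  refine exists_fst E (fun B _ ρ => ρ.V.fst) √‖E.L‖ (Real.sqrt_nonneg _) (fun B _ ρ b => ?_)
    (fun a z => ⟨iS E (E.α a) * z, fun B _ ρ => ?_⟩) x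
  · refine (ρ.V.fst.le_opNorm b).trans ?_
    rw [DoubleCentralizer.norm_fst]
    gcongr
    exact ρ.norm_V_le
  · rw [map_mul, map_mul, lift_i, lift_iS, ρ.fst_π_mul]

theorem exists_star_S (x : E.Toeplitz) : ∃ y : E.Toeplitz, ∀ (B : Type u)
    [NonUnitalCStarAlgebra B] (ρ : ToeplitzCovRep E B),
    lift ρ y = (star ρ.V).fst (lift ρ x) := by
  refine exists_fst E (fun B _ ρ => (star ρ.V).fst) √‖E.L‖ (Real.sqrt_nonneg _)
    (fun B _ ρ b => ?_) (fun a z => ⟨star (iS E (star a)) * z, fun B _ ρ => ?_⟩) x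
  · refine ((star ρ.V).fst.le_opNorm b).trans ?_
    rw [DoubleCentralizer.norm_fst, norm_star]
    gcongr
    exact ρ.norm_V_le
  · rw [map_mul, map_mul, lift_i, map_star, lift_iS, ρ.star_fst_π_mul]

theorem exists_S_right (x : E.Toeplitz) : ∃ y : E.Toeplitz, ∀ (B : Type u)
    [NonUnitalCStarAlgebra B] (ρ : ToeplitzCovRep E B), lift ρ y = ρ.V.snd (lift ρ x) := by
  obtain ⟨y, hy⟩ := exists_star_S E (star x)
  refine ⟨star y, fun B _ ρ => ?_⟩
  rw [map_star (lift ρ), hy, DoubleCentralizer.star_fst, map_star (lift ρ), star_star, star_star]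

theorem fst_spec (x : E.Toeplitz) (B : Type u) [NonUnitalCStarAlgebra B]
    (ρ : ToeplitzCovRep E B) : lift ρ (exists_S E x).choose = ρ.V.fst (lift ρ x) :=
  (exists_S E x).choose_spec B ρ

theorem snd_spec (x : E.Toeplitz) (B : Type u) [NonUnitalCStarAlgebra B]
    (ρ : ToeplitzCovRep E B) : lift ρ (exists_S_right E x).choose = ρ.V.snd (lift ρ x) :=
  (exists_S_right E x).choose_spec B ρ

/-- The canonical multiplier `S` of `𝒯(A, α, L)`. It is determined by
`(π × V)(S x) = V (π × V)(x)` and `(π × V)(x S) = (π × V)(x) V` for all `x ∈ 𝒯(A, α, L)` and all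
Toeplitz-covariant representations `(π, V)`. -/
def S : 𝓜(ℂ, E.Toeplitz) where
  fst := LinearMap.mkContinuous
    { toFun := fun x => (exists_S E x).choose
      map_add' := fun x y => ext fun B _ ρ => by
        rw [map_add (lift ρ), fst_spec, fst_spec, fst_spec, map_add, map_add]
      map_smul' := fun c x => ext fun B _ ρ => by
        rw [map_smul (lift ρ), fst_spec, fst_spec, map_smul, map_smul]; rfl } √‖E.L‖ fun x => by
    refine norm_le (by positivity) fun B _ ρ => ?_
    rw [LinearMap.coe_mk, AddHom.coe_mk, fst_spec]
    refine (ρ.V.fst.le_opNorm _).trans ?_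
    rw [DoubleCentralizer.norm_fst]
    gcongr
    · exact ρ.norm_V_le
    · exact NonUnitalStarAlgHom.norm_apply_le (lift ρ) _
  snd := LinearMap.mkContinuous
    { toFun := fun x => (exists_S_right E x).choose
      map_add' := fun x y => ext fun B _ ρ => by
        rw [map_add (lift ρ), snd_spec, snd_spec, snd_spec, map_add, map_add]
      map_smul' := fun c x => ext fun B _ ρ => by
        rw [map_smul (lift ρ), snd_spec, snd_spec, map_smul, map_smul]; rfl } √‖E.L‖ fun x => by
    refine norm_le (by positivity) fun B _ ρ => ?_
    rw [LinearMap.coe_mk, AddHom.coe_mk, snd_spec]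
    refine (ρ.V.snd.le_opNorm _).trans ?_
    rw [DoubleCentralizer.norm_snd]
    gcongr
    · exact ρ.norm_V_le
    · exact NonUnitalStarAlgHom.norm_apply_le (lift ρ) _
  central x y := ext fun B _ ρ => by
    rw [map_mul, map_mul]
    exact (congrArg (· * _) (snd_spec E x B ρ)).trans
      ((ρ.V.central _ _).trans (congrArg (_ * ·) (fst_spec E y B ρ).symm))

@[simp] theorem lift_S_fst {B : Type u} [NonUnitalCStarAlgebra B] (ρ : ToeplitzCovRep E B)
    (x : E.Toeplitz) : lift ρ ((S E).fst x) = ρ.V.fst (lift ρ x) := fst_spec E x B ρ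

@[simp] theorem lift_S_snd {B : Type u} [NonUnitalCStarAlgebra B] (ρ : ToeplitzCovRep E B)
    (x : E.Toeplitz) : lift ρ ((S E).snd x) = ρ.V.snd (lift ρ x) := snd_spec E x B ρ

/-- The canonical Toeplitz-covariant representation `(i, S)` in `𝒯(A, α, L)`. -/
def canonical : ToeplitzCovRep E E.Toeplitz where
  π := i E
  nondegenerate := i_nondegenerate E
  V := S E
  tc1 a := multiplier_ext fun x => ext fun B _ ρ => by
    change lift ρ ((S E).fst (i E a * x)) = lift ρ (i E (E.α a) * (S E).fst x)
    rw [lift_S_fst, map_mul (lift ρ), map_mul (lift ρ), lift_i, lift_i, lift_S_fst, ρ.fst_π_mul, ρ.π_mul_fst]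
  tc2 a := multiplier_ext fun x => ext fun B _ ρ => by
    have h := congrArg (fun m : 𝓜(ℂ, B) => m.fst (lift ρ x)) (ρ.tc2 a)
    change star (ρ.V.snd (star (ρ.π a * ρ.V.fst (lift ρ x)))) = ρ.π (E.L a) * lift ρ x at h
    change lift ρ (star ((S E).snd (star (i E a * (S E).fst x)))) = lift ρ (i E (E.L a) * x)
    rw [map_star, lift_S_snd, map_star, map_mul, lift_i, lift_S_fst, map_mul, lift_i, h]

theorem canonical_πV (a : A) : (canonical E).πV a = iS E a := ext fun B _ ρ => by
  rw [lift_iS]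
  exact (lift_S_snd E ρ _).trans (congrArg _ (lift_i E ρ a))

/-- The canonical map `ψ_S : M_L → 𝒯(A, α, L)`, with `ψ_S(q(a)) = i(a) S`. -/
def psiS : E.ML →L[ℂ] E.Toeplitz := (canonical E).psi

end Toeplitz

/-! ### The crossed product -/

open Toeplitz in
/-- `(i(a), k)` is a *redundancy* if `k` belongs to the closed linear span of `i(A) S S⋆ i(A)` and
`i(a) i(b) S = k i(b) S` for all `b ∈ A`. Here `(S E).snd (i E b) = i(b) S` and
`(star (S E)).fst (i E c) = S⋆ i(c)`. -/
def IsRedundancy (a : A) (k : E.Toeplitz) : Prop :=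
  k ∈ (Submodule.span ℂ {x : E.Toeplitz | ∃ b c, x =
    (S E).snd (i E b) * (star (S E)).fst (i E c)}).topologicalClosure ∧
  ∀ b, i E a * (S E).snd (i E b) = k * (S E).snd (i E b)

/-- The ideal `I(A, α, L)` of `𝒯(A, α, L)` generated by the elements `i(a) - k` such that
`(i(a), k)` is a redundancy and `a` belongs to the closed linear span of `A α(A) A`. -/
def redundancyIdeal : ClosedIdeal E.Toeplitz :=
  ClosedIdeal.generatedBy
    {x | ∃ a ∈ E.AαA, ∃ k, E.IsRedundancy a k ∧ x = Toeplitz.i E a - k}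

/-- Exel's *crossed product* `A ⋊_{α,L} ℕ = 𝒯(A, α, L) ⧸ I(A, α, L)`. -/
abbrev CrossedProduct : Type u := E.redundancyIdeal.Quot

/-- The quotient map `Q : 𝒯(A, α, L) → A ⋊_{α,L} ℕ`. -/
def Q : E.Toeplitz →⋆ₙₐ[ℂ] E.CrossedProduct := E.redundancyIdeal.proj

/-- The Toeplitz-covariant representation `(Q ∘ i, Q̄(S))` of `(A, α, L)` in `A ⋊_{α,L} ℕ`. -/
def crossedProductRep : ToeplitzCovRep E E.CrossedProduct :=
  (Toeplitz.canonical E).quot E.redundancyIdeal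

/-- The map `ψ_{Q̄(S)} : M_L → A ⋊_{α,L} ℕ`, with `ψ_{Q̄(S)}(q(a)) = Q(i(a)) Q̄(S)`. -/
def psiQS : E.ML →L[ℂ] E.CrossedProduct := E.crossedProductRep.psi

end ExelSystem

end ExelCP

end

noncomputable section

open Filter Topology
open scoped MultiplierAlgebra

namespace ExelCP

/-! ### Strong limits of bounded nets of operators, and the multipliers they define -/

section Limits

variable {ι X Y : Type*} [NormedAddCommGroup X] [NormedSpace ℂ X] [NormedAddCommGroup Y]
  [NormedSpace ℂ Y] {l : Filter ι} {T : ι → X →ₗ[ℂ] Y} {C : ℝ}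

/-! Both algebras are universal for Toeplitz representations of `M_L` subject to one extra relation,
and the proof matches the two universal problems.

A Toeplitz-covariant representation (π, V) gives the Toeplitz representation (ψ_V, π) with ψ_V(q(a))
= π(a)V. Conversely, when π is nondegenerate, V is recovered from ψ as the strict limit of ψ(q(e))
along an approximate unit e of A (`exists_toeplitzCovRep`). This applies to 𝒪(K, M_L), because an
approximate unit of A acts as one on M_L from both sides, so that k_A is nondegenerate
(`tendsto_kA_mul`).

The extra relations agree by `isRedundancy_iff`. For a redundancy (i(a), k), the element k lies in
the closed span of ψ_S(M_L)ψ_S(M_L)⋆ and acts on ψ_S(M_L) as φ(a) does. If i is injective, then ψ_S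
is isometric, so approximating k by finite sums of ψ_S(x)ψ_S(y)⋆ also approximates φ(a) in operator
norm by finite-rank operators (`exists_onCompacts_eq`). Hence φ(a) is compact and k = (ψ_S,
i)⁽¹⁾(φ(a)). Dividing by the elements i(a) - k with a in the closure of Aα(A)A therefore imposes
exactly coisometricity on K_α.

Injectivity of i (`i_injective`) is the analytic input. For a ≠ 0, separation of convex sets gives a
positive functional ω with ω(a⋆a) ≠ 0, and A and M_L are represented on the Fock space ⊕ₙ M_L^{⊗n}
⊗_A H_ω by left multiplication and creation operators. The tensor powers need not be formed: since
L(b⋆ L(a⋆c) d) = L²((aα(b))⋆ cα(d)), the tensor q(a) ⊗ q(b) is represented by aα(b), and layer n can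
be replaced by A itself with the form ω(Lⁿ(x⋆y)). The creation operator of q(a) then sends x in
layer n to aα(x) in layer n + 1.

The universal properties now give homomorphisms in both directions, and these are mutually inverse
because they are so on generators. -/

theorem isClosed_setOf_tendsto_zero (hT : ∀ᶠ i in l, ∀ x, ‖T i x‖ ≤ C * ‖x‖) :
    IsClosed {x | Tendsto (fun i => T i x) l (𝓝 0)} := by
  refine isClosed_of_closure_subset fun x hx => ?_
  rw [Set.mem_ofPred_eq, Metric.tendsto_nhds]
  intro ε hε
  -- Half of ε is spent on `T i (x - y)` and half on `T i y`. No sign of `C` is known, and dividing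
  -- by `|C| + 1` avoids the question.
  obtain ⟨y, hy, hxy⟩ := Metric.mem_closure_iff.1 hx (ε / 2 / (|C| + 1)) (by positivity)
  filter_upwards [hT, Metric.tendsto_nhds.1 hy (ε / 2) (half_pos hε)] with i hi hiy
  rw [dist_zero_right] at hiy ⊢
  rw [dist_eq_norm, lt_div_iff₀ (by positivity)] at hxy
  have h1 : ‖T i x‖ ≤ ‖T i (x - y)‖ + ‖T i y‖ := by
    have : T i x = T i (x - y) + T i y := by rw [← map_add, sub_add_cancel]
    rw [this]
    exact norm_add_le _ _
  have h2 := hi (x - y)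
  nlinarith [norm_nonneg (x - y), le_abs_self C]

theorem isClosed_setOf_tendsto_id {T : ι → X →ₗ[ℂ] X} (hT : ∀ᶠ i in l, ∀ x, ‖T i x‖ ≤ C * ‖x‖) :
    IsClosed {x | Tendsto (fun i => T i x) l (𝓝 x)} := by
  have h : ∀ᶠ i in l, ∀ x, ‖(T i - LinearMap.id : X →ₗ[ℂ] X) x‖ ≤ (C + 1) * ‖x‖ := by
    filter_upwards [hT] with i hi x
    rw [LinearMap.sub_apply, LinearMap.id_apply, add_mul, one_mul]
    exact (norm_sub_le _ _).trans (add_le_add_left (hi x) _)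
  convert isClosed_setOf_tendsto_zero h using 3 with x
  rw [tendsto_sub_nhds_zero_iff.symm]
  rfl

/-- By completeness, convergence of `T i x` is the Cauchy condition, that is, `(T i - T j) x` tends
to zero along the product filter. The differences are again eventually bounded, now by `C + C`, so
the set is a null set of the kind already known to be closed. -/
theorem isClosed_setOf_exists_tendsto [CompleteSpace Y] [l.NeBot]
    (hT : ∀ᶠ i in l, ∀ x, ‖T i x‖ ≤ C * ‖x‖) :
    IsClosed {x | ∃ y, Tendsto (fun i => T i x) l (𝓝 y)} := by
  have key : ∀ x, (∃ y, Tendsto (fun i => T i x) l (𝓝 y)) ↔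
      Tendsto (fun p : ι × ι => (T p.1 - T p.2) x) (l ×ˢ l) (𝓝 0) := fun x => by
    rw [← cauchy_map_iff_exists_tendsto, cauchy_map_iff, and_iff_right (inferInstance : l.NeBot),
      tendsto_uniformity_iff_dist_tendsto_zero]
    simp only [dist_eq_norm, LinearMap.sub_apply]
    exact tendsto_zero_iff_norm_tendsto_zero.symm
  simp only [key]
  refine isClosed_setOf_tendsto_zero (T := fun p : ι × ι => T p.1 - T p.2) (C := C + C) ?_
  filter_upwards [hT.prod_mk hT] with p hp x
  rw [LinearMap.sub_apply, add_mul]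
  exact (norm_sub_le _ _).trans (add_le_add (hp.1 x) (hp.2 x))

end Limits

/-- A bounded net which converges strictly defines a multiplier. -/
theorem exists_multiplier_of_tendsto {ι : Type*} {B : Type u} [NonUnitalCStarAlgebra B]
    {l : Filter ι} [l.NeBot] {w : ι → B} {C : ℝ} (hw : ∀ᶠ i in l, ‖w i‖ ≤ C)
    (h1 : ∀ b, ∃ y, Tendsto (fun i => w i * b) l (𝓝 y))
    (h2 : ∀ b, ∃ y, Tendsto (fun i => b * w i) l (𝓝 y)) :
    ∃ V : 𝓜(ℂ, B), (∀ b, Tendsto (fun i => w i * b) l (𝓝 (V.fst b))) ∧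
      ∀ b, Tendsto (fun i => b * w i) l (𝓝 (V.snd b)) := by
  choose f hf using h1
  choose g hg using h2
  refine ⟨⟨⟨LinearMap.mkContinuous ⟨⟨f, fun x y => ?_⟩, fun c x => ?_⟩ C fun b => ?_,
    LinearMap.mkContinuous ⟨⟨g, fun x y => ?_⟩, fun c x => ?_⟩ C fun b => ?_⟩, fun x y => ?_⟩,
    hf, hg⟩
  · refine tendsto_nhds_unique (hf _) (((hf x).add (hf y)).congr fun i => ?_)
    rw [mul_add]
  · refine tendsto_nhds_unique (hf _) (((hf x).const_smul c).congr fun i => ?_)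
    rw [mul_smul_comm]
  · refine le_of_tendsto (hf b).norm ?_
    filter_upwards [hw] with i hi
    exact (norm_mul_le _ _).trans (by gcongr)
  · refine tendsto_nhds_unique (hg _) (((hg x).add (hg y)).congr fun i => ?_)
    rw [add_mul]
  · refine tendsto_nhds_unique (hg _) (((hg x).const_smul c).congr fun i => ?_)
    rw [smul_mul_assoc]
  · refine le_of_tendsto (hg b).norm ?_
    filter_upwards [hw] with i hi
    rw [mul_comm C]
    exact (norm_mul_le _ _).trans (by gcongr)
  -- The centrality condition is the limit of `(x w) y = x (w y)`.
  · change g x * y = x * f y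
    refine tendsto_nhds_unique ((hg x).mul_const y) (((hf y).const_mul x).congr fun i => ?_)
    rw [mul_assoc]

/-! ### Approximate units and nondegenerate homomorphisms -/

/-- A filter along which the positive contractions of `A` form an approximate unit. -/
structure IsApproxUnit {A : Type u} [NonUnitalCStarAlgebra A] (l : Filter A) : Prop where
  neBot : l.NeBot
  left : ∀ x : A, Tendsto (fun e => e * x) l (𝓝 x)
  right : ∀ x : A, Tendsto (fun e => x * e) l (𝓝 x)
  norm_le : ∀ᶠ e in l, ‖e‖ ≤ 1
  star_eq : ∀ᶠ e in l, star e = e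

theorem exists_isApproxUnit (A : Type u) [NonUnitalCStarAlgebra A] :
    ∃ l : Filter A, IsApproxUnit l := by
  obtain ⟨l, h1, h2, h3, h4⟩ := exists_approx_unit A
  refine ⟨l, h1, h2, h3, h4.mono fun e he => he.1, h4.mono fun e he => ?_⟩
  obtain ⟨-, c, rfl⟩ := he
  rw [star_mul, star_star]

section Nondegenerate

variable {A : Type u} [NonUnitalCStarAlgebra A] {B : Type v} [NonUnitalCStarAlgebra B]
  (π : A →⋆ₙₐ[ℂ] B) {l : Filter A}

theorem IsApproxUnit.norm_map_le (hl : IsApproxUnit l) : ∀ᶠ e in l, ‖π e‖ ≤ 1 := by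
  filter_upwards [hl.norm_le] with e he
  exact (NonUnitalStarAlgHom.norm_apply_le π e).trans he

/-- Left multiplications by `π e` are eventually contractions. Nondegeneracy can thus be tested on a
dense set of vectors. -/
theorem IsApproxUnit.isClosed_left (hl : IsApproxUnit l) :
    IsClosed {b : B | Tendsto (fun e => π e * b) l (𝓝 b)} := by
  refine isClosed_setOf_tendsto_id (T := fun e => LinearMap.mulLeft ℂ (π e)) (C := 1) ?_
  filter_upwards [hl.norm_map_le π] with e he b
  exact (norm_mul_le _ _).trans (by gcongr)

/-- Along an approximate unit `e`, `π(e) b → b` if and only if `b⋆ π(e) → b⋆`. -/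
theorem IsApproxUnit.tendsto_star (hl : IsApproxUnit l) {b : B}
    (h : Tendsto (fun e => b * π e) l (𝓝 b)) :
    Tendsto (fun e => π e * star b) l (𝓝 (star b)) := by
  refine h.star.congr' ?_
  filter_upwards [hl.star_eq] with e he
  rw [star_mul, ← map_star, he]

theorem IsApproxUnit.tendsto_star' (hl : IsApproxUnit l) {b : B}
    (h : Tendsto (fun e => π e * b) l (𝓝 b)) :
    Tendsto (fun e => star b * π e) l (𝓝 (star b)) := by
  refine h.star.congr' ?_
  filter_upwards [hl.star_eq] with e he
  rw [star_mul, ← map_star, he]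

theorem nondegenerate_of_tendsto (hl : IsApproxUnit l)
    (h : ∀ b, Tendsto (fun e => π e * b) l (𝓝 b)) :
    (Submodule.span ℂ {x : B | ∃ a b, x = π a * b}).topologicalClosure = ⊤ := by
  have := hl.neBot
  refine eq_top_iff.2 fun b _ => mem_closure_of_tendsto (h b) (Eventually.of_forall fun e => ?_)
  exact Submodule.subset_span ⟨e, b, rfl⟩

end Nondegenerate

/-! ### Approximate units of `A` acting on `M_L` and on relative Cuntz–Pimsner algebras -/

open HilbertBimodule

theorem ToeplitzRep.ext' {A : Type u} {M : Type v} [NonUnitalCStarAlgebra A]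
    [NormedAddCommGroup M] [NormedSpace ℂ M] [HilbertBimodule A M] {B : Type w}
    [NonUnitalCStarAlgebra B] {ρ σ : ToeplitzRep A M B} (hψ : ∀ x, ρ.ψ x = σ.ψ x)
    (hπ : ∀ a, ρ.π a = σ.π a) : ρ = σ := by
  cases ρ
  cases σ
  obtain rfl := LinearMap.ext hψ
  obtain rfl := NonUnitalStarAlgHom.ext hπ
  rfl

theorem ToeplitzRep.continuous_ψ {A : Type u} {M : Type v} [NonUnitalCStarAlgebra A]
    [NormedAddCommGroup M] [NormedSpace ℂ M] [HilbertBimodule A M] {B : Type w}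
    [NonUnitalCStarAlgebra B] (ρ : ToeplitzRep A M B) : Continuous ρ.ψ :=
  AddMonoidHomClass.continuous_of_bound ρ.ψ 1 fun x => by
    rw [one_mul]; exact ρ.norm_ψ_le x

namespace ExelSystem

variable {A : Type u} [NonUnitalCStarAlgebra A] (E : ExelSystem A)

/-- Since ‖q(a)‖² = ‖L(a⋆a)‖, boundedness of `L` suffices. The explicit constant later bounds the
net ψ(q(e)) whose strict limit is V. -/
theorem norm_q_le (a : A) : ‖E.q a‖ ≤ √‖E.L‖ * ‖a‖ := by
  refine (pow_le_pow_iff_left₀ (norm_nonneg _) (by positivity) two_ne_zero).1 ?_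
  rw [norm_q_sq, mul_pow, Real.sq_sqrt (norm_nonneg _), pow_two, ← CStarRing.norm_star_mul_self]
  exact E.L.le_opNorm _

theorem continuous_q : Continuous E.q :=
  AddMonoidHomClass.continuous_of_bound E.q _ E.norm_q_le

end ExelSystem

namespace IsApproxUnit

variable {A : Type u} [NonUnitalCStarAlgebra A] {E : ExelSystem A} {B : Type v}
  [NonUnitalCStarAlgebra B] {l : Filter A}

/-- On q(m) the right action is q(mα(e)), but α(e) need not be an approximate unit of `A`. The
convergence comes from the inner product instead: with p = ⟨x, x⟩ and e self-adjoint, ⟨xe - x, xe -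
x⟩ = e(pe - p) - (pe - p), whose norm is at most 2‖pe - p‖ for a contraction e. -/
theorem tendsto_rsmul (hl : IsApproxUnit l) (x : E.ML) : Tendsto (fun e => rsmul x e) l (𝓝 x) := by
  have key : ∀ᶠ e in l, ‖rsmul x e - x‖ ^ 2 ≤
      2 * ‖(ip x x : A) * e - ip x x‖ := by
    filter_upwards [hl.norm_le, hl.star_eq] with e he hes
    have h1 : (ip (rsmul x e - x) (rsmul x e - x) : A) =
        e * ((ip x x : A) * e - ip x x) - ((ip x x : A) * e - ip x x) := by
      simp only [ip_sub_left, ip_sub_right, ip_rsmul, ip_rsmul_left, hes]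
      noncomm_ring
    rw [norm_sq (A := A), h1, two_mul]
    refine (norm_sub_le _ _).trans (add_le_add_left ((norm_mul_le _ _).trans ?_) _)
    exact mul_le_of_le_one_left (norm_nonneg _) he
  rw [tendsto_iff_norm_sub_tendsto_zero]
  have h2 : Tendsto (fun e => √(2 * ‖(ip x x : A) * e - ip x x‖)) l (𝓝 0) := by
    have := ((tendsto_iff_norm_sub_tendsto_zero.1 (hl.right (ip x x : A))).const_mul 2).sqrt
    simpa using this
  refine squeeze_zero' (Eventually.of_forall fun _ => norm_nonneg _) ?_ h2
  filter_upwards [key] with e he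
  exact Real.le_sqrt_of_sq_le he

/-- On q(m) the claim is q(em) → q(m), by continuity of `q`. It passes to the completion because the
operators φ(e) are eventually contractions. -/
theorem tendsto_φ (hl : IsApproxUnit l) (x : E.ML) : Tendsto (fun e => (φ e : E.ML →L[ℂ] E.ML) x) l (𝓝 x) := by
  have hcl : IsClosed {x : E.ML | Tendsto (fun e => (φ e : E.ML →L[ℂ] E.ML) x) l (𝓝 x)} := by
    refine isClosed_setOf_tendsto_id
      (T := fun e => ((φ e : E.ML →L[ℂ] E.ML) : E.ML →ₗ[ℂ] E.ML)) (C := 1) ?_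
    -- Contractivity is tested on the dense range of `q`, where it is the estimate ‖L((em)⋆(em))‖ ≤
    -- ‖e‖² ‖L(m⋆m)‖.
    filter_upwards [hl.norm_le] with e he x
    refine E.denseRange_q.induction_on (p := fun x => ‖(φ e : E.ML →L[ℂ] E.ML) x‖ ≤ 1 * ‖x‖) x
      (isClosed_le (by fun_prop) (by fun_prop)) fun m => ?_
    rw [E.φ_q, one_mul]
    refine (pow_le_pow_iff_left₀ (norm_nonneg _) (norm_nonneg _) two_ne_zero).1 ?_
    rw [E.norm_q_sq, E.norm_q_sq]
    exact (E.norm_L_conj_le e m).trans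
      (mul_le_of_le_one_left (norm_nonneg _) (pow_le_one₀ (norm_nonneg _) he))
  refine E.denseRange_q.induction_on
    (p := fun x => Tendsto (fun e => (φ e : E.ML →L[ℂ] E.ML) x) l (𝓝 x)) x hcl fun m => ?_
  simp only [E.φ_q]
  exact (E.continuous_q.tendsto m).comp (hl.left m)

theorem tendsto_mul_ψ (hl : IsApproxUnit l) (ρ : ToeplitzRep A E.ML B) (x : E.ML) :
    Tendsto (fun e => ρ.π e * ρ.ψ x) l (𝓝 (ρ.ψ x)) := by
  simpa only [Function.comp_def, ρ.map_lsmul] using (ρ.continuous_ψ.tendsto x).comp (hl.tendsto_φ x)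

theorem tendsto_ψ_mul (hl : IsApproxUnit l) (ρ : ToeplitzRep A E.ML B) (x : E.ML) :
    Tendsto (fun e => ρ.ψ x * ρ.π e) l (𝓝 (ρ.ψ x)) := by
  simpa only [Function.comp_def, ρ.map_rsmul] using (ρ.continuous_ψ.tendsto x).comp (hl.tendsto_rsmul x)

/-- This is the nondegeneracy of k_A. The elements b with k_A(e)b → b form a closed subspace stable
under right multiplication, so only generators matter. For k_M(x) the left action on M_L is used.
For k_M(x)⋆ one takes adjoints, and the right action enters through xe → x. -/
theorem tendsto_kA_mul (hl : IsApproxUnit l) {K : Submodule ℂ A} (hK : K ≤ J A E.ML) (b : RelCP hK) :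
    Tendsto (fun e => RelCP.kA hK e * b) l (𝓝 b) := by
  refine RelCP.induction hK
    (p := fun b => Tendsto (fun e => RelCP.kA hK e * b) l (𝓝 b)) (hl.isClosed_left _)
    (fun a => ?_) (hl.tendsto_mul_ψ (RelCP.rep hK))
    (fun x => hl.tendsto_star _ (hl.tendsto_ψ_mul (RelCP.rep hK) x)) (fun x y hx hy => ?_) ?_
    (fun x y hx _ => ?_) (fun c x hx => ?_) b
  · simpa only [Function.comp_def, map_mul] using
      ((continuous_hom (RelCP.kA hK)).tendsto a).comp (hl.left a)
  · simpa only [mul_add] using hx.add hy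
  · simpa only [mul_zero] using tendsto_const_nhds
  · simpa only [mul_assoc] using hx.mul_const y
  · simpa only [mul_smul_comm] using hx.const_smul c

end IsApproxUnit

/-! ### Recovering the multiplier `V` from a nondegenerate Toeplitz representation -/

namespace ToeplitzRep

variable {A : Type u} [NonUnitalCStarAlgebra A] {E : ExelSystem A} {B : Type u}
  [NonUnitalCStarAlgebra B]

/-- A nondegenerate Toeplitz representation `(ψ, π)` of `M_L` comes from a Toeplitz-covariant
representation `(π, V)`, where `V` is the strict limit of `ψ(q(e))` along an approximate unit. -/
theorem exists_toeplitzCovRep {l : Filter A} (hl : IsApproxUnit l) (ρ : ToeplitzRep A E.ML B)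
    (hρ : ∀ b, Tendsto (fun e => ρ.π e * b) l (𝓝 b)) :
    ∃ σ : ToeplitzCovRep E B, σ.π = ρ.π ∧ ∀ a, σ.πV a = ρ.ψ (E.q a) := by
  have := hl.neBot
  have hc : Continuous fun a => ρ.ψ (E.q a) := ρ.continuous_ψ.comp E.continuous_q
  have hπψ : ∀ a b, ρ.π a * ρ.ψ (E.q b) = ρ.ψ (E.q (a * b)) := fun a b => by
    rw [← ρ.map_lsmul, E.φ_q]
  have hψπ : ∀ a b, ρ.ψ (E.q a) * ρ.π b = ρ.ψ (E.q (a * E.α b)) := fun a b => by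
    rw [← ρ.map_rsmul, E.rsmul_q]
  have hbound : ∀ᶠ e in l, ‖ρ.ψ (E.q e)‖ ≤ √‖E.L‖ := by
    filter_upwards [hl.norm_le] with e he
    exact (ρ.norm_ψ_le _).trans ((E.norm_q_le e).trans
      (mul_le_of_le_one_right (Real.sqrt_nonneg _) he))
  -- On vectors π(a)b the limit is explicit: ψ(q(e))π(a)b = ψ(q(eα(a)))b, and eα(a) → α(a). The
  -- right-hand version uses π(a)ψ(q(e)) = ψ(q(ae)) instead.
  have hleft : ∀ a b, Tendsto (fun e => ρ.ψ (E.q e) * (ρ.π a * b)) l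
      (𝓝 (ρ.ψ (E.q (E.α a)) * b)) := fun a b => by
    simp only [← mul_assoc, hψπ]
    exact ((hc.tendsto _).comp (hl.left (E.α a))).mul_const b
  have hright : ∀ a b, Tendsto (fun e => b * ρ.π a * ρ.ψ (E.q e)) l
      (𝓝 (b * ρ.ψ (E.q a))) := fun a b => by
    simp only [mul_assoc, hπψ]
    exact ((hc.tendsto _).comp (hl.right a)).const_mul b
  -- The vectors at which the bounded net converges form a closed set. It contains every π(a)b, and
  -- b is the limit of the vectors π(a)b as a runs along the approximate unit.
  obtain ⟨V, hV1, hV2⟩ := exists_multiplier_of_tendsto (w := fun e => ρ.ψ (E.q e)) hbound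
    (fun b => by
      refine (isClosed_setOf_exists_tendsto (T := fun e => LinearMap.mulLeft ℂ (ρ.ψ (E.q e)))
        (C := √‖E.L‖) ?_).mem_of_tendsto (hρ b) (Eventually.of_forall fun a => ⟨_, hleft a b⟩)
      filter_upwards [hbound] with e he b
      exact (norm_mul_le _ _).trans (by gcongr))
    (fun b => by
      -- Here bπ(e) → b is needed; it is the adjoint of the nondegeneracy hypothesis applied to b⋆.
      refine (isClosed_setOf_exists_tendsto (T := fun e => LinearMap.mulRight ℂ (ρ.ψ (E.q e)))
        (C := √‖E.L‖) ?_).mem_of_tendsto (star_star b ▸ hl.tendsto_star' ρ.π (hρ (star b)))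
        (Eventually.of_forall fun a => ⟨_, hright a b⟩)
      filter_upwards [hbound] with e he b
      rw [mul_comm √‖E.L‖]
      exact (norm_mul_le _ _).trans (by gcongr))
  have hπV : ∀ a, V.snd (ρ.π a) = ρ.ψ (E.q a) := fun a => by
    refine tendsto_nhds_unique (hV2 (ρ.π a)) ?_
    simp only [hπψ]
    exact (hc.tendsto _).comp (hl.right a)
  have hVπ : ∀ a b, V.fst (ρ.π a * b) = ρ.ψ (E.q (E.α a)) * b := fun a b =>
    tendsto_nhds_unique (hV1 _) (hleft a b)
  have hπV' : ∀ a b, ρ.π a * V.fst b = ρ.ψ (E.q a) * b := fun a b => by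
    rw [← hπV, V.central]
  -- Strict convergence includes convergence of right multiplications, so the adjoints ψ(q(e))⋆
  -- converge to V⋆ on the left.
  have hstar : ∀ b, Tendsto (fun e => star (ρ.ψ (E.q e)) * b) l (𝓝 ((star V).fst b)) :=
    fun b => by
      have h := (hV2 (star b)).star
      simpa only [star_mul, star_star, DoubleCentralizer.star_fst] using h
  refine ⟨⟨ρ.π, nondegenerate_of_tendsto _ hl hρ, V, fun a => multiplier_ext fun b => ?_,
    fun a => multiplier_ext fun b => ?_⟩, rfl, hπV⟩
  · change V.fst (ρ.π a * b) = ρ.π (E.α a) * V.fst b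
    rw [hVπ, hπV']
  · change (star V).fst (ρ.π a * V.fst b) = ρ.π (E.L a) * b
    refine tendsto_nhds_unique (hstar _) ?_
    -- Replacing V⋆ by ψ(q(e))⋆ turns V⋆π(a)Vb into ψ(q(e))⋆ψ(q(a))b = π(L(ea))b for self-adjoint e,
    -- and continuity of `L` gives the limit π(L(a))b.
    have h1 : Tendsto (fun e => ρ.π (E.L (e * a)) * b) l (𝓝 (ρ.π (E.L a) * b)) :=
      ((((continuous_hom ρ.π).comp E.L.continuous).tendsto a).comp (hl.left a)).mul_const b
    refine h1.congr' ?_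
    filter_upwards [hl.star_eq] with e he
    rw [hπV', ← mul_assoc, ρ.star_mul_map, E.ip_q, he]

end ToeplitzRep

/-! ### Positive functionals from the separation theorem -/

/-- Positive linear functionals separate the points of a C⋆-algebra. -/
theorem exists_positive_functional {A : Type u} [NonUnitalCStarAlgebra A] {a : A} (ha : a ≠ 0) :
    ∃ f : A →L[ℂ] ℂ, (∀ x, f (star x) = star (f x)) ∧ (∀ x, 0 ≤ (f (star x * x)).re) ∧
      f (star a * a) ≠ 0 := by
  let _ := CStarAlgebra.spectralOrder A
  have := CStarAlgebra.spectralOrderedRing A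
  -- The positive elements form a closed real cone, which does not contain -(a⋆a) for a ≠ 0. A real
  -- functional separating the two is nonnegative on the cone and strictly positive at a⋆a.
  let C : ProperCone ℝ A :=
    { carrier := {x | 0 ≤ x}
      add_mem' := fun {x y} (hx : 0 ≤ x) (hy : 0 ≤ y) => show 0 ≤ x + y from add_nonneg hx hy
      zero_mem' := le_refl (0 : A)
      smul_mem' := fun c x (hx : 0 ≤ x) => show 0 ≤ (c : ℝ) • x from smul_nonneg c.2 hx
      isClosed' := CStarAlgebra.isClosed_nonneg }
  have hC : -(star a * a) ∉ C := fun h => by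
    have h1 : 0 ≤ -(star a * a) := h
    have h2 := le_antisymm (neg_nonneg.1 h1) (star_mul_self_nonneg a)
    exact ha ((CStarRing.star_mul_self_eq_zero_iff a).1 h2)
  obtain ⟨g, hg, hga⟩ := C.hyperplane_separation_point hC
  -- The separating functional need not respect the involution. Symmetrizing it makes its
  -- complexification hermitian, at the cost of a factor 2 on self-adjoint elements.
  let h : A →L[ℝ] ℝ := g + g.comp ((starL' ℝ : A ≃L[ℝ] A) : A →L[ℝ] A)
  have hh : ∀ x, h x = g x + g (star x) := fun x => rfl
  have hsa : ∀ x, h (star x) = h x := fun x => by rw [hh, hh, star_star, add_comm]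
  let f : A →L[ℂ] ℂ := StrongDual.extendRCLike h
  have hf : ∀ x, f x = (h x : ℂ) - Complex.I * h (Complex.I • x) := fun x =>
    StrongDual.extendRCLike_apply h x
  have hre : ∀ x, (f (star x * x)).re = 2 * g (star x * x) := fun x => by
    rw [hf, hh, star_mul, star_star]
    simp [two_mul]
  refine ⟨f, fun x => ?_, fun x => ?_, fun h0 => ?_⟩
  · have h1 : h (Complex.I • star x) = - h (Complex.I • x) := by
      rw [← hsa (Complex.I • x), star_smul, Complex.star_def, Complex.conj_I, neg_smul, map_neg,
        neg_neg]
    rw [hf, hf, hsa, h1]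
    simp
  · rw [hre]
    exact mul_nonneg zero_le_two (hg _ (star_mul_self_nonneg x))
  · have h1 := hre a
    rw [h0, Complex.zero_re] at h1
    rw [map_neg] at hga
    linarith

/-! ### Bounded operators on a pre-Hilbert space and their completions -/

section Completion

open UniformSpace.Completion

variable {H : Type*} [SeminormedAddCommGroup H] [InnerProductSpace ℂ H] (S T : H →L[ℂ] H)

theorem completion_zero : (0 : H →L[ℂ] H).completion = 0 := by
  ext x
  induction x using induction_on with
  | hp => exact isClosed_eq (ContinuousLinearMap.continuous _) (ContinuousLinearMap.continuous _)
  | ih x => exact (ContinuousLinearMap.completion_apply_coe _ x).trans coe_zero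

theorem completion_smul (c : ℂ) : (c • T).completion = c • T.completion := by
  ext x
  induction x using induction_on with
  | hp => exact isClosed_eq (ContinuousLinearMap.continuous _) (ContinuousLinearMap.continuous _)
  | ih x => simp

theorem completion_add : (S + T).completion = S.completion + T.completion := by
  ext x
  induction x using induction_on with
  | hp => exact isClosed_eq (ContinuousLinearMap.continuous _) (ContinuousLinearMap.continuous _)
  | ih x => simp [coe_add]

theorem completion_mul : (S * T).completion = S.completion * T.completion := by
  ext x
  induction x using induction_on with
  | hp => exact isClosed_eq (ContinuousLinearMap.continuous _) (ContinuousLinearMap.continuous _)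
  | ih x => simp

variable {S T}

theorem completion_eq_star (h : ∀ x y, inner ℂ (S x) y = inner ℂ x (T y)) :
    S.completion = star T.completion := by
  refine (ContinuousLinearMap.eq_adjoint_iff _ _).2 fun x y => ?_
  induction x, y using induction_on₂ with
  | hp => apply isClosed_eq <;> fun_prop
  | ih x y => simpa using h x y

/-- The identity is checked weakly on the dense subspace. Thus S⋆T is identified without computing
S⋆ on the pre-Hilbert space, so no annihilation operators need be introduced. -/
theorem star_completion_mul {R : H →L[ℂ] H} (h : ∀ x y, inner ℂ (S x) (T y) = inner ℂ x (R y)) :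
    star S.completion * T.completion = R.completion := by
  ext y
  refine ext_inner_left ℂ fun x => ?_
  change inner ℂ x (ContinuousLinearMap.adjoint S.completion (T.completion y)) = _
  rw [ContinuousLinearMap.adjoint_inner_right]
  induction x, y using induction_on₂ with
  | hp => apply isClosed_eq <;> fun_prop
  | ih x y => simpa using h x y

end Completion

/-! ### The Fock representation of `M_L` attached to a positive functional -/

/-- A sequence of positive functionals `ω, ω ∘ L, ω ∘ L², …` on `A`. -/
structure FockData {A : Type u} [NonUnitalCStarAlgebra A] (E : ExelSystem A) where
  f : ℕ → A →ₗ[ℂ] ℂ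
  apply_star : ∀ n x, f n (star x) = star (f n x)
  nonneg : ∀ n x, 0 ≤ (f n (star x * x)).re
  succ : ∀ n x, f (n + 1) x = f n (E.L x)

namespace FockData

variable {A : Type u} [NonUnitalCStarAlgebra A] {E : ExelSystem A}

/-- The functionals are ω ∘ Lⁿ. They inherit hermitian symmetry and positivity from ω because `L`
preserves adjoints and maps elements c⋆c to elements of the same form. -/
theorem exists_of_functional (ω : A →ₗ[ℂ] ℂ) (h1 : ∀ x, ω (star x) = star (ω x))
    (h2 : ∀ x, 0 ≤ (ω (star x * x)).re) : ∃ F : FockData E, F.f 0 = ω := by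
  let f : ℕ → A →ₗ[ℂ] ℂ := fun n => n.rec ω fun _ g => g ∘ₗ (E.L : A →ₗ[ℂ] A)
  refine ⟨⟨f, fun n => ?_, fun n => ?_, fun n x => rfl⟩, rfl⟩
  · induction n with
    | zero => exact h1
    | succ n ih => exact fun x => (congrArg (f n) (E.L_star x)).trans (ih _)
  · induction n with
    | zero => exact h2
    | succ n ih =>
      intro x
      obtain ⟨c, hc⟩ := E.positive x
      change 0 ≤ (f n (E.L (star x * x))).re
      rw [hc]
      exact ih c

/-- A positive functional is applied to x⋆px ≤ ‖p‖ x⋆x. Applied layer by layer, this bounds all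
operators on the Fock space. -/
theorem re_conj_le (F : FockData E) (n : ℕ) {p : A} (hp : IsSelfAdjoint p) (x : A) :
    (F.f n (star x * (p * x))).re ≤ ‖p‖ * (F.f n (star x * x)).re := by
  let _ := CStarAlgebra.spectralOrder A
  have := CStarAlgebra.spectralOrderedRing A
  have h : star x * p * x ≤ ‖p‖ • (star x * x) := CStarAlgebra.star_left_conjugate_le_norm_smul hp
  obtain ⟨c, hc⟩ := CStarAlgebra.nonneg_iff_eq_star_mul_self.1 (sub_nonneg.2 h)
  have h1 := F.nonneg n c
  rw [← hc, ← Complex.coe_smul, map_sub, map_smul, mul_assoc] at h1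
  simpa using h1

/-- The algebraic Fock space: the finitely supported sequences in `A`, with the pre-inner product
`⟪x, y⟫ = ∑ ω(Lⁿ(xₙ⋆ yₙ))`. -/
def Pre (_F : FockData E) : Type u := ℕ →₀ A

variable (F : FockData E)

instance : AddCommGroup F.Pre := inferInstanceAs (AddCommGroup (ℕ →₀ A))
instance : Module ℂ F.Pre := inferInstanceAs (Module ℂ (ℕ →₀ A))

/-- The pre-inner product of the algebraic Fock space. -/
def form (x y : ℕ →₀ A) : ℂ := x.sum fun n a => F.f n (star a * y n)

theorem form_single (n : ℕ) (a : A) (y : ℕ →₀ A) :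
    F.form (Finsupp.single n a) y = F.f n (star a * y n) :=
  Finsupp.sum_single_index (by rw [star_zero, zero_mul, map_zero])

theorem form_add_left (x y z : ℕ →₀ A) : F.form (x + y) z = F.form x z + F.form y z :=
  Finsupp.sum_add_index' (fun n => by rw [star_zero, zero_mul, map_zero])
    fun n a b => by rw [star_add, add_mul, map_add]

theorem form_smul_left (c : ℂ) (x y : ℕ →₀ A) : F.form (c • x) y = star c * F.form x y := by
  rw [form, Finsupp.sum_smul_index' fun n => by rw [star_zero, zero_mul, _root_.map_zero]]
  simp only [star_smul, smul_mul_assoc, map_smul]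
  exact Finsupp.smul_sum.symm

theorem form_zero_left (z : ℕ →₀ A) : F.form 0 z = 0 := Finsupp.sum_zero_index

theorem form_add_right (x y z : ℕ →₀ A) : F.form x (y + z) = F.form x y + F.form x z := by
  rw [form, form, form, ← Finsupp.sum_add]
  simp only [Finsupp.add_apply, mul_add, map_add]

theorem star_form (x y : ℕ →₀ A) : star (F.form x y) = F.form y x := by
  induction x using Finsupp.induction_linear with
  | zero => simp [form]
  | add x z hx hz => rw [form_add_left, form_add_right, star_add, hx, hz]
  | single n a =>
    induction y using Finsupp.induction_linear with
    | zero => simp [form]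
    | add x z hx hz => rw [form_add_left, form_add_right, star_add, hx, hz]
    | single m b =>
      rw [form_single, form_single, ← F.apply_star, star_mul, star_star]
      rcases eq_or_ne n m with rfl | h
      · simp
      · simp [h, h.symm]

theorem form_re_nonneg (x : ℕ →₀ A) : 0 ≤ (F.form x x).re := by
  rw [form, Finsupp.sum, Complex.re_sum]
  exact Finset.sum_nonneg fun n _ => F.nonneg n _

/-- The pre-inner product space structure of the algebraic Fock space. -/
abbrev core : PreInnerProductSpace.Core ℂ F.Pre where
  inner x y := F.form x y
  conj_inner_symm x y := F.star_form y x
  re_inner_nonneg := F.form_re_nonneg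
  add_left := F.form_add_left
  smul_left x y c := by
    exact F.form_smul_left c x y

instance : SeminormedAddCommGroup F.Pre :=
  InnerProductSpace.Core.toSeminormedAddCommGroup (c := F.core)
instance : InnerProductSpace ℂ F.Pre := InnerProductSpace.ofCore F.core

theorem inner_pre (x y : F.Pre) : inner ℂ x y = F.form x y := rfl

/-- The Fock space. -/
abbrev Space : Type u := UniformSpace.Completion F.Pre

/-- Left multiplication by `a` on the algebraic Fock space. -/
def mulₗ (a : A) : (ℕ →₀ A) →ₗ[ℂ] (ℕ →₀ A) := Finsupp.mapRange.linearMap (LinearMap.mulLeft ℂ a)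

/-- The creation operator of `q(a)` on the algebraic Fock space. -/
def createₗ (E : ExelSystem A) (a : A) : (ℕ →₀ A) →ₗ[ℂ] (ℕ →₀ A) :=
  Finsupp.lmapDomain A ℂ Nat.succ ∘ₗ
    Finsupp.mapRange.linearMap (LinearMap.mulLeft ℂ a ∘ₗ (E.α : A →ₗ[ℂ] A))

theorem mulₗ_apply (a : A) (x : ℕ →₀ A) (n : ℕ) : mulₗ a x n = a * x n := rfl

theorem mulₗ_single (a : A) (n : ℕ) (b : A) :
    mulₗ a (Finsupp.single n b) = Finsupp.single n (a * b) :=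
  Finsupp.mapRange_single (hf := map_zero _)

theorem mulₗ_mulₗ (a b : A) (x : ℕ →₀ A) : mulₗ a (mulₗ b x) = mulₗ (a * b) x :=
  Finsupp.ext fun n => (mul_assoc a b (x n)).symm

theorem createₗ_single (a : A) (n : ℕ) (b : A) :
    createₗ E a (Finsupp.single n b) = Finsupp.single (n + 1) (a * E.α b) := by
  rw [createₗ, LinearMap.comp_apply, Finsupp.mapRange.linearMap_apply, Finsupp.mapRange_single,
    Finsupp.lmapDomain_apply, Finsupp.mapDomain_single]
  rfl

theorem createₗ_succ (a : A) (x : ℕ →₀ A) (n : ℕ) :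
    createₗ E a x (n + 1) = a * E.α (x n) :=
  Finsupp.mapDomain_apply Nat.succ_injective _ _

theorem form_mulₗ (a : A) (x y : ℕ →₀ A) :
    F.form (mulₗ a x) y = F.form x (mulₗ (star a) y) := by
  induction x using Finsupp.induction_linear with
  | zero => rw [map_zero, form_zero_left, form_zero_left]
  | add x z hx hz => rw [map_add, form_add_left, form_add_left, hx, hz]
  | single n b => rw [mulₗ_single, form_single, form_single, mulₗ_apply, star_mul, mul_assoc]

/-- Layer n + 1 carries the functional ω ∘ Lⁿ ∘ L, and the transfer identity on both sides gives
L(α(c⋆) a⋆b α(d)) = c⋆ L(a⋆b) d. This is the relation ψ(q(a))⋆ψ(q(b)) = π(L(a⋆b)) for creation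
operators. -/
theorem form_createₗ (a b : A) (x y : ℕ →₀ A) :
    F.form (createₗ E a x) (createₗ E b y) = F.form x (mulₗ (E.L (star a * b)) y) := by
  induction x using Finsupp.induction_linear with
  | zero => rw [map_zero, form_zero_left, form_zero_left]
  | add x z hx hz => rw [map_add, form_add_left, form_add_left, hx, hz]
  | single n c =>
    rw [createₗ_single, form_single, form_single, createₗ_succ, mulₗ_apply, F.succ, star_mul,
      ← map_star E.α, ← E.L_mul_α, ← E.L_α_mul]
    simp only [mul_assoc]

theorem form_mulₗ_le {p : A} (hp : IsSelfAdjoint p) (x : ℕ →₀ A) :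
    (F.form x (mulₗ p x)).re ≤ ‖p‖ * (F.form x x).re := by
  rw [form, form, Finsupp.sum, Finsupp.sum, Complex.re_sum, Complex.re_sum, Finset.mul_sum]
  exact Finset.sum_le_sum fun n _ => F.re_conj_le n hp _

/-- An operator `T` on the algebraic Fock space with `T⋆ T = p` is bounded. -/
theorem norm_le_of_form {T : F.Pre →ₗ[ℂ] F.Pre} {p : A} (hp : IsSelfAdjoint p)
    (h : ∀ x, F.form (T x) (T x) = F.form x (mulₗ p x)) (x : F.Pre) : ‖T x‖ ≤ √‖p‖ * ‖x‖ := by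
  refine (pow_le_pow_iff_left₀ (norm_nonneg _) (by positivity) two_ne_zero).1 ?_
  rw [mul_pow, Real.sq_sqrt (norm_nonneg _), ← inner_self_eq_norm_sq (𝕜 := ℂ),
    ← inner_self_eq_norm_sq (𝕜 := ℂ), inner_pre, inner_pre, h]
  exact F.form_mulₗ_le hp x

/-- Left multiplication by `a` on the Fock space. -/
def mul (a : A) : F.Pre →L[ℂ] F.Pre :=
  LinearMap.mkContinuous (mulₗ a : F.Pre →ₗ[ℂ] F.Pre) √‖star a * a‖ <|
    F.norm_le_of_form (IsSelfAdjoint.star_mul_self a) fun x =>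
      (F.form_mulₗ a x _).trans (congrArg (F.form x) (mulₗ_mulₗ _ a x))

/-- The creation operator of `q(a)` on the Fock space. -/
def create (a : A) : F.Pre →L[ℂ] F.Pre :=
  LinearMap.mkContinuous (createₗ E a : F.Pre →ₗ[ℂ] F.Pre) √‖E.L (star a * a)‖ <|
    -- The creation operator T satisfies T⋆T = L(a⋆a), so its norm is at most ‖L(a⋆a)‖^(1/2) =
    -- ‖q(a)‖.
    F.norm_le_of_form (by
      rw [IsSelfAdjoint, ← E.L_star, star_mul, star_star]) fun x => F.form_createₗ a a x x

theorem createₗ_smul (c : ℂ) (a : A) : createₗ E (c • a) = c • createₗ E a :=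
  Finsupp.lhom_ext fun n b => by
    rw [LinearMap.smul_apply, createₗ_single, createₗ_single, Finsupp.smul_single, smul_mul_assoc]

theorem createₗ_add (a b : A) : createₗ E (a + b) = createₗ E a + createₗ E b :=
  Finsupp.lhom_ext fun n c => by
    rw [LinearMap.add_apply, createₗ_single, createₗ_single, createₗ_single,
      ← Finsupp.single_add, add_mul]

theorem createₗ_mulₗ (a b : A) (x : ℕ →₀ A) :
    createₗ E a (mulₗ b x) = createₗ E (a * E.α b) x := by
  have h : createₗ E a ∘ₗ mulₗ b = createₗ E (a * E.α b) := Finsupp.lhom_ext fun n c => by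
    rw [LinearMap.comp_apply, mulₗ_single, createₗ_single, createₗ_single, _root_.map_mul,
      mul_assoc]
  exact LinearMap.congr_fun h x

theorem mulₗ_createₗ (a b : A) (x : ℕ →₀ A) :
    mulₗ a (createₗ E b x) = createₗ E (a * b) x := by
  have h : mulₗ a ∘ₗ createₗ E b = createₗ E (a * b) := Finsupp.lhom_ext fun n c => by
    rw [LinearMap.comp_apply, createₗ_single, createₗ_single, mulₗ_single, mul_assoc]
  exact LinearMap.congr_fun h x

/-- The representation of `A` on the Fock space. -/
def π : A →⋆ₙₐ[ℂ] (F.Space →L[ℂ] F.Space) where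
  toFun a := (F.mul a).completion
  map_smul' c a := by
    rw [← completion_smul]
    congr 1
    ext x
    exact Finsupp.ext fun n => smul_mul_assoc c a ((show ℕ →₀ A from x) n)
  map_zero' := by
    rw [← completion_zero]
    congr 1
    ext x
    exact Finsupp.ext fun n => zero_mul ((show ℕ →₀ A from x) n)
  map_add' a b := by
    rw [← completion_add]
    congr 1
    ext x
    exact Finsupp.ext fun n => add_mul a b ((show ℕ →₀ A from x) n)
  map_mul' a b := by
    rw [← completion_mul]
    congr 1
    ext x
    exact (mulₗ_mulₗ a b x).symm
  map_star' a := completion_eq_star fun x y =>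
    (F.form_mulₗ (star a) x y).trans (congrArg (fun b => F.form x (mulₗ b y)) (star_star a))

/-- The map sending `a` to the creation operator of `q(a)`. -/
def createLin : A →ₗ[ℂ] (F.Space →L[ℂ] F.Space) where
  toFun a := (F.create a).completion
  map_smul' c a := by
    rw [RingHom.id_apply, ← completion_smul]
    congr 1
    ext x
    exact LinearMap.congr_fun (createₗ_smul c a) x
  map_add' a b := by
    rw [← completion_add]
    congr 1
    ext x
    exact LinearMap.congr_fun (createₗ_add a b) x

theorem star_createLin_mul (a b : A) :
    star (F.createLin a) * F.createLin b = F.π (E.L (star a * b)) :=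
  star_completion_mul fun x y => F.form_createₗ a b x y

theorem createLin_mul_π (a b : A) : F.createLin a * F.π b = F.createLin (a * E.α b) := by
  refine (completion_mul _ _).symm.trans (congrArg ContinuousLinearMap.completion ?_)
  ext x
  exact createₗ_mulₗ a b x

theorem π_mul_createLin (a b : A) : F.π a * F.createLin b = F.createLin (a * b) := by
  refine (completion_mul _ _).symm.trans (congrArg ContinuousLinearMap.completion ?_)
  ext x
  exact mulₗ_createₗ a b x

/-- Without a unit in `A` there is no vacuum vector in layer 0, so the approximate unit replaces it.
With ξ_b denoting b placed in layer 0, ⟪ξ_a, π(a)ξ_e⟫ = ω(a⋆ae) → ω(a⋆a) ≠ 0, where ω = `F.f 0`. -/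
theorem π_ne_zero {a : A} (ha : F.f 0 (star a * a) ≠ 0) (hc : Continuous (F.f 0)) : F.π a ≠ 0 := by
  intro h
  obtain ⟨l, hl⟩ := exists_isApproxUnit A
  have := hl.neBot
  refine ha (tendsto_nhds_unique (f := fun e => F.f 0 (star a * (a * e))) (l := l) ?_ ?_)
  · exact (hc.tendsto _).comp ((hl.right a).const_mul (star a))
  · refine tendsto_const_nhds.congr fun e => ?_
    let ξ : A → F.Pre := fun b => (Finsupp.single 0 b : ℕ →₀ A)
    have h1 : F.π a (ξ e : F.Space) = 0 := by rw [h]; rfl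
    have h2 := congrArg (inner ℂ (ξ a : F.Space)) h1
    change inner ℂ _ ((F.mul a).completion _) = _ at h2
    rw [ContinuousLinearMap.completion_apply_coe, UniformSpace.Completion.inner_coe,
      inner_zero_right] at h2
    have h3 := F.form_single 0 a (mulₗ a (Finsupp.single 0 e))
    rw [mulₗ_apply, Finsupp.single_eq_same] at h3
    exact h2.symm.trans h3

/-- The Toeplitz representation of `M_L` on the Fock space. -/
theorem exists_toeplitzRep : ∃ ρ : ToeplitzRep A E.ML (F.Space →L[ℂ] F.Space), ρ.π = F.π := by
  -- This bound lets a ↦ `createLin a` factor through `q` and extend to the completion M_L. The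
  -- three Toeplitz relations are then verified on q(A) and extended by density.
  have hb : ∀ a, ‖F.createLin a‖ ≤ 1 * ‖E.q a‖ := fun a => by
    refine (pow_le_pow_iff_left₀ (norm_nonneg _) (by positivity) two_ne_zero).1 ?_
    rw [one_mul, E.norm_q_sq, pow_two, ← CStarRing.norm_star_mul_self, star_createLin_mul]
    exact NonUnitalStarAlgHom.norm_apply_le F.π _
  let ψ : E.ML →L[ℂ] (F.Space →L[ℂ] F.Space) := LinearMap.extendOfNorm F.createLin E.q
  have hψ : ∀ a, ψ (E.q a) = F.createLin a :=
    fun a => LinearMap.extendOfNorm_eq E.denseRange_q ⟨1, hb⟩ a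
  refine ⟨⟨ψ, F.π, fun x a => ?_, fun x y => ?_, fun a x => ?_⟩, rfl⟩
  · refine congrFun (ExelSystem.ext_q (f := fun x => ψ (E.rightML a x))
      (g := fun x => ψ x * F.π a) (by fun_prop) (by fun_prop) fun m => ?_) x
    rw [E.rightML_q, hψ, hψ, createLin_mul_π]
  · refine E.denseRange_q.induction_on₂ (p := fun x y => star (ψ x) * ψ y = F.π (E.ipML x y))
      (isClosed_eq (by fun_prop)
        ((continuous_hom F.π).comp (E.continuous_ipML continuous_fst continuous_snd)))
      (fun m n => ?_) x y
    rw [hψ, hψ, E.ipML_q, star_createLin_mul]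
  · refine congrFun (ExelSystem.ext_q (f := fun x => ψ (E.leftML a x))
      (g := fun x => F.π a * ψ x) (by fun_prop) (by fun_prop) fun m => ?_) x
    rw [E.leftML_q, hψ, hψ, π_mul_createLin]

end FockData

/-! ### Faithfulness of the canonical homomorphism into the Toeplitz crossed product -/

theorem ToeplitzRep.isCoisometricOn_bot {A : Type u} {M : Type v} [NonUnitalCStarAlgebra A]
    [NormedAddCommGroup M] [NormedSpace ℂ M] [HilbertBimodule A M] {B : Type w}
    [NonUnitalCStarAlgebra B] (ρ : ToeplitzRep A M B) :
    ρ.IsCoisometricOn (bot_le : (⊥ : Submodule ℂ A) ≤ J A M) := by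
  intro a ha
  obtain rfl := (Submodule.mem_bot ℂ).1 ha
  refine (congrArg ρ.onCompacts (Subtype.ext ?_)).trans
    ((map_zero ρ.onCompacts).trans (map_zero ρ.π).symm)
  exact map_zero _

/-- The canonical homomorphism of `A` into the Toeplitz crossed product is injective. -/
theorem ExelSystem.Toeplitz.i_injective {A : Type u} [NonUnitalCStarAlgebra A]
    (E : ExelSystem A) : Function.Injective (Toeplitz.i E) := by
  rw [injective_iff_map_eq_zero]
  intro a ha
  by_contra h0
  obtain ⟨ω, h1, h2, h3⟩ := exists_positive_functional h0
  obtain ⟨F, hF⟩ := FockData.exists_of_functional (E := E) (ω : A →ₗ[ℂ] ℂ) h1 h2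
  obtain ⟨ρ, hρ⟩ := F.exists_toeplitzRep
  obtain ⟨l, hl⟩ := exists_isApproxUnit A
  -- The Fock representation need not be nondegenerate in the sense of norm density of π(A)B(H) in
  -- B(H), so it need not come from a Toeplitz-covariant representation. The detour through 𝒪(0,
  -- M_L) repairs this: k_A is nondegenerate there, which yields `σ`, and the Fock representation
  -- factors through 𝒪(0, M_L) since coisometricity on the zero ideal is no condition.
  obtain ⟨σ, hσ, -⟩ := (RelCP.rep (bot_le : (⊥ : Submodule ℂ A) ≤ J A E.ML)).exists_toeplitzCovRep
    hl (hl.tendsto_kA_mul _)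
  have h4 := congrArg (RelCP.lift _ ρ ρ.isCoisometricOn_bot) (congrArg (Toeplitz.lift σ) ha)
  rw [Toeplitz.lift_i, hσ, map_zero, map_zero] at h4
  have h5 : F.π a = 0 := by
    rw [← hρ, ← h4]
    exact (RelCP.lift_kA _ ρ _ a).symm
  refine F.π_ne_zero (by rw [hF]; exact h3) ?_ h5
  rw [hF]
  exact ω.continuous

/-! ### Compact operators seen through a Toeplitz representation -/

section OnCompacts

variable {A : Type u} {M : Type v} [NonUnitalCStarAlgebra A] [NormedAddCommGroup M]
  [NormedSpace ℂ M] [HilbertBimodule A M] {B : Type w} [NonUnitalCStarAlgebra B]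

namespace ToeplitzRep

theorem norm_ψ_of_injective (ρ : ToeplitzRep A M B) (h : Function.Injective ρ.π) (x : M) :
    ‖ρ.ψ x‖ = ‖x‖ := by
  have h1 : ‖ρ.ψ x‖ ^ 2 = ‖x‖ ^ 2 := by
    rw [pow_two, ← CStarRing.norm_star_mul_self, ρ.star_mul_map, norm_sq (A := A),
      NonUnitalStarAlgHom.norm_map _ h]
  exact (pow_left_inj₀ (norm_nonneg _) (norm_nonneg _) two_ne_zero).1 h1

/-- The formula holds for finite-rank operators, and both sides are continuous in `T`. -/
theorem onCompacts_mul_ψ (ρ : ToeplitzRep A M B) (T : compacts A M) (z : M) :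
    ρ.onCompacts T * ρ.ψ z = ρ.ψ ((T : M →L[ℂ] M) z) := by
  refine denseRange_finiteRank.induction_on
    (p := fun T : compacts A M => ρ.onCompacts T * ρ.ψ z = ρ.ψ ((T : M →L[ℂ] M) z)) T
    (isClosed_eq (ρ.onCompacts.continuous.mul continuous_const)
      (ρ.continuous_ψ.comp (continuous_subtype_val.clm_apply continuous_const))) fun c => ?_
  rw [onCompacts_finiteRank, onFiniteRank_mul_ψ]

theorem onCompacts_mem_closure (ρ : ToeplitzRep A M B) (T : compacts A M) :
    ρ.onCompacts T ∈ closure (Set.range ρ.onFiniteRank) := by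
  refine denseRange_finiteRank.induction_on
    (p := fun T : compacts A M => ρ.onCompacts T ∈ closure (Set.range ρ.onFiniteRank)) T
    (isClosed_closure.preimage ρ.onCompacts.continuous) fun c => subset_closure ⟨c, ?_⟩
  exact (ρ.onCompacts_finiteRank c).symm

/-- If `π` is injective, an element `k` of `closure (span ψ(M) ψ(M)⋆)` that implements an operator
`T` on `M` is the image of `T`, which is therefore compact. -/
theorem exists_onCompacts_eq (ρ : ToeplitzRep A M B) (h : Function.Injective ρ.π) {k : B}
    (hk : k ∈ closure (Set.range ρ.onFiniteRank)) {T : M →L[ℂ] M}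
    (hT : ∀ z, k * ρ.ψ z = ρ.ψ (T z)) :
    ∃ hc : T ∈ compacts A M, ρ.onCompacts ⟨T, hc⟩ = k := by
  obtain ⟨s, hs, hsk⟩ := mem_closure_iff_seq_limit.1 hk
  choose c hc using hs
  obtain rfl : s = fun n => ρ.onFiniteRank (c n) := funext fun n => (hc n).symm
  -- With π injective, ψ is isometric. The finite-rank operator and `T` are implemented by
  -- `ρ.onFiniteRank (c n)` and `k`, so the norm of their difference at z equals ‖(`ρ.onFiniteRank
  -- (c n)` - k)ψ(z)‖. Norm convergence in `B` therefore forces operator-norm convergence on `M`.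
  have hle : ∀ n, ‖(finiteRank A M (c n) : M →L[ℂ] M) - T‖ ≤ ‖ρ.onFiniteRank (c n) - k‖ :=
    fun n => ContinuousLinearMap.opNorm_le_bound _ (norm_nonneg _) fun z => by
      rw [sub_apply, ← ρ.norm_ψ_of_injective h, map_sub, ← hT, ← onFiniteRank_mul_ψ,
        ← sub_mul, ← ρ.norm_ψ_of_injective h z]
      exact norm_mul_le _ _
  have hlim : Tendsto (fun n => (finiteRank A M (c n) : M →L[ℂ] M)) atTop (𝓝 T) :=
    tendsto_iff_norm_sub_tendsto_zero.2 (squeeze_zero (fun _ => norm_nonneg _) hle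
      (tendsto_iff_norm_sub_tendsto_zero.1 hsk))
  have hcpt : T ∈ compacts A M :=
    (Submodule.isClosed_topologicalClosure _).mem_of_tendsto hlim
      (Eventually.of_forall fun n => (finiteRank A M (c n)).2)
  have hlim' : Tendsto (fun n => finiteRank A M (c n)) atTop (𝓝 ⟨T, hcpt⟩) :=
    tendsto_subtype_rng.2 hlim
  refine ⟨hcpt, tendsto_nhds_unique ?_ hsk⟩
  simpa only [Function.comp_def, onCompacts_finiteRank] using
    (ρ.onCompacts.continuous.tendsto _).comp hlim'

theorem coe_range_onFiniteRank (ρ : ToeplitzRep A M B) :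
    (Set.range ρ.onFiniteRank : Set B) =
      Submodule.span ℂ (Set.range fun p : M × M => ρ.ψ p.1 * star (ρ.ψ p.2)) := by
  rw [← Finsupp.range_linearCombination]
  rfl

end ToeplitzRep

end OnCompacts

/-! ### Kernels, generated ideals and factorization through quotients -/

namespace ClosedIdeal

variable {T : Type u} [NonUnitalCStarAlgebra T] {B : Type v} [NonUnitalCStarAlgebra B]

/-- The kernel of a homomorphism of C⋆-algebras. -/
def ker (f : T →⋆ₙₐ[ℂ] B) : ClosedIdeal T where
  toSubmodule := LinearMap.ker (f : T →ₗ[ℂ] B)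
  isClosed' := isClosed_singleton.preimage (continuous_hom f)
  mul_left' t x hx := by
    change f (t * x) = 0
    rw [map_mul, show f x = 0 from hx, mul_zero]
  mul_right' t x hx := by
    change f (x * t) = 0
    rw [map_mul, show f x = 0 from hx, zero_mul]
  star_mem' {x} hx := by
    change f (star x) = 0
    rw [map_star, show f x = 0 from hx, star_zero]

theorem subset_generatedBy (s : Set T) : s ⊆ (generatedBy s).toSubmodule := fun x hx => by
  refine (Submodule.mem_sInf).2 ?_
  rintro J ⟨hs, -⟩
  exact hs hx

theorem generatedBy_le {s : Set T} {I : ClosedIdeal T} (h : s ⊆ I.toSubmodule) :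
    (generatedBy s).toSubmodule ≤ I.toSubmodule :=
  sInf_le ⟨h, I, rfl⟩

/-- A homomorphism which vanishes on a closed ideal factors through the quotient. -/
theorem exists_quot_lift (I : ClosedIdeal T) (f : T →⋆ₙₐ[ℂ] B) (h : ∀ x ∈ I.toSubmodule, f x = 0) :
    ∃ g : I.Quot →⋆ₙₐ[ℂ] B, ∀ x, g (I.proj x) = f x := by
  -- A representative is chosen in each class; since `f` kills the ideal, its value does not depend
  -- on the choice.
  let g : I.Quot → B := fun x => f (I.proj_surjective x).choose
  have hg : ∀ x, g (I.proj x) = f x := fun x => by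
    have h1 := (I.mkL_eq).1 (I.proj_surjective (I.proj x)).choose_spec
    exact sub_eq_zero.1 ((map_sub f _ _).symm.trans (h _ h1))
  refine ⟨{ toFun := g, map_smul' := fun c x => ?_, map_zero' := ?_, map_add' := fun x y => ?_,
            map_mul' := fun x y => ?_, map_star' := fun x => ?_ }, hg⟩
  · obtain ⟨x, rfl⟩ := I.proj_surjective x
    rw [← map_smul, hg, hg, map_smul]
    rfl
  · rw [← map_zero I.proj, hg, map_zero]
  · obtain ⟨x, rfl⟩ := I.proj_surjective x
    obtain ⟨y, rfl⟩ := I.proj_surjective y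
    rw [← map_add, hg, hg, hg, map_add]
  · obtain ⟨x, rfl⟩ := I.proj_surjective x
    obtain ⟨y, rfl⟩ := I.proj_surjective y
    change g (I.proj x * I.proj y) = g (I.proj x) * g (I.proj y)
    rw [← map_mul, hg, hg, hg, map_mul]
  · obtain ⟨x, rfl⟩ := I.proj_surjective x
    rw [← map_star, hg, hg, map_star]

end ClosedIdeal

/-! ### Redundancies as compact operators, and the homomorphisms between the two algebras -/

namespace ExelSystem

variable {A : Type u} [NonUnitalCStarAlgebra A] (E : ExelSystem A)

open Toeplitz in
-- Here i(b)S = ψ_S(q(b)) and S⋆i(c) = ψ_S(q(c⋆))⋆, and q(A) is dense in M_L. The subspace in the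
-- definition of a redundancy is thus the one in which (ψ_S, i)⁽¹⁾ takes its values.
theorem closure_range_onFiniteRank_canonical :
    closure (Set.range (canonical E).toToeplitzRep.onFiniteRank) =
      (Submodule.span ℂ {x : E.Toeplitz | ∃ b c, x =
        (S E).snd (i E b) * (star (S E)).fst (i E c)}).topologicalClosure := by
  have hSc : ∀ c, (star (S E)).fst (i E c) = star (psiS E (E.q (star c))) := fun c => by
    rw [DoubleCentralizer.star_fst, ← map_star (i E)]
    exact congrArg star ((canonical E).psi_q _).symm
  have hSb : ∀ b, (S E).snd (i E b) = psiS E (E.q b) := fun b => ((canonical E).psi_q b).symm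
  rw [ToeplitzRep.coe_range_onFiniteRank]
  refine Set.Subset.antisymm ?_ (closure_mono (Submodule.span_mono ?_))
  · refine closure_minimal ?_ isClosed_closure
    rw [SetLike.coe_subset_coe, Submodule.span_le]
    rintro _ ⟨⟨x, y⟩, rfl⟩
    refine E.denseRange_q.induction_on₂ (p := fun x y => psiS E x * star (psiS E y) ∈
      ((Submodule.span ℂ {x : E.Toeplitz | ∃ b c, x =
        (S E).snd (i E b) * (star (S E)).fst (i E c)}).topologicalClosure : Set E.Toeplitz))
      (isClosed_closure.preimage (by fun_prop)) (fun b c => ?_) x y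
    refine subset_closure (Submodule.subset_span ⟨b, star c, ?_⟩)
    rw [hSc, hSb, star_star]
  · rintro _ ⟨b, c, rfl⟩
    exact ⟨(E.q b, E.q (star c)), by rw [hSc, hSb]; rfl⟩

open Toeplitz in
/-- The redundancies of `(A, α, L)` are the pairs `(i(a), (ψ_S, i)⁽¹⁾(φ(a)))` with `a ∈ J(M_L)`. -/
theorem isRedundancy_iff (a : A) (k : E.Toeplitz) : E.IsRedundancy a k ↔
    ∃ ha : a ∈ J A E.ML, (canonical E).toToeplitzRep.onCompacts ⟨φ a, ha⟩ = k := by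
  have hψ : ∀ b, (S E).snd (i E b) = (canonical E).toToeplitzRep.ψ (E.q b) :=
    fun b => ((canonical E).psi_q b).symm
  rw [IsRedundancy, ← SetLike.mem_coe, ← closure_range_onFiniteRank_canonical]
  constructor
  · rintro ⟨hk, h⟩
    -- Injectivity of i enters here. The redundancy relation says that k implements φ(a) on
    -- ψ_S(q(A)), and density extends this to all of ψ_S(M_L).
    refine (canonical E).toToeplitzRep.exists_onCompacts_eq (i_injective E) hk fun z => ?_
    refine congrFun (ext_q (f := fun z => k * psiS E z)
      (g := fun z => psiS E ((φ a : E.ML →L[ℂ] E.ML) z)) (by fun_prop) (by fun_prop) fun b => ?_) z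
    refine Eq.trans ?_ ((canonical E).toToeplitzRep.map_lsmul a (E.q b)).symm
    have h1 := h b
    rw [hψ] at h1
    exact h1.symm
  · rintro ⟨ha, rfl⟩
    refine ⟨ToeplitzRep.onCompacts_mem_closure _ _, fun b => ?_⟩
    rw [hψ, ToeplitzRep.onCompacts_mul_ψ]
    exact ((canonical E).toToeplitzRep.map_lsmul a (E.q b)).symm

/-- Both sides are continuous, and on q(a) they are Q(i(a)S) and Q(i(a))Q̄(S), which agree by the
definition of Q̄. -/
theorem Q_psiS (m : E.ML) : E.Q (Toeplitz.psiS E m) = E.psiQS m := by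
  refine congrFun (ext_q (f := fun m => E.Q (Toeplitz.psiS E m)) (g := fun m => E.psiQS m)
    ((continuous_hom E.Q).comp (Toeplitz.psiS E).continuous) E.psiQS.continuous fun a => ?_) m
  exact (congrArg E.Q ((Toeplitz.canonical E).psi_q a)).trans (E.crossedProductRep.psi_q a).symm

/-- The Toeplitz representation `(Q ∘ ψ_S, Q ∘ i)` of `M_L` in `A ⋊_{α,L} ℕ`. -/
def quotientRep : ToeplitzRep A E.ML E.CrossedProduct :=
  (Toeplitz.canonical E).toToeplitzRep.map E.Q

/-- For a in K_α, the pair formed by i(a) and (ψ_S, i)⁽¹⁾(φ(a)) is a redundancy with a in the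
closure of Aα(A)A. The difference of its entries is one of the generators killed by Q. -/
theorem quotientRep_isCoisometricOn : E.quotientRep.IsCoisometricOn E.Kα_le := by
  intro a ha
  rw [quotientRep, ToeplitzRep.map_onCompacts]
  refine (sub_eq_zero.1 ?_).symm
  refine (map_sub E.Q _ _).symm.trans (E.redundancyIdeal.proj_eq_zero.2 ?_)
  exact ClosedIdeal.subset_generatedBy _
    ⟨a, ha.1, _, (E.isRedundancy_iff a _).2 ⟨E.Kα_le ha, rfl⟩, rfl⟩

/-- The canonical representation of 𝒪(K_α, M_L) is nondegenerate, hence comes from a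
Toeplitz-covariant representation. The induced homomorphism on 𝒯(A, α, L) respects redundancies
because (k_M, k_A) is coisometric on K_α. -/
theorem exists_hom_relCP : ∃ Λ : E.CrossedProduct →⋆ₙₐ[ℂ] RelCP E.Kα_le,
    (∀ a, Λ (E.Q (Toeplitz.i E a)) = RelCP.kA E.Kα_le a) ∧
    ∀ m, Λ (E.Q (Toeplitz.psiS E m)) = RelCP.kM E.Kα_le m := by
  obtain ⟨l, hl⟩ := exists_isApproxUnit A
  obtain ⟨σ, hσ1, hσ2⟩ := (RelCP.rep E.Kα_le).exists_toeplitzCovRep hl (hl.tendsto_kA_mul _)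
  have hi : ∀ a, Toeplitz.lift σ (Toeplitz.i E a) = RelCP.kA E.Kα_le a := fun a => by
    rw [Toeplitz.lift_i, hσ1]
    rfl
  have hψ : ∀ m, Toeplitz.lift σ (Toeplitz.psiS E m) = RelCP.kM E.Kα_le m := fun m => by
    refine congrFun (ext_q (f := fun m => Toeplitz.lift σ (Toeplitz.psiS E m))
      (g := fun m => RelCP.kM E.Kα_le m)
      ((continuous_hom _).comp (Toeplitz.psiS E).continuous) (RelCP.rep E.Kα_le).continuous_ψ
      fun a => ?_) m
    refine (congrArg (Toeplitz.lift σ) ((Toeplitz.canonical E).psi_q a)).trans ?_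
    rw [Toeplitz.canonical_πV, Toeplitz.lift_iS, hσ2]
    rfl
  have hmap : (Toeplitz.canonical E).toToeplitzRep.map (Toeplitz.lift σ) = RelCP.rep E.Kα_le :=
    ToeplitzRep.ext' hψ hi
  -- The kernel of `Toeplitz.lift σ` is a closed ideal, so it is enough that it contains the
  -- generators of the redundancy ideal.
  obtain ⟨Λ, hΛ⟩ := E.redundancyIdeal.exists_quot_lift (Toeplitz.lift σ) fun x hx => by
    refine ClosedIdeal.generatedBy_le (I := ClosedIdeal.ker (Toeplitz.lift σ)) ?_ hx
    rintro _ ⟨a, ha, k, hk, rfl⟩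
    -- A redundancy forces a ∈ J(M_L). Together with a in the closure of Aα(A)A this gives a ∈ K_α,
    -- and k is sent to (k_M, k_A)⁽¹⁾(φ(a)) = k_A(a).
    obtain ⟨haJ, rfl⟩ := (E.isRedundancy_iff a k).1 hk
    change Toeplitz.lift σ (_ - _) = 0
    rw [map_sub, ← ToeplitzRep.map_onCompacts, hmap, hi, sub_eq_zero]
    exact (RelCP.rep_isCoisometricOn E.Kα_le a ⟨ha, haJ⟩).symm
  exact ⟨Λ, fun a => (hΛ _).trans (hi a), fun m => (hΛ _).trans (hψ m)⟩

/-! ### Homomorphisms are determined on generators; the isomorphism -/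

theorem crossedProduct_hom_ext {B : Type*} [NonUnitalCStarAlgebra B]
    {f g : E.CrossedProduct →⋆ₙₐ[ℂ] B}
    (hi : ∀ a, f (E.Q (Toeplitz.i E a)) = g (E.Q (Toeplitz.i E a)))
    (hψ : ∀ m, f (E.Q (Toeplitz.psiS E m)) = g (E.Q (Toeplitz.psiS E m)))
    (x : E.CrossedProduct) : f x = g x := by
  obtain ⟨x, rfl⟩ := E.redundancyIdeal.proj_surjective x
  change f (E.Q x) = g (E.Q x)
  -- The generators i(a)S of 𝒯(A, α, L) are the values ψ_S(q(a)).
  have hS : ∀ a, f (E.Q (Toeplitz.iS E a)) = g (E.Q (Toeplitz.iS E a)) := fun a => by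
    have h := hψ (E.q a)
    rwa [show Toeplitz.psiS E (E.q a) = Toeplitz.iS E a from
      ((Toeplitz.canonical E).psi_q a).trans (Toeplitz.canonical_πV E a)] at h
  refine Toeplitz.induction E (p := fun x => f (E.Q x) = g (E.Q x))
    (isClosed_eq ((continuous_hom f).comp (continuous_hom E.Q))
      ((continuous_hom g).comp (continuous_hom E.Q))) hi hS (fun a => ?_) (fun x y hx hy => ?_) ?_
    (fun x y hx hy => ?_) (fun c x hx => ?_) x
  · rw [map_star E.Q, map_star, map_star, hS]
  · rw [map_add E.Q, map_add, map_add, hx, hy]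
  · rw [map_zero E.Q, map_zero, map_zero]
  · rw [map_mul E.Q, map_mul, map_mul, hx, hy]
  · rw [map_smul E.Q, map_smul, map_smul, hx]

end ExelSystem

theorem RelCP.hom_ext {A M : Type u} [NonUnitalCStarAlgebra A] [NormedAddCommGroup M]
    [NormedSpace ℂ M] [HilbertBimodule A M] {K : Submodule ℂ A} {hK : K ≤ J A M} {B : Type*}
    [NonUnitalCStarAlgebra B] {f g : RelCP hK →⋆ₙₐ[ℂ] B}
    (hA : ∀ a, f (kA hK a) = g (kA hK a)) (hM : ∀ m, f (kM hK m) = g (kM hK m))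
    (x : RelCP hK) : f x = g x := by
  refine RelCP.induction hK (p := fun x => f x = g x)
    (isClosed_eq (continuous_hom f) (continuous_hom g)) hA hM (fun m => ?_) (fun x y hx hy => ?_)
    ?_ (fun x y hx hy => ?_) (fun c x hx => ?_) x
  · rw [map_star, map_star, hM]
  · rw [map_add, map_add, hx, hy]
  · rw [map_zero, map_zero]
  · rw [map_mul, map_mul, hx, hy]
  · rw [map_smul, map_smul, hx]

end ExelCP

end

theorem theorem4p1 {A : Type u} [NonUnitalCStarAlgebra A] (E : ExelCP.ExelSystem A) :
    ∃ θ : ExelCP.RelCP E.Kα_le ≃⋆ₐ[ℂ] E.CrossedProduct,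
      (∀ a : A, θ (ExelCP.RelCP.kA E.Kα_le a) = E.Q (ExelCP.ExelSystem.Toeplitz.i E a)) ∧
      (∀ m : E.ML, θ (ExelCP.RelCP.kM E.Kα_le m) =
        E.Q (ExelCP.ExelSystem.Toeplitz.psiS E m)) ∧
      (∀ m : E.ML, E.Q (ExelCP.ExelSystem.Toeplitz.psiS E m) = E.psiQS m) := by
  obtain ⟨Λ, hΛA, hΛM⟩ := E.exists_hom_relCP
  let Θ := ExelCP.RelCP.lift E.Kα_le E.quotientRep E.quotientRep_isCoisometricOn
  have hA : ∀ a, Θ (ExelCP.RelCP.kA E.Kα_le a) = E.Q (ExelCP.ExelSystem.Toeplitz.i E a) :=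
    ExelCP.RelCP.lift_kA _ _ _
  have hM : ∀ m, Θ (ExelCP.RelCP.kM E.Kα_le m) = E.Q (ExelCP.ExelSystem.Toeplitz.psiS E m) :=
    ExelCP.RelCP.lift_kM _ _ _
  -- Each composite fixes the images of `A` and of M_L, which generate the algebra, so it is the
  -- identity.
  have hleft : ∀ x, Λ (Θ x) = x :=
    ExelCP.RelCP.hom_ext (f := Λ.comp Θ) (g := NonUnitalStarAlgHom.id ℂ _)
      (fun a => (congrArg Λ (hA a)).trans (hΛA a)) fun m => (congrArg Λ (hM m)).trans (hΛM m)
  have hright : ∀ x, Θ (Λ x) = x :=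
    E.crossedProduct_hom_ext (f := Θ.comp Λ) (g := NonUnitalStarAlgHom.id ℂ _)
      (fun a => (congrArg Θ (hΛA a)).trans (hA a)) fun m => (congrArg Θ (hΛM m)).trans (hM m)
  exact ⟨StarAlgEquiv.ofBijective Θ
    ⟨Function.LeftInverse.injective hleft, Function.RightInverse.surjective hright⟩,
    hA, hM, E.Q_psiS⟩
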